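/- Let $\xi$ be a complex-valued random variable with $\mathbb{E}[\xi]=0$, $\sigma_1^2:=\mathbb{E}[(\Re\xi)^2]<\infty$, $\sigma_2^2:=\mathbb{E}[(\Im\xi)^2]<\infty$ ($\sigma_1,\sigma_2\ge 0$), $\sigma^2:=\sigma_1^2+\sigma_2^2>0$ and $\mathrm{Cov}[\Re\xi,\Im\xi]=0$, and let $(\xi_k)_{k\ge 0}$ be independent copies of $\xi$. Let $\alpha>-1/2$ and let $b:[0,\infty)\to\mathbb{R}$ be measurable and regularly varying at $+\infty$ with index $\alpha$, that is, $b(x)=x^{\alpha}\ell(x)$ for $x>0$, where $\ell$ is measurable and eventually positive and $\ell(\lambda x)/\ell(x)\to 1$ as $x\to+\infty$ for every $\lambda>0$. For $m\in\mathbb{N}$ put $$K_m(z):=1+\sum_{k=1}^{m}b(k)\xi_k z^k+\sum_{k=1}^{m}b(k)\overline{\xi_k}\,z^{2m+1-k}+z^{2m+1}.$$ Let $M_p(\mathbb{R})$ be the space of locally finite integer-valued measures on $\mathbb{R}$ with the topology of vague convergence and, for a real-analytic $f\not\equiv 0$ on $\mathbb{R}$, let $\mathsf{Zeros}_{\mathbb{R}}(f)\in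 M_p(\mathbb{R})$ be the counting measure of its real zeros, with multiplicities. Let $G_0$ be a centred Gaussian analytic function on $\mathbb{C}$ (a random entire function whose finite-dimensional distributions are jointly Gaussian) with $$\mathbb{E}[G_0(u)\overline{G_0(v)}]=\sigma^2\int_0^1x^{2\alpha}e^{x(u+\overline v)}\,dx,\qquad \mathbb{E}[G_0(u)G_0(v)]=(\sigma_1^2-\sigma_2^2)\int_0^1x^{2\alpha}e^{x(u+v)}\,dx,\qquad u,v\in\mathbb{C},$$ and put $\widetilde{\mathfrak G}(t):=2\Re\bigl(e^{-it}G_0(it)\bigr)$, $t\in\mathbb{R}$. Then: 1. Such a $G_0$ exists, and almost surely $\widetilde{\mathfrak G}$ has no multiple real zeros. 2. As $m\to\infty$, the point processes $\mathsf{Zeros}_{\mathbb{R}}\bigl(t\mapsto K_m(e^{it/m})\bigr)$ converge in distribution on $M_p(\mathbb{R})$ to $\mathsf{Zeros}_{\mathbb{R}}(\widetilde{\mathfrak G})$. 3. Let $B_1,B_2$ be independent standard real Brownian motions and let integrals against them be understood pathwise, by integration by parts: $\int_0^1\varphi\,dB_j:=\varphi(1)B_j(1)-\int_0^1B_j(x)\varphi'(x)\,dx$.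 Almost surely, for all $u\in\mathbb{C}$ and $t\in\mathbb{R}$ and for each of the functions $\varphi(x)=x^{\alpha}e^{ux}$, $x^{\alpha}\cos(t(x-1))$, $x^{\alpha}\sin(t(x-1))$, the function $B_j\varphi'$ is integrable on $[0,1]$ and $\varphi(x)B_j(x)\to 0$ as $x\to0+$. The process $u\mapsto\int_0^1x^{\alpha}e^{ux}\,dB(x)$, $B:=\sigma_1B_1+i\sigma_2B_2$, is a Gaussian analytic function with the above mean and covariances. For this version of $G_0$, almost surely, for all $t\in\mathbb{R}$, $$\widetilde{\mathfrak G}(t)=2\sigma_1\int_0^1x^{\alpha}\cos(t(x-1))\,dB_1(x)-2\sigma_2\int_0^1x^{\alpha}\sin(t(x-1))\,dB_2(x),$$ and for every version of $G_0$ the two sides have the same finite-dimensional distributions. -/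

import Mathlib

open MeasureTheory ProbabilityTheory Filter Topology
open scoped NNReal ENNReal ComplexConjugate

noncomputable section

/-! ### Regular variation -/

/-- A (Karamata) slowly varying function at `+∞`: measurable on `(0, ∞)`, eventually positive, and
`ℓ (c x) / ℓ x → 1` as `x → ∞` for every `c > 0`. Values on `(-∞, 0]` play no role. -/
structure IsSlowlyVarying (l : ℝ → ℝ) : Prop where
  measurable : Measurable (fun x : Set.Ioi (0 : ℝ) => l x)
  eventually_pos : ∀ᶠ x in atTop, 0 < l x
  tendsto : ∀ c : ℝ, 0 < c → Tendsto (fun x => l (c * x) / l x) atTop (𝓝 1)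

/-- `b : [0, ∞) → ℝ` is measurable and regularly varying at `+∞` with index `α`:
`b x = x ^ α * ℓ x` for `x > 0`, with `ℓ` slowly varying. Values on `(-∞, 0)` play no role. -/
structure IsRegularlyVarying (b : ℝ → ℝ) (α : ℝ) : Prop where
  measurable : Measurable (fun x : Set.Ici (0 : ℝ) => b x)
  exists_eq : ∃ l : ℝ → ℝ, IsSlowlyVarying l ∧ ∀ x : ℝ, 0 < x → b x = x ^ α * l x

/-! ### The self-inversive polynomials -/

/-- `K_m(z) = 1 + ∑_{k=1}^m b(k) x_k z^k + ∑_{k=1}^m b(k) conj(x_k) z^(2m+1-k) + z^(2m+1)`. -/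
def selfInversive (b : ℝ → ℝ) (x : ℕ → ℂ) (m : ℕ) (z : ℂ) : ℂ :=
  1 + ∑ k ∈ Finset.Icc 1 m, (b k : ℂ) * x k * z ^ k
    + ∑ k ∈ Finset.Icc 1 m, (b k : ℂ) * conj (x k) * z ^ (2 * m + 1 - k)
    + z ^ (2 * m + 1)

/-! ### The space of point measures with the vague topology -/

/-- Locally finite measures whose values are nonnegative integers or `∞`. -/
def IsPointMeasure {X : Type*} [TopologicalSpace X] [MeasurableSpace X] (μ : Measure X) : Prop :=
  IsLocallyFiniteMeasure μ ∧ ∀ s, MeasurableSet s → μ s = ⊤ ∨ ∃ n : ℕ, μ s = n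

/-- The space `M_p(X)` of locally finite integer-valued measures on `X`. -/
def PointMeasure (X : Type*) [TopologicalSpace X] [MeasurableSpace X] : Type _ :=
  {μ : Measure X // IsPointMeasure μ}

/-- The vague topology: the coarsest one for which `μ ↦ ∫ f dμ` is continuous for every continuous
compactly supported `f : X → ℝ`. -/
instance PointMeasure.instTopologicalSpace (X : Type*) [TopologicalSpace X] [MeasurableSpace X] :
    TopologicalSpace (PointMeasure X) :=
  TopologicalSpace.induced
    (fun (μ : PointMeasure X) (f : CompactlySupportedContinuousMap X ℝ) => ∫ x, f x ∂μ.1)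
    inferInstance

instance PointMeasure.instMeasurableSpace (X : Type*) [TopologicalSpace X] [MeasurableSpace X] :
    MeasurableSpace (PointMeasure X) :=
  borel (PointMeasure X)

instance PointMeasure.instBorelSpace (X : Type*) [TopologicalSpace X] [MeasurableSpace X] :
    BorelSpace (PointMeasure X) :=
  ⟨rfl⟩

/-! ### The point process of real zeros -/

section Zeros

variable {E : Type*} [NormedAddCommGroup E] [NormedSpace ℝ E]

/-- The sum of unit point masses at the zeros of `f` on the real line, counted with multiplicity
(the multiplicity of a zero `t` is the order of vanishing of the real-analytic function `f`
at `t`; the order is `0` at the points that are not zeros). -/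
def zeroMeasure (f : ℝ → E) : Measure ℝ :=
  Measure.sum fun t : ℝ => (analyticOrderNatAt f t : ℝ≥0∞) • Measure.dirac t

theorem zeroMeasure_apply (f : ℝ → E) {s : Set ℝ} (hs : MeasurableSet s) :
    zeroMeasure f s = ∑' t : ℝ, ((s.indicator (analyticOrderNatAt f) t : ℕ) : ℝ≥0∞) := by
  classical
  rw [zeroMeasure, Measure.sum_apply _ hs]
  refine tsum_congr fun t => ?_
  by_cases ht : t ∈ s <;> simp [Measure.dirac_apply' _ hs, ht]

theorem tsum_natCast_eq (a : ℝ → ℕ) :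
    (∑' t, (a t : ℝ≥0∞)) = ⊤ ∨ ∃ n : ℕ, (∑' t, (a t : ℝ≥0∞)) = n := by
  by_cases h : (∑' t, (a t : ℝ≥0∞)) = ⊤
  · exact Or.inl h
  · right
    have hfin : {t | (1 : ℝ≥0∞) ≤ a t}.Finite :=
      ENNReal.finite_const_le_of_tsum_ne_top h one_ne_zero
    refine ⟨∑ t ∈ hfin.toFinset, a t, ?_⟩
    rw [tsum_eq_sum (s := hfin.toFinset)]
    · push_cast
      rfl
    · intro t ht
      simp only [Set.Finite.mem_toFinset, Set.mem_ofPred_eq, Nat.one_le_cast, not_le,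
        Nat.lt_one_iff] at ht
      simp [ht]

/-- The zeros of a real-analytic function that is not identically zero form a locally finite
configuration. -/
theorem isPointMeasure_zeroMeasure {f : ℝ → E} (hf : AnalyticOnNhd ℝ f Set.univ)
    (h0 : ∃ t, f t ≠ 0) : IsPointMeasure (zeroMeasure f) := by
  refine ⟨⟨fun x => ?_⟩, fun s hs => ?_⟩
  · have hx : ∀ᶠ t in 𝓝[≠] x, f t ≠ 0 := by
      rcases (hf x (Set.mem_univ x)).eventually_eq_zero_or_eventually_ne_zero with h | h
      · obtain ⟨t, ht⟩ := h0
        exact absurd (hf.eqOn_zero_of_preconnected_of_eventuallyEq_zero isPreconnected_univ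
          (Set.mem_univ x) h (Set.mem_univ t)) ht
      · exact h
    obtain ⟨U, hUsub, hUo, hxU⟩ := eventually_nhds_iff.1 (eventually_nhdsWithin_iff.1 hx)
    refine ⟨U, hUo.mem_nhds hxU, ?_⟩
    rw [zeroMeasure_apply f hUo.measurableSet, tsum_eq_single x]
    · exact ENNReal.natCast_lt_top _
    · intro t ht
      by_cases htU : t ∈ U
      · have hft : f t ≠ 0 := hUsub t htU ht
        have : analyticOrderNatAt f t = 0 := by
          rw [analyticOrderNatAt, (hf t (Set.mem_univ t)).analyticOrderAt_eq_zero.2 hft]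
          rfl
        simp [this]
      · simp [htU]
  · rw [zeroMeasure_apply f hs]
    exact tsum_natCast_eq _

theorem isPointMeasure_zero : IsPointMeasure (0 : Measure ℝ) :=
  ⟨inferInstance, fun _ _ => Or.inr ⟨0, by simp⟩⟩

open Classical in
/-- The point process of real zeros of `f`, with multiplicities, as an element of `M_p(ℝ)`, for
a real-analytic `f` that is not identically zero (and, by convention, the zero measure for any
other `f`). -/
def realZeros (f : ℝ → E) : PointMeasure ℝ :=
  if h : AnalyticOnNhd ℝ f Set.univ ∧ ∃ t, f t ≠ 0 then
    ⟨zeroMeasure f, isPointMeasure_zeroMeasure h.1 h.2⟩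
  else ⟨0, isPointMeasure_zero⟩

end Zeros

/-! ### The limiting Gaussian analytic function -/

/-- `G` is a version of the Gaussian analytic function `G_0`: a random entire function on the
probability space `(Ω, P)` whose finite-dimensional distributions are (jointly, over `ℝ`) Gaussian
and centred, with
`E[G(u) conj(G(v))] = (σ₁² + σ₂²) ∫₀¹ x^(2α) exp(x (u + conj v)) dx` and
`E[G(u) G(v)] = (σ₁² - σ₂²) ∫₀¹ x^(2α) exp(x (u + v)) dx`. -/
structure IsLimitGAF {Ω : Type*} [MeasurableSpace Ω] (σ₁ σ₂ α : ℝ) (G : Ω → ℂ → ℂ)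
    (P : Measure Ω) : Prop where
  entire : ∀ᵐ ω ∂P, Differentiable ℂ (G ω)
  gaussian : IsGaussianProcess (fun (u : ℂ) (ω : Ω) => G ω u) P
  centred : ∀ u : ℂ, ∫ ω, G ω u ∂P = 0
  covariance : ∀ u v : ℂ, ∫ ω, G ω u * conj (G ω v) ∂P =
    ((σ₁ ^ 2 + σ₂ ^ 2 : ℝ) : ℂ) *
      ∫ x in (0 : ℝ)..1, ((x ^ (2 * α) : ℝ) : ℂ) * Complex.exp (x * (u + conj v))
  pseudoCovariance : ∀ u v : ℂ, ∫ ω, G ω u * G ω v ∂P =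
    ((σ₁ ^ 2 - σ₂ ^ 2 : ℝ) : ℂ) *
      ∫ x in (0 : ℝ)..1, ((x ^ (2 * α) : ℝ) : ℂ) * Complex.exp (x * (u + v))

/-- `t ↦ 2 Re (exp (-i t) g (i t))`, for `t` real. -/
def tildeTransform (g : ℂ → ℂ) (t : ℝ) : ℝ :=
  2 * (Complex.exp (-(Complex.I * t)) * g (Complex.I * t)).re

/-! ### Pathwise stochastic integrals over `[0, 1]` -/

section PathIntegral

variable {E : Type*} [NormedAddCommGroup E] [NormedSpace ℝ E]

/-- The integral `∫₀¹ φ dW` along the path `W` can be formed by integration by parts, with no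
boundary contribution at `0`: `φ` is differentiable on `(0, 1]`, `W φ'` is integrable on `[0, 1]`
and `W(x) φ(x) → 0` as `x → 0+`. -/
structure PathIntegrable (W : ℝ≥0 → ℝ) (φ : ℝ → E) : Prop where
  differentiable : ∀ x ∈ Set.Ioc (0 : ℝ) 1, DifferentiableAt ℝ φ x
  integrable : IntervalIntegrable (fun x => W x.toNNReal • deriv φ x) volume 0 1
  boundary : Tendsto (fun x : ℝ => W x.toNNReal • φ x) (𝓝[>] 0) (𝓝 0)

/-- The pathwise integral `∫₀¹ φ dW = W(1) φ(1) - ∫₀¹ W(x) φ'(x) dx`; meaningful when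
`PathIntegrable W φ`. -/
def pathIntegral (W : ℝ≥0 → ℝ) (φ : ℝ → E) : E :=
  W 1 • φ 1 - ∫ x in (0 : ℝ)..1, W x.toNNReal • deriv φ x

end PathIntegral

/-- `x ↦ x^α exp(u x)`. -/
def expKernel (α : ℝ) (u : ℂ) (x : ℝ) : ℂ := ((x ^ α : ℝ) : ℂ) * Complex.exp (u * x)

/-- `x ↦ x^α cos(t (x - 1))`. -/
def cosKernel (α t x : ℝ) : ℝ := x ^ α * Real.cos (t * (x - 1))

/-- `x ↦ x^α sin(t (x - 1))`. -/
def sinKernel (α t x : ℝ) : ℝ := x ^ α * Real.sin (t * (x - 1))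

/-- `∫₀¹ x^α exp(u x) dB(x)` for the complex path `B = σ₁ W₁ + i σ₂ W₂`. -/
def integralGAF (σ₁ σ₂ α : ℝ) (W₁ W₂ : ℝ≥0 → ℝ) (u : ℂ) : ℂ :=
  σ₁ * pathIntegral W₁ (expKernel α u) + Complex.I * σ₂ * pathIntegral W₂ (expKernel α u)

/-- `2 σ₁ ∫₀¹ x^α cos(t (x - 1)) dW₁(x) - 2 σ₂ ∫₀¹ x^α sin(t (x - 1)) dW₂(x)`. -/
def integralTilde (σ₁ σ₂ α : ℝ) (W₁ W₂ : ℝ≥0 → ℝ) (t : ℝ) : ℝ :=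
  2 * σ₁ * pathIntegral W₁ (cosKernel α t) - 2 * σ₂ * pathIntegral W₂ (sinKernel α t)

end

/-!
On the unit circle `K_m` equals a phase times a real trigonometric polynomial: by self-inversiveness,
`exp (-i t (2m+1) / (2m)) K_m (exp (i t / m))` is real for real `t` (`phaseReduced`). So the zeros in
question are those of this function divided by `b(m) √m`, a random real entire function `F_m` whose
value at `t` is a weighted sum of the `ξ_k` plus a negligible deterministic term. The proof compares
`F_m` with its limit `Y = tildeTransform G` in three respects.

*Finite-dimensional distributions.* For a regularly varying `b` of index `α > -1/2`, the sums
`∑ b(k)² f(k/m) / (m b(m)²)` tend to `∫₀¹ x^(2α) f(x) dx`: the uniform convergence theorem gives the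
pointwise limit of the summands, and Potter's bound an integrable majorant
(`IsRegularlyVarying.tendsto_sum_sq`). This is the convergence of variances in a Lindeberg central
limit theorem (`tendsto_integral_exp_sum`), which identifies the limit of the joint characteristic
functions of `F_m` as those of `Y` (`tendsto_integral_exp_phaseReduced`).

*Tightness and continuity.* The frequencies of `F_m` are bounded, so the second moment of its `n`-th
derivative at the origin grows at most geometrically in `n`, uniformly in `m`. With probability close
to one the sequence of derivatives therefore lies in a compact box (`coeffBox`), on which the entire
function depends continuously on the sequence. A function of the box is determined by its values at a
dense set of points, so the convergence of characteristic functions and compactness bound the limsup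
of the probability of any closed set of the box. By a real form of Hurwitz's theorem
(`tendsto_realZeros`) the point process of real zeros, with the vague topology, is continuous at
functions all of whose real zeros are simple. Hence the zeros converge in law as soon as `Y` almost
surely has simple zeros (`tendstoInDistribution_realZeros`). That the zeros form a random element
at all, multiplicities included, comes from recovering the counting measure as a limit of the measures
with density `1 / (2ε)` on `{|f| < ε |f'|}`.

*Simple zeros.* At a multiple zero `Y` is quadratically small, so on a grid of mesh `1/n` one of about
`n` Gaussian variables is `O(n⁻²)`; if their variances are bounded below this has probability
`O(n⁻¹)`. The variance of `Y t` vanishes at most at `t = 0`, and there only if `σ₁ = 0`. In this case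
it is at least of order `t²`, and a multiple zero at `0` forces `Y t / t` to be small, a Gaussian
variable of variance bounded below.

It remains to construct the Gaussian analytic function. It is `σ₁ Z₁ + i σ₂ Z₂` for independent copies
`Z₁`, `Z₂` of the Gaussian integral of `x^α exp (u x)`; the notion `IsWienerPair` records the variances
of real linear combinations of the real and imaginary parts of such a pair, from which all covariances
follow by polarisation. One pair is obtained from a Gaussian sequence with the Gram matrix of
`x^(α+n)`, `n ∈ ℕ`, in `L²(0, 1)` as the power series with these coefficients (`exists_isLimitGAF`).
Another is given by two independent Brownian motions: their paths are `O(x^γ)` at the origin for every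
`γ < 1/2`, and some such `γ` has `γ + α > 0`, so that `x^α exp (u x)` can be integrated by parts
against them. The resulting integral is a limit of Riemann–Stieltjes sums, whose Gaussian laws have
explicit variances (`hasLaw_pathIntegral_add`). The trigonometric representation of `Y` is then the
linearity of the pathwise integral (`tildeTransform_integralGAF`), and the law of `Y` depends only on
the mean and the covariances of `G`.
-/

/-! ### Regular variation -/

/-- The uniform convergence theorem for slowly varying functions, in additive form. The sets of
shifts that are bad for `x` and for `x + u` both have small measure, so some shift is good for both,
and the triangle inequality applies. -/
theorem exists_forall_abs_sub_lt_of_tendsto {h : ℝ → ℝ} (hm : Measurable h)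
    (H : ∀ u, Tendsto (fun x => h (x + u) - h x) atTop (𝓝 0)) {ε A : ℝ} (hε : 0 < ε) (hA : 0 < A) :
    ∃ X, ∀ x, X ≤ x → ∀ u, 0 ≤ u → u ≤ A → |h (x + u) - h x| < ε := by
  by_contra! hcon
  choose x hx u hu0 huA hbad using fun n : ℕ => hcon (n : ℝ)
  have hxt : Tendsto x atTop atTop :=
    tendsto_atTop_mono hx tendsto_natCast_atTop_atTop
  have hyt : Tendsto (fun n => x n + u n) atTop atTop :=
    tendsto_atTop_mono (fun n => le_add_of_nonneg_right (hu0 n)) hxt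
  -- pointwise convergence in the shift gives convergence in measure on `[0, 2A]`
  have key : ∀ y : ℕ → ℝ, Tendsto y atTop atTop →
      Tendsto (fun n => (volume.restrict (Set.Icc 0 (2 * A)))
        {v | ε / 2 ≤ dist (h (y n + v) - h (y n)) 0}) atTop (𝓝 0) := by
    intro y hy
    have : TendstoInMeasure (volume.restrict (Set.Icc 0 (2 * A)))
        (fun n v => h (y n + v) - h (y n)) atTop (fun _ => (0 : ℝ)) := by
      refine tendstoInMeasure_of_tendsto_ae (fun n => ?_) ?_
      · exact (by fun_prop : Measurable fun v => h (y n + v) - h (y n)).aestronglyMeasurable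
      · exact Eventually.of_forall fun v => (H v).comp hy
    exact (tendstoInMeasure_iff_dist.1 this) (ε / 2) (by positivity)
  have h1 := (key x hxt).eventually_lt_const
    (show (0 : ℝ≥0∞) < ENNReal.ofReal (A / 2) by simpa using hA)
  have h2 := (key _ hyt).eventually_lt_const
    (show (0 : ℝ≥0∞) < ENNReal.ofReal (A / 2) by simpa using hA)
  obtain ⟨n, hn1, hn2⟩ := (h1.and h2).exists
  have hms : ∀ y : ℝ, MeasurableSet {v | ε / 2 ≤ dist (h (y + v) - h y) 0} := fun y =>
    measurableSet_le measurable_const (by fun_prop)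
  rw [Measure.restrict_apply (hms _)] at hn1 hn2
  set S1 := {v | ε / 2 ≤ dist (h (x n + v) - h (x n)) 0} ∩ Set.Icc 0 (2 * A)
  set S2 := {v | ε / 2 ≤ dist (h (x n + u n + v) - h (x n + u n)) 0} ∩ Set.Icc 0 (2 * A)
  -- an interval of length `A` is not covered by two bad sets of measure less than `A / 2`
  have hsub : Set.Icc (u n) (u n + A) ⊆ S1 ∪ (fun w => u n + w) '' S2 := by
    intro z hz
    by_contra hz'
    have hzI : z ∈ Set.Icc 0 (2 * A) := ⟨(hu0 n).trans hz.1, by linarith [hz.2, huA n]⟩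
    have hwI : z - u n ∈ Set.Icc 0 (2 * A) := ⟨by linarith [hz.1], by linarith [hz.2]⟩
    simp only [Set.mem_union, not_or] at hz'
    have a1 : |h (x n + z) - h (x n)| < ε / 2 := by
      by_contra hc
      exact hz'.1 ⟨by simpa [Real.dist_eq] using hc, hzI⟩
    have a2 : |h (x n + z) - h (x n + u n)| < ε / 2 := by
      by_contra hc
      refine hz'.2 ⟨z - u n, ⟨?_, hwI⟩, by simp⟩
      have : x n + u n + (z - u n) = x n + z := by ring
      simpa [Real.dist_eq, this] using hc
    have := hbad n
    have h3 : h (x n + u n) - h (x n) =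
      (h (x n + z) - h (x n)) - (h (x n + z) - h (x n + u n)) := by ring
    rw [h3] at this
    linarith [abs_sub (h (x n + z) - h (x n)) (h (x n + z) - h (x n + u n))]
  have := measure_mono (μ := volume) hsub
  have h4 : volume ((fun w => u n + w) '' S2) = volume S2 := by
    rw [Set.image_add_left, measure_preimage_add]
  have h5 := this.trans (measure_union_le _ _)
  rw [h4, Real.volume_Icc] at h5
  have h6 := h5.trans_lt (ENNReal.add_lt_add hn1 hn2)
  rw [← ENNReal.ofReal_add (by positivity) (by positivity)] at h6
  simp at h6

/-- Potter's bound in additive form. -/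
theorem exists_forall_abs_sub_le_of_tendsto {h : ℝ → ℝ} (hm : Measurable h)
    (H : ∀ u, Tendsto (fun x => h (x + u) - h x) atTop (𝓝 0)) {δ : ℝ} (hδ : 0 < δ) :
    ∃ X, ∀ x, X ≤ x → ∀ y, x ≤ y → |h y - h x| ≤ δ * (y - x) + δ := by
  obtain ⟨X, hX⟩ := exists_forall_abs_sub_lt_of_tendsto hm H hδ one_pos
  refine ⟨X, fun x hx y hxy => ?_⟩
  have step : ∀ n : ℕ, ∀ r : ℝ, 0 ≤ r → r ≤ 1 → |h (x + r + n) - h x| ≤ δ * n + δ := by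
    intro n
    induction n with
    | zero => intro r h0 h1; simpa using (hX x hx r h0 h1).le
    | succ n ih =>
      intro r h0 h1
      have a := ih r h0 h1
      have c := hX (x + r + n) (by linarith [n.cast_nonneg (α := ℝ)]) 1 zero_le_one le_rfl
      have e : h (x + r + (n + 1 : ℕ)) - h x
          = (h (x + r + n + 1) - h (x + r + n)) + (h (x + r + n) - h x) := by
        push_cast; rw [← add_assoc]; ring
      rw [e]
      push_cast
      linarith [abs_add_le (h (x + r + n + 1) - h (x + r + n)) (h (x + r + n) - h x)]
  have hf := Nat.floor_le (sub_nonneg.2 hxy)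
  have hl := Nat.lt_floor_add_one (y - x)
  have := step ⌊y - x⌋₊ (y - x - ⌊y - x⌋₊) (by linarith) (by linarith)
  have e : x + (y - x - ⌊y - x⌋₊) + ⌊y - x⌋₊ = y := by ring
  rw [e] at this
  nlinarith

theorem IsSlowlyVarying.measurable_log_comp_exp {l : ℝ → ℝ} (hl : IsSlowlyVarying l) :
    Measurable fun x => Real.log (l (Real.exp x)) := by
  have : Measurable fun x : ℝ => (⟨Real.exp x, Real.exp_pos x⟩ : Set.Ioi (0 : ℝ)) :=
    Real.measurable_exp.subtype_mk
  exact Real.measurable_log.comp (hl.measurable.comp this)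

theorem IsSlowlyVarying.tendsto_log_sub {l : ℝ → ℝ} (hl : IsSlowlyVarying l) (u : ℝ) :
    Tendsto (fun x => Real.log (l (Real.exp (x + u))) - Real.log (l (Real.exp x))) atTop (𝓝 0) := by
  have h1 := (hl.tendsto (Real.exp u) (Real.exp_pos u)).comp Real.tendsto_exp_atTop
  have h2 := h1.log one_ne_zero
  rw [Real.log_one] at h2
  refine h2.congr' ?_
  have hp := Real.tendsto_exp_atTop.eventually hl.eventually_pos
  have hp' := (tendsto_atTop_add_const_right atTop u tendsto_id).eventually hp
  filter_upwards [hp, hp'] with x h3 h4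
  simp only [id] at h4
  simp only [Function.comp]
  rw [← Real.exp_add, add_comm u x, Real.log_div h4.ne' h3.ne']

namespace IsRegularlyVarying

variable {b : ℝ → ℝ} {α : ℝ}

/-- Logarithmic form of regular variation: `b x = exp (α log x + h (log x))` for large `x`, with `h`
as in the additive uniform convergence theorem. -/
theorem exists_eq_exp (hb : IsRegularlyVarying b α) : ∃ (h : ℝ → ℝ) (X : ℝ), Measurable h ∧
    (∀ u, Tendsto (fun x => h (x + u) - h x) atTop (𝓝 0)) ∧ 1 ≤ X ∧
    ∀ x, X ≤ x → b x = Real.exp (α * Real.log x + h (Real.log x)) := by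
  obtain ⟨l, hl, hbl⟩ := hb.exists_eq
  obtain ⟨X, hX⟩ := eventually_atTop.1 hl.eventually_pos
  refine ⟨fun x => Real.log (l (Real.exp x)), max X 1, hl.measurable_log_comp_exp,
    hl.tendsto_log_sub, le_max_right _ _, fun x hx => ?_⟩
  have hx0 : 0 < x := lt_of_lt_of_le one_pos ((le_max_right _ _).trans hx)
  simp only [Real.exp_log hx0]
  rw [hbl x hx0, Real.exp_add,
    Real.exp_log (hX x ((le_max_left _ _).trans hx)), Real.rpow_def_of_pos hx0, mul_comm α]

theorem eventually_pos (hb : IsRegularlyVarying b α) : ∀ᶠ x in atTop, 0 < b x := by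
  obtain ⟨h, X, -, -, -, hX⟩ := hb.exists_eq_exp
  filter_upwards [eventually_ge_atTop X] with x hx
  rw [hX x hx]
  exact Real.exp_pos _

/-- Potter's bound. -/
theorem exists_div_le (hb : IsRegularlyVarying b α) {δ : ℝ} (hδ : 0 < δ) :
    ∃ X : ℝ, 1 ≤ X ∧ ∀ x, X ≤ x → 0 < b x ∧
      ∀ y, x ≤ y → b x / b y ≤ Real.exp δ * (x / y) ^ (α - δ) := by
  obtain ⟨h, X, hm, H, hX1, hX⟩ := hb.exists_eq_exp
  obtain ⟨Y, hY⟩ := exists_forall_abs_sub_le_of_tendsto hm H hδ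
  refine ⟨max X (Real.exp Y), hX1.trans (le_max_left _ _), fun x hx => ?_⟩
  have hxX := (le_max_left _ _).trans hx
  have hx0 : 0 < x := by linarith
  refine ⟨by rw [hX x hxX]; exact Real.exp_pos _, fun y hy => ?_⟩
  have hy0 : 0 < y := by linarith
  rw [hX x hxX, hX y (hxX.trans hy), ← Real.exp_sub, Real.rpow_def_of_pos (by positivity),
    ← Real.exp_add, Real.log_div hx0.ne' hy0.ne']
  apply Real.exp_le_exp.2
  have h1 := hY (Real.log x) ((Real.le_log_iff_exp_le hx0).2 ((le_max_right _ _).trans hx))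
    (Real.log y) (Real.log_le_log hx0 hy)
  have h2 := neg_abs_le (h (Real.log y) - h (Real.log x))
  nlinarith

/-- `b(⌈m s⌉) / b(m) → s ^ α`. -/
theorem tendsto_ceil_div (hb : IsRegularlyVarying b α) {s : ℝ} (hs : 0 < s) (hs1 : s ≤ 1) :
    Tendsto (fun m : ℕ => b ((⌈m * s⌉₊ : ℕ) : ℝ) / b m) atTop (𝓝 (s ^ α)) := by
  obtain ⟨h, X, hm, H, hX1, hX⟩ := hb.exists_eq_exp
  have hms : Tendsto (fun m : ℕ => (m : ℝ) * s) atTop atTop :=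
    tendsto_natCast_atTop_atTop.atTop_mul_const hs
  have hk : Tendsto (fun m : ℕ => ((⌈m * s⌉₊ : ℕ) : ℝ)) atTop atTop :=
    tendsto_atTop_mono (fun m => Nat.le_ceil _) hms
  have hratio : Tendsto (fun m : ℕ => ((⌈m * s⌉₊ : ℕ) : ℝ) / m) atTop (𝓝 s) := by
    have := (tendsto_nat_ceil_mul_div_atTop hs.le).comp
      (tendsto_natCast_atTop_atTop (R := ℝ))
    simpa [Function.comp_def, mul_comm] using this
  have hlog : Tendsto (fun m : ℕ => Real.log m - Real.log ((⌈m * s⌉₊ : ℕ) : ℝ)) atTop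
      (𝓝 (-Real.log s)) := by
    refine (hratio.log hs.ne').neg.congr' ?_
    filter_upwards [eventually_gt_atTop 0, hk.eventually_gt_atTop 0] with m hm0 hk0
    rw [Real.log_div hk0.ne' (by positivity)]
    ring
  have hh : Tendsto (fun m : ℕ => h (Real.log m) - h (Real.log ((⌈m * s⌉₊ : ℕ) : ℝ))) atTop
      (𝓝 0) := by
    rw [Metric.tendsto_atTop']
    intro ε hε
    have hlogs : Real.log s ≤ 0 := Real.log_nonpos hs.le hs1
    obtain ⟨Y, hY⟩ := exists_forall_abs_sub_lt_of_tendsto hm H hε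
      (show 0 < -Real.log s + 1 by linarith)
    have hkl := Real.tendsto_log_atTop.comp hk
    have := ((hkl.eventually_ge_atTop Y).and
      ((hlog.eventually_le_const (lt_add_one _)).and (hk.eventually_gt_atTop 0))).and
        (eventually_gt_atTop 0)
    obtain ⟨N, hN⟩ := eventually_atTop.1 this
    refine ⟨N, fun m hm' => ?_⟩
    obtain ⟨⟨h1, h2, h3⟩, h4⟩ := hN m hm'.le
    have h5 : ((⌈m * s⌉₊ : ℕ) : ℝ) ≤ m := by
      have : ⌈m * s⌉₊ ≤ m := Nat.ceil_le.2 (mul_le_of_le_one_right (by positivity) hs1)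
      exact_mod_cast this
    have := hY _ h1 (Real.log m - Real.log ((⌈m * s⌉₊ : ℕ) : ℝ))
      (sub_nonneg.2 (Real.log_le_log h3 h5)) h2
    simpa [Real.dist_eq] using this
  have hexp : Tendsto (fun m : ℕ => Real.exp
      (-(α * (Real.log m - Real.log ((⌈m * s⌉₊ : ℕ) : ℝ)))
        - (h (Real.log m) - h (Real.log ((⌈m * s⌉₊ : ℕ) : ℝ))))) atTop (𝓝 (s ^ α)) := by
    have := (Real.continuous_exp.tendsto _).comp ((hlog.const_mul α).neg.sub hh)
    rw [Real.rpow_def_of_pos hs, show Real.log s * α = -(α * -Real.log s) - 0 by ring]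
    exact this
  refine hexp.congr' ?_
  filter_upwards [hk.eventually_ge_atTop X,
    (tendsto_natCast_atTop_atTop (R := ℝ)).eventually_ge_atTop X] with m h1 h2
  rw [hX _ h1, hX _ h2, ← Real.exp_sub]
  ring_nf

/-- A bound for `b(k) / b(m)` that holds for all `1 ≤ k ≤ m`, with an integrable power. -/
theorem exists_sq_div_sq_le (hb : IsRegularlyVarying b α) (hα : -(1 / 2) < α) :
    ∃ (β C : ℝ), -1 < β ∧ 0 < C ∧ ∀ᶠ m : ℕ in atTop, 0 < b m ∧ (m : ℝ)⁻¹ / b m ^ 2 ≤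
      C * (m : ℝ) ^ (-1 - β) ∧
      ∀ k : ℕ, 1 ≤ k → k ≤ m → b k ^ 2 / b m ^ 2 ≤ C * ((k : ℝ) / m) ^ β := by
  -- this `δ` makes the exponent `2 (α - δ) = α - 1/2` exceed `-1`
  set δ : ℝ := (α + 1 / 2) / 2 with hδ
  have hδ0 : 0 < δ := by rw [hδ]; linarith
  obtain ⟨X₀, hX1, hX⟩ := hb.exists_div_le hδ0
  set X : ℕ := ⌈X₀⌉₊
  have hXX : X₀ ≤ X := Nat.le_ceil _
  have hX0 : (0 : ℝ) < X := by linarith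
  set β : ℝ := 2 * (α - δ) with hβ
  have hbX : 0 < b X := (hX X hXX).1
  have hsq : ∀ r : ℝ, 0 ≤ r → (Real.exp δ * r ^ (α - δ)) ^ 2 = Real.exp δ ^ 2 * r ^ β := by
    intro r hr
    rw [mul_pow, ← Real.rpow_natCast (r ^ (α - δ)), ← Real.rpow_mul hr, hβ]
    congr 2
    push_cast
    ring
  set C1 : ℝ := Real.exp δ ^ 2 * (X : ℝ) ^ β / b X ^ 2 with hC1
  have hC1p : 0 < C1 := by positivity
  -- Potter's bound covers `k ≥ X`; the finitely many smaller `k` are absorbed in the constant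
  set C : ℝ := Real.exp δ ^ 2 + C1 + ∑ k ∈ Finset.range X, b k ^ 2 * C1 * (k : ℝ) ^ (-β) with hC
  have hterm : ∀ k ∈ Finset.range X, 0 ≤ b k ^ 2 * C1 * (k : ℝ) ^ (-β) := fun k _ => by positivity
  have hsum := Finset.sum_nonneg hterm
  have hbm : ∀ m : ℕ, X ≤ m → 0 < b m ∧ 1 / b m ^ 2 ≤ C1 * (m : ℝ) ^ (-β) := by
    intro m hm
    have hmX : (X : ℝ) ≤ m := by exact_mod_cast hm
    have hm0 : (0 : ℝ) < m := by linarith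
    have hp := (hX m (hXX.trans hmX)).1
    refine ⟨hp, ?_⟩
    have h1 := (hX X hXX).2 m hmX
    have h2 : (b X / b m) ^ 2 ≤ Real.exp δ ^ 2 * ((X : ℝ) / m) ^ β := by
      rw [← hsq _ (by positivity)]
      exact pow_le_pow_left₀ (by positivity) h1 2
    rw [Real.div_rpow hX0.le hm0.le, div_pow] at h2
    rw [hC1, Real.rpow_neg hm0.le]
    calc 1 / b m ^ 2 = (b X ^ 2 / b m ^ 2) / b X ^ 2 := by field_simp
      _ ≤ (Real.exp δ ^ 2 * ((X : ℝ) ^ β / m ^ β)) / b X ^ 2 := by gcongr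
      _ = _ := by ring
  refine ⟨β, C, by rw [hβ, hδ]; linarith, by positivity, ?_⟩
  filter_upwards [eventually_ge_atTop X] with m hm
  obtain ⟨hmp, hm2⟩ := hbm m hm
  have hmX : (X : ℝ) ≤ m := by exact_mod_cast hm
  have hm0 : (0 : ℝ) < m := by linarith
  refine ⟨hmp, ?_, fun k hk1 hkm => ?_⟩
  · have : (m : ℝ)⁻¹ / b m ^ 2 = (m : ℝ)⁻¹ * (1 / b m ^ 2) := by ring
    rw [this]
    calc (m : ℝ)⁻¹ * (1 / b m ^ 2) ≤ (m : ℝ)⁻¹ * (C1 * (m : ℝ) ^ (-β)) := by gcongr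
      _ = C1 * (m : ℝ) ^ (-1 - β) := by
        rw [sub_eq_add_neg, Real.rpow_add hm0, Real.rpow_neg_one]; ring
      _ ≤ C * (m : ℝ) ^ (-1 - β) := by
        gcongr
        rw [hC]
        have := Real.exp_pos δ
        nlinarith
  · have hk0 : (0 : ℝ) < k := by exact_mod_cast hk1
    rcases le_or_gt X k with hXk | hXk
    · have hXk' : (X : ℝ) ≤ k := by exact_mod_cast hXk
      have hkm' : (k : ℝ) ≤ m := by exact_mod_cast hkm
      have hkp := (hX k (hXX.trans hXk')).1
      have h1 := (hX k (hXX.trans hXk')).2 m hkm'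
      have h2 := pow_le_pow_left₀ (by positivity) h1 2
      rw [hsq _ (by positivity), div_pow] at h2
      refine h2.trans ?_
      gcongr
      rw [hC]
      linarith
    · have h3 : b k ^ 2 * C1 * (k : ℝ) ^ (-β) ≤ C := by
        have := Finset.single_le_sum hterm (Finset.mem_range.2 hXk)
        rw [hC]
        have h' := Real.exp_pos δ
        nlinarith
      calc b k ^ 2 / b m ^ 2 = b k ^ 2 * (1 / b m ^ 2) := by ring
        _ ≤ b k ^ 2 * (C1 * (m : ℝ) ^ (-β)) := by gcongr
        _ = (b k ^ 2 * C1 * (k : ℝ) ^ (-β)) * ((k : ℝ) / m) ^ β := by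
          rw [Real.div_rpow hk0.le hm0.le, Real.rpow_neg hk0.le, Real.rpow_neg hm0.le]
          have := (Real.rpow_pos_of_pos hk0 β).ne'
          field_simp
        _ ≤ C * ((k : ℝ) / m) ^ β := by gcongr

end IsRegularlyVarying

theorem ceil_mul_eq_of_mem_Ioc {m k : ℕ} (hm : 0 < m) {s : ℝ}
    (hs : s ∈ Set.Ioc ((k : ℝ) / m) ((k + 1 : ℕ) / m)) : ⌈m * s⌉₊ = k + 1 := by
  have hm' : (0 : ℝ) < m := by exact_mod_cast hm
  rw [Nat.ceil_eq_iff (by simp)]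
  constructor
  · have := (div_lt_iff₀ hm').1 hs.1
    simpa [mul_comm] using this
  · have := (le_div_iff₀ hm').1 hs.2
    simpa [mul_comm] using this

theorem intervalIntegrable_comp_ceil {m : ℕ} (f : ℕ → ℝ) (u v : ℝ) :
    IntervalIntegrable (fun s : ℝ => f ⌈m * s⌉₊) volume u v := by
  refine Measure.integrableOn_of_bounded (M := ∑ k ∈ Finset.range (⌈m * max u v⌉₊ + 1), |f k|)
    ?_ ?_ ?_ |>.intervalIntegrable
  · simp
  · exact (measurable_from_nat.comp (Nat.measurable_ceil.comp (by fun_prop))).aestronglyMeasurable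
  · filter_upwards [ae_restrict_mem measurableSet_uIcc] with s hs
    refine Finset.single_le_sum (f := fun k => |f k|) (fun _ _ => abs_nonneg _)
      (Finset.mem_range.2 (Nat.lt_succ_of_le (Nat.ceil_le_ceil ?_)))
    have := hs.2
    gcongr

/-- A Riemann sum is the integral of a step function. -/
theorem integral_comp_ceil {m : ℕ} (hm : 0 < m) (f : ℕ → ℝ) :
    ∫ s in (0 : ℝ)..1, f ⌈m * s⌉₊ = (m : ℝ)⁻¹ * ∑ k ∈ Finset.Icc 1 m, f k := by
  have hm' : (0 : ℝ) < m := by exact_mod_cast hm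
  have h1 := intervalIntegral.sum_integral_adjacent_intervals (μ := volume)
    (f := fun s : ℝ => f ⌈m * s⌉₊) (a := fun k : ℕ => (k : ℝ) / m) (n := m)
    (fun k _ => intervalIntegrable_comp_ceil f _ _)
  simp only [Nat.cast_zero, zero_div, div_self hm'.ne'] at h1
  rw [← h1, Finset.mul_sum, Finset.range_eq_Ico,
    show Finset.Icc 1 m = Finset.Ico (0 + 1) (m + 1) by ext; simp,
    ← Finset.sum_Ico_add' (fun k => (m : ℝ)⁻¹ * f k) 0 m 1]
  refine Finset.sum_congr rfl fun k _ => ?_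
  have hle : (k : ℝ) / m ≤ (k + 1 : ℕ) / m := by gcongr; simp
  rw [intervalIntegral.integral_of_le hle,
    setIntegral_congr_fun measurableSet_Ioc
      (g := fun _ => f (k + 1)) (fun s hs => by simp only [ceil_mul_eq_of_mem_Ioc hm hs])]
  rw [setIntegral_const, measureReal_def, Real.volume_Ioc, ENNReal.toReal_ofReal (by linarith)]
  simp only [smul_eq_mul]
  congr 1
  push_cast
  field_simp
  ring

/-- Karamata-type limit of weighted sums: `∑ b(k)² a(m, k) / (m b(m)²) → ∫₀¹ s^(2α) A(s) ds` when
`a` is bounded and `a(m, ⌈m s⌉) → A(s)`. -/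
theorem IsRegularlyVarying.tendsto_sum_sq {b : ℝ → ℝ} {α : ℝ} (hb : IsRegularlyVarying b α)
    (hα : -(1 / 2) < α) {a : ℕ → ℕ → ℝ} {A : ℝ → ℝ} {M : ℝ}
    (ha : ∀ m k, 1 ≤ k → k ≤ m → |a m k| ≤ M)
    (hlim : ∀ s : ℝ, 0 < s → s < 1 → Tendsto (fun m : ℕ => a m ⌈m * s⌉₊) atTop (𝓝 (A s))) :
    Tendsto (fun m : ℕ => (m : ℝ)⁻¹ * ∑ k ∈ Finset.Icc 1 m, b k ^ 2 / b m ^ 2 * a m k) atTop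
      (𝓝 (∫ s in (0 : ℝ)..1, s ^ (2 * α) * A s)) := by
  obtain ⟨β, C, hβ, hC, hev⟩ := hb.exists_sq_div_sq_le hα
  have hM : 0 ≤ M := (abs_nonneg _).trans (ha 1 1 le_rfl le_rfl)
  have key : Tendsto (fun m : ℕ => ∫ s in (0 : ℝ)..1,
      (fun k : ℕ => b k ^ 2 / b m ^ 2 * a m k) ⌈m * s⌉₊) atTop
      (𝓝 (∫ s in (0 : ℝ)..1, s ^ (2 * α) * A s)) := by
    refine intervalIntegral.tendsto_integral_filter_of_dominated_convergence
      (fun s => C * (s ^ β + 1) * M) ?_ ?_ ?_ ?_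
    · refine Eventually.of_forall fun m => ?_
      exact (measurable_from_nat (f := fun k : ℕ => b k ^ 2 / b m ^ 2 * a m k) |>.comp
        (Nat.measurable_ceil.comp (measurable_const_mul (m : ℝ)))).aestronglyMeasurable
    · filter_upwards [hev, eventually_gt_atTop 0] with m hm hm0
      refine Eventually.of_forall fun s hs => ?_
      rw [Set.uIoc_of_le zero_le_one] at hs
      have hm0' : (0 : ℝ) < m := by exact_mod_cast hm0
      have hk1 : 1 ≤ ⌈m * s⌉₊ := Nat.one_le_ceil_iff.2 (mul_pos hm0' hs.1)
      have hkm : ⌈m * s⌉₊ ≤ m := Nat.ceil_le.2 (mul_le_of_le_one_right hm0'.le hs.2)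
      have h1 := hm.2.2 _ hk1 hkm
      simp only [Real.norm_eq_abs, abs_mul]
      rw [abs_of_nonneg (by positivity : (0 : ℝ) ≤ b (⌈m * s⌉₊ : ℕ) ^ 2 / b m ^ 2)]
      have h2 : (((⌈m * s⌉₊ : ℕ) : ℝ) / m) ^ β ≤ s ^ β + 1 := by
        have hk1' : (1 : ℝ) ≤ (⌈m * s⌉₊ : ℕ) := by exact_mod_cast hk1
        have hkm' : ((⌈m * s⌉₊ : ℕ) : ℝ) ≤ m := by exact_mod_cast hkm
        have hle : s ≤ ((⌈m * s⌉₊ : ℕ) : ℝ) / m := by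
          rw [le_div_iff₀ hm0', mul_comm]; exact Nat.le_ceil _
        have hle1 : ((⌈m * s⌉₊ : ℕ) : ℝ) / m ≤ 1 := by rw [div_le_one hm0']; exact hkm'
        have hs0 := Real.rpow_nonneg hs.1.le β
        rcases le_total 0 β with hb0 | hb0
        · have := Real.rpow_le_one (hs.1.le.trans hle) hle1 hb0
          linarith
        · have := Real.rpow_le_rpow_of_nonpos hs.1 hle hb0
          linarith
      have h3 := ha m _ hk1 hkm
      have := Real.rpow_nonneg hs.1.le β
      calc _ ≤ (C * (((⌈m * s⌉₊ : ℕ) : ℝ) / m) ^ β) * M := by gcongr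
        _ ≤ _ := by gcongr
    · exact (((intervalIntegral.intervalIntegrable_rpow' hβ).add
        intervalIntegrable_const).const_mul C).mul_const M
    -- `hlim` says nothing about the end point `s = 1`
    · have : ∀ᵐ s : ℝ, s ≠ 1 := by simp [ae_iff]
      filter_upwards [this] with s hs1 hs
      rw [Set.uIoc_of_le zero_le_one] at hs
      have h1 := (hb.tendsto_ceil_div hs.1 hs.2).pow 2
      have h2 := h1.mul (hlim s hs.1 (lt_of_le_of_ne hs.2 hs1))
      rw [← Real.rpow_natCast, ← Real.rpow_mul hs.1.le] at h2
      simp only [div_pow] at h2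
      rwa [show α * ((2 : ℕ) : ℝ) = 2 * α by push_cast; ring] at h2
  refine key.congr' ?_
  filter_upwards [eventually_gt_atTop 0] with m hm
  exact integral_comp_ceil hm (fun k : ℕ => b k ^ 2 / b m ^ 2 * a m k)

/-- No single weight `b(k)² / (m b(m)²)` matters in the limit. -/
theorem IsRegularlyVarying.tendsto_max_weight {b : ℝ → ℝ} {α : ℝ} (hb : IsRegularlyVarying b α)
    (hα : -(1 / 2) < α) {ε : ℝ} (hε : 0 < ε) : ∀ᶠ m : ℕ in atTop,
      (m : ℝ)⁻¹ / b m ^ 2 < ε ∧ ∀ k : ℕ, 1 ≤ k → k ≤ m → (m : ℝ)⁻¹ * (b k ^ 2 / b m ^ 2) < ε := by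
  obtain ⟨β, C, hβ, hC, hev⟩ := hb.exists_sq_div_sq_le hα
  have t1 : Tendsto (fun m : ℕ => C * (m : ℝ) ^ (-1 - β)) atTop (𝓝 0) := by
    have := ((tendsto_rpow_neg_atTop (y := 1 + β) (by linarith)).comp
      (tendsto_natCast_atTop_atTop (R := ℝ))).const_mul C
    simpa [Function.comp_def, neg_add, sub_eq_add_neg, add_comm] using this
  have t2 : Tendsto (fun m : ℕ => C * (m : ℝ)⁻¹) atTop (𝓝 0) := by
    simpa using (tendsto_inv_atTop_nhds_zero_nat (𝕜 := ℝ)).const_mul C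
  filter_upwards [hev, t1.eventually_lt_const hε, t2.eventually_lt_const hε,
    eventually_gt_atTop 0] with m hm h1 h2 hm0
  have hm0' : (0 : ℝ) < m := by exact_mod_cast hm0
  refine ⟨hm.2.1.trans_lt h1, fun k hk1 hkm => ?_⟩
  have hk0 : (1 : ℝ) ≤ k := by exact_mod_cast hk1
  have hkm' : (k : ℝ) ≤ m := by exact_mod_cast hkm
  have h3 := hm.2.2 k hk1 hkm
  have hr0 : 0 < (k : ℝ) / m := by positivity
  have h4 : (m : ℝ)⁻¹ * (b k ^ 2 / b m ^ 2) ≤ (m : ℝ)⁻¹ * (C * ((k : ℝ) / m) ^ β) := by gcongr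
  refine h4.trans_lt ?_
  rcases le_total 0 β with hb0 | hb0
  · have : ((k : ℝ) / m) ^ β ≤ 1 :=
      Real.rpow_le_one hr0.le ((div_le_one hm0').2 hkm') hb0
    calc (m : ℝ)⁻¹ * (C * ((k : ℝ) / m) ^ β) ≤ (m : ℝ)⁻¹ * (C * 1) := by gcongr
      _ < ε := by rw [mul_one, mul_comm]; exact h2
  · have : ((k : ℝ) / m) ^ β ≤ ((m : ℝ)⁻¹) ^ β := by
      refine Real.rpow_le_rpow_of_nonpos (by positivity) ?_ hb0
      rw [inv_eq_one_div]; gcongr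
    calc (m : ℝ)⁻¹ * (C * ((k : ℝ) / m) ^ β) ≤ (m : ℝ)⁻¹ * (C * ((m : ℝ)⁻¹) ^ β) := by gcongr
      _ = C * (m : ℝ) ^ (-1 - β) := by
        rw [sub_eq_add_neg, Real.rpow_add hm0', Real.rpow_neg_one, Real.inv_rpow hm0'.le,
          Real.rpow_neg hm0'.le]
        ring
      _ < ε := h1

/-! ### The vague topology -/

theorem CompactlySupportedContinuousMap.integrable_of_isLocallyFiniteMeasure
    (φ : CompactlySupportedContinuousMap ℝ ℝ) (μ : Measure ℝ) [IsLocallyFiniteMeasure μ] :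
    Integrable φ μ :=
  φ.continuous.integrable_of_hasCompactSupport φ.hasCompactSupport

/-- Vague convergence is a local property: by a partition of unity it is enough to test it on
functions supported near an arbitrary point. -/
theorem tendsto_integral_of_forall_tsupport_subset {ι : Type*} {L : Filter ι} {μ : ι → Measure ℝ}
    [∀ i, IsLocallyFiniteMeasure (μ i)] {ν : Measure ℝ} [IsLocallyFiniteMeasure ν]
    (h : ∀ x : ℝ, ∃ U ∈ 𝓝 x, ∀ φ : CompactlySupportedContinuousMap ℝ ℝ, tsupport φ ⊆ U →
      Tendsto (fun i => ∫ t, φ t ∂μ i) L (𝓝 (∫ t, φ t ∂ν)))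
    (φ : CompactlySupportedContinuousMap ℝ ℝ) :
    Tendsto (fun i => ∫ t, φ t ∂μ i) L (𝓝 (∫ t, φ t ∂ν)) := by
  choose U hU hUφ using h
  obtain ⟨T, hT⟩ := φ.hasCompactSupport.isCompact.elim_finite_subcover
    (fun x => interior (U x)) (fun x => isOpen_interior)
    (fun x _ => Set.mem_iUnion.2 ⟨x, mem_interior_iff_mem_nhds.2 (hU x)⟩)
  let e := T.equivFin
  obtain ⟨g, hgU, hg1, -, hgc⟩ := exists_continuous_sum_one_of_isOpen_isCompact
    (s := fun i : Fin T.card => interior (U (e.symm i))) (fun i => isOpen_interior)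
    φ.hasCompactSupport.isCompact (by
      intro x hx
      obtain ⟨y, hy, hxy⟩ := Set.mem_iUnion₂.1 (hT hx)
      exact Set.mem_iUnion.2 ⟨e ⟨y, hy⟩, by simpa using hxy⟩)
  let ψ : Fin T.card → CompactlySupportedContinuousMap ℝ ℝ := fun i =>
    ⟨φ.toContinuousMap * g i, (hgc i).mul_left⟩
  have hψ : ∀ i t, ψ i t = φ t * g i t := fun i t => rfl
  have hsum : ∀ t, φ t = ∑ i, ψ i t := by
    intro t
    simp only [hψ, ← Finset.mul_sum]
    by_cases ht : t ∈ tsupport φ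
    · have := hg1 ht
      simp only [Finset.sum_apply, Pi.one_apply] at this
      rw [this, mul_one]
    · rw [image_eq_zero_of_notMem_tsupport ht, zero_mul]
  have hint : ∀ (ρ : Measure ℝ) [IsLocallyFiniteMeasure ρ],
      ∫ t, φ t ∂ρ = ∑ i, ∫ t, ψ i t ∂ρ := by
    intro ρ _
    rw [← integral_finsetSum _ fun i _ => (ψ i).integrable_of_isLocallyFiniteMeasure ρ]
    exact integral_congr_ae (Eventually.of_forall hsum)
  simp only [hint]
  refine tendsto_finsetSum _ fun i _ => hUφ (e.symm i) (ψ i) ?_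
  exact (closure_mono (Function.support_mul_subset_right _ _)).trans
    ((hgU i).trans interior_subset)

/-- A continuous cutoff, equal to `1` on `[-N, N]` and to `0` outside `[-N - 1, N + 1]`. -/
noncomputable def cutoff (N : ℕ) : CompactlySupportedContinuousMap ℝ ℝ where
  toFun t := max 0 (min 1 (N + 1 - |t|))
  continuous_toFun := by fun_prop
  hasCompactSupport' := by
    refine HasCompactSupport.of_support_subset_isCompact
      (isCompact_Icc (a := -(N + 1 : ℝ)) (b := N + 1)) fun t ht => ?_
    rw [Function.mem_support] at ht
    by_contra hc
    apply ht
    have : (N + 1 : ℝ) < |t| := by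
      by_contra h'
      exact hc (abs_le.1 (not_lt.1 h'))
    exact max_eq_left ((min_le_right _ _).trans (by linarith))

theorem cutoff_nonneg (N : ℕ) (t : ℝ) : 0 ≤ cutoff N t := le_max_left _ _

theorem cutoff_eq_one {N : ℕ} {t : ℝ} (ht : |t| ≤ N) : cutoff N t = 1 := by
  change max 0 (min 1 (N + 1 - |t|)) = (1 : ℝ)
  rw [min_eq_left (by linarith), max_eq_right zero_le_one]

theorem cutoff_eq_zero {N : ℕ} {t : ℝ} (ht : (N + 1 : ℝ) < |t|) : cutoff N t = 0 :=
  max_eq_left ((min_le_right _ _).trans (by linarith))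

/-- Countably many test functions that determine the vague topology. -/
noncomputable def vagueTest (i : ℕ × Option ℕ) : CompactlySupportedContinuousMap ℝ ℝ :=
  match i with
  | (N, none) => cutoff N
  | (N, some k) => ⟨(cutoff N).toContinuousMap * TopologicalSpace.denseSeq C(ℝ, ℝ) k,
      (cutoff N).hasCompactSupport.mul_right⟩

/-- Continuity of the integrals of the countably many test functions implies that of all integrals:
uniform approximation of `φ` on the support of a cutoff `χ`, with an error at most `δ ∫ χ`. -/
theorem continuous_integral_of_vagueTest {X : Type*} [TopologicalSpace X] {F : X → PointMeasure ℝ}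
    (hF : ∀ i, Continuous fun x => ∫ t, vagueTest i t ∂(F x).1)
    (φ : CompactlySupportedContinuousMap ℝ ℝ) : Continuous fun x => ∫ t, φ t ∂(F x).1 := by
  obtain ⟨R, hR⟩ := φ.hasCompactSupport.isCompact.isBounded.subset_closedBall 0
  obtain ⟨N, hN⟩ := exists_nat_ge R
  have hφ : ∀ t, φ t = cutoff N t * φ t := by
    intro t
    by_cases ht : t ∈ tsupport φ
    · have := hR ht
      rw [Metric.mem_closedBall, dist_zero_right, Real.norm_eq_abs] at this
      rw [cutoff_eq_one (this.trans hN), one_mul]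
    · rw [image_eq_zero_of_notMem_tsupport ht, mul_zero]
  refine continuous_of_locally_uniform_approx_of_continuousAt fun x u hu => ?_
  obtain ⟨ε, hε, hεu⟩ := Metric.mem_uniformity_dist.1 hu
  set c : X → ℝ := fun y => ∫ t, cutoff N t ∂(F y).1
  have hc : Continuous c := hF (N, none)
  have hc0 : ∀ y, 0 ≤ c y := fun y => integral_nonneg fun t => cutoff_nonneg N t
  set δ : ℝ := ε / (2 * (c x + 1)) with hδ
  have hcx := hc0 x
  have hδ0 : 0 < δ := by positivity
  have hopen : IsOpen {p : C(ℝ, ℝ) | Set.MapsTo (φ.toContinuousMap - p)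
      (Set.Icc (-(N + 1 : ℝ)) (N + 1)) {q : ℝ | |q| < δ}} :=
    (ContinuousMap.isOpen_setOfPred_mapsTo isCompact_Icc
      (isOpen_lt continuous_abs continuous_const)).preimage (continuous_const.sub continuous_id)
  obtain ⟨k, hk⟩ := (TopologicalSpace.denseRange_denseSeq C(ℝ, ℝ)).exists_mem_open hopen
    ⟨φ.toContinuousMap, fun t _ => by
      change |φ t - φ t| < δ
      simpa using hδ0⟩
  -- the mass of the cutoff is locally bounded, so the approximation is locally uniform
  refine ⟨{y | c y < c x + 1}, hc.continuousAt.eventually_lt_const (lt_add_one _),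
    fun y => ∫ t, vagueTest (N, some k) t ∂(F y).1, (hF _).continuousAt, fun y hy => hεu ?_⟩
  have : IsLocallyFiniteMeasure (F y).1 := (F y).2.1
  rw [Real.dist_eq, ← integral_sub (φ.integrable_of_isLocallyFiniteMeasure _)
    ((vagueTest (N, some k)).integrable_of_isLocallyFiniteMeasure _)]
  have hbound : ∀ t, ‖φ t - vagueTest (N, some k) t‖ ≤ δ * cutoff N t := by
    intro t
    have e : vagueTest (N, some k) t = cutoff N t * TopologicalSpace.denseSeq C(ℝ, ℝ) k t := rfl
    rw [e, hφ t, ← mul_sub, Real.norm_eq_abs, abs_mul, abs_of_nonneg (cutoff_nonneg N t), mul_comm]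
    rcases le_or_gt |t| (N + 1) with ht | ht
    · have : |φ t - TopologicalSpace.denseSeq C(ℝ, ℝ) k t| < δ := hk (abs_le.1 ht)
      exact mul_le_mul_of_nonneg_right this.le (cutoff_nonneg N t)
    · rw [cutoff_eq_zero ht]; simp
  have h1 := norm_integral_le_of_norm_le
    (((cutoff N).integrable_of_isLocallyFiniteMeasure (F y).1).const_mul δ)
    (Eventually.of_forall hbound)
  rw [integral_const_mul] at h1
  refine h1.trans_lt ?_
  have hy' : c y < c x + 1 := hy
  calc δ * c y ≤ δ * (c x + 1) := by gcongr
    _ = ε / 2 := by rw [hδ]; field_simp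
    _ < ε := by linarith

/-- A map into `M_p(ℝ)` is Borel measurable as soon as all integrals of test functions are
measurable; the reason is that countably many test functions generate the vague topology. -/
theorem PointMeasure.measurable_of_integral {Ω : Type*} [MeasurableSpace Ω]
    {F : Ω → PointMeasure ℝ}
    (hF : ∀ φ : CompactlySupportedContinuousMap ℝ ℝ, Measurable fun ω => ∫ t, φ t ∂(F ω).1) :
    Measurable F := by
  let J : PointMeasure ℝ → (ℕ × Option ℕ → ℝ) := fun μ i => ∫ t, vagueTest i t ∂μ.1
  have hle : TopologicalSpace.induced J inferInstance ≤
      PointMeasure.instTopologicalSpace ℝ := by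
    refine (continuous_iff_le_induced (t₁ := TopologicalSpace.induced J inferInstance)).1 ?_
    refine @continuous_pi _ _ _ (TopologicalSpace.induced J inferInstance) _ _ fun φ => ?_
    refine @continuous_integral_of_vagueTest _ (TopologicalSpace.induced J inferInstance)
      (fun μ => μ) (fun i => ?_) φ
    exact @Continuous.comp _ _ _ (TopologicalSpace.induced J inferInstance) _ _ _ _
      (continuous_apply i) continuous_induced_dom
  have hborel : PointMeasure.instMeasurableSpace ℝ ≤
      MeasurableSpace.comap J inferInstance := by
    refine (borel_anti hle).trans ?_
    rw [BorelSpace.measurable_eq (α := ℕ × Option ℕ → ℝ), borel_comap]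
  refine Measurable.mono (ma := inferInstance)
    (mb := MeasurableSpace.comap J inferInstance) ?_ le_rfl hborel
  exact measurable_comap_iff.2 (measurable_pi_lambda _ fun i => hF _)

theorem PointMeasure.tendsto_iff {ι : Type*} {L : Filter ι} {μ : ι → PointMeasure ℝ}
    {ν : PointMeasure ℝ} : Tendsto μ L (𝓝 ν) ↔
      ∀ φ : CompactlySupportedContinuousMap ℝ ℝ,
        Tendsto (fun i => ∫ t, φ t ∂(μ i).1) L (𝓝 (∫ t, φ t ∂ν.1)) := by
  rw [nhds_induced, tendsto_comap_iff, tendsto_pi_nhds]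
  rfl

/-! ### Measurability and continuity of the point process of real zeros -/

theorem realZeros_of_analytic {E : Type*} [NormedAddCommGroup E] [NormedSpace ℝ E] {f : ℝ → E}
    (hf : AnalyticOnNhd ℝ f Set.univ) (h0 : ∃ t, f t ≠ 0) :
    (realZeros f).1 = zeroMeasure f :=
  congrArg Subtype.val (dif_pos ⟨hf, h0⟩)

theorem realZeros_of_forall_eq_zero {E : Type*} [NormedAddCommGroup E] [NormedSpace ℝ E]
    {f : ℝ → E} (h0 : ∀ t, f t = 0) : (realZeros f).1 = 0 :=
  congrArg Subtype.val (dif_neg fun h => h.2.choose_spec (h0 _))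

/-- Multiplication by an analytic function without zeros does not change the zeros. -/
theorem realZeros_smul {E : Type*} [NormedAddCommGroup E] [NormedSpace ℝ E] {f : ℝ → ℝ} {g : ℝ → E}
    (hf : AnalyticOnNhd ℝ f Set.univ) (hg : AnalyticOnNhd ℝ g Set.univ) (hg0 : ∀ t, g t ≠ 0) :
    realZeros (fun t => f t • g t) = realZeros f := by
  apply Subtype.ext
  have hfg : AnalyticOnNhd ℝ (fun t => f t • g t) Set.univ := hf.smul hg
  by_cases h : ∃ t, f t ≠ 0
  · obtain ⟨t, ht⟩ := h
    rw [realZeros_of_analytic hf ⟨t, ht⟩, realZeros_of_analytic hfg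
      ⟨t, smul_ne_zero ht (hg0 t)⟩, zeroMeasure, zeroMeasure]
    congr 1
    funext s
    have h1 := analyticOrderAt_smul (hf s trivial) (hg s trivial)
    rw [(hg s trivial).analyticOrderAt_eq_zero.2 (hg0 s), add_zero] at h1
    have h2 : analyticOrderNatAt (fun t => f t • g t) s = analyticOrderNatAt f s :=
      congrArg ENat.toNat h1
    rw [h2]
  · push Not at h
    rw [realZeros_of_forall_eq_zero h, realZeros_of_forall_eq_zero fun t => by simp [h t]]

theorem integral_zeroMeasure {f : ℝ → ℝ} (hf : AnalyticOnNhd ℝ f Set.univ) (h0 : ∃ t, f t ≠ 0)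
    (φ : CompactlySupportedContinuousMap ℝ ℝ) :
    ∫ t, φ t ∂zeroMeasure f = ∑' t, (analyticOrderNatAt f t : ℝ) * φ t := by
  have := (isPointMeasure_zeroMeasure hf h0).1
  have h1 := hasSum_integral_measure (φ.integrable_of_isLocallyFiniteMeasure (zeroMeasure f))
  rw [zeroMeasure, ← h1.tsum_eq]
  refine tsum_congr fun t => ?_
  rw [integral_smul_measure, integral_dirac]
  simp

theorem analyticOrderNatAt_eq_zero_of_ne {f : ℝ → ℝ} {t : ℝ} (h : f t ≠ 0) :
    analyticOrderNatAt f t = 0 := by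
  by_contra hc
  exact h (apply_eq_zero_of_analyticOrderNatAt_ne_zero hc)

/-- If `x` is the only possible zero in the support of `φ`, only its term remains. -/
theorem integral_realZeros_of_forall_ne {f : ℝ → ℝ} (hf : AnalyticOnNhd ℝ f Set.univ)
    (h0 : ∃ t, f t ≠ 0) (φ : CompactlySupportedContinuousMap ℝ ℝ) (x : ℝ)
    (hx : ∀ t ∈ tsupport φ, t ≠ x → f t ≠ 0) :
    ∫ t, φ t ∂(realZeros f).1 = (analyticOrderNatAt f x : ℝ) * φ x := by
  rw [realZeros_of_analytic hf h0, integral_zeroMeasure hf h0, tsum_eq_single x]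
  intro t ht
  by_cases hts : t ∈ tsupport φ
  · rw [analyticOrderNatAt_eq_zero_of_ne (hx t hts ht)]; simp
  · rw [image_eq_zero_of_notMem_tsupport hts, mul_zero]

/-- The measure `(2 ε)⁻¹ 1[|f| < ε |f'|] dt`. As `ε → 0` it tends to the zero measure of `f`: near a
zero of order `k` at `x`, `f' / f ∼ k / (t - x)`, so `|f| < ε |f'|` cuts out an interval of
length `∼ 2 k ε`. -/
noncomputable def logDerivMeasure (f : ℝ → ℝ) (ε : ℝ) : Measure ℝ :=
  ENNReal.ofReal (2 * ε)⁻¹ • volume.restrict {t | |f t| < ε * |deriv f t|}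

instance (f : ℝ → ℝ) (ε : ℝ) : IsLocallyFiniteMeasure (logDerivMeasure f ε) :=
  inferInstanceAs (IsLocallyFiniteMeasure ((2 * ε)⁻¹.toNNReal • volume.restrict _))

theorem measurableSet_logDeriv {f : ℝ → ℝ} (hf : AnalyticOnNhd ℝ f Set.univ) (ε : ℝ) :
    MeasurableSet {t | |f t| < ε * |deriv f t|} := by
  have h1 : Continuous f := continuousOn_univ.1 hf.continuousOn
  have h2 : Continuous (deriv f) := continuousOn_univ.1 hf.deriv.continuousOn
  exact (isOpen_lt (by fun_prop) (by fun_prop)).measurableSet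

theorem integral_logDerivMeasure {f : ℝ → ℝ} (hf : AnalyticOnNhd ℝ f Set.univ) {ε : ℝ} (hε : 0 < ε)
    (φ : ℝ → ℝ) : ∫ t, φ t ∂logDerivMeasure f ε =
      (2 * ε)⁻¹ * ∫ t, {t | |f t| < ε * |deriv f t|}.indicator φ t := by
  rw [logDerivMeasure, integral_smul_measure, integral_indicator (measurableSet_logDeriv hf ε),
    ENNReal.toReal_ofReal (by positivity), smul_eq_mul]

theorem tendsto_integral_logDerivMeasure {f : ℝ → ℝ} (hf : AnalyticOnNhd ℝ f Set.univ)
    (φ : CompactlySupportedContinuousMap ℝ ℝ) :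
    Tendsto (fun ε => ∫ t, φ t ∂logDerivMeasure f ε) (𝓝[>] 0)
      (𝓝 (∫ t, φ t ∂(realZeros f).1)) := by
  have := (realZeros f).2.1
  by_cases h0 : ∃ t, f t ≠ 0
  swap
  · push Not at h0
    have hf0 : f = 0 := funext h0
    rw [realZeros_of_forall_eq_zero h0]
    refine tendsto_const_nhds.congr' ?_
    filter_upwards [self_mem_nhdsWithin] with ε hε
    rw [integral_logDerivMeasure hf hε]
    simp [hf0]
  refine tendsto_integral_of_forall_tsupport_subset (fun x => ?_) φ
  have hfx := hf x trivial
  have htop : analyticOrderAt f x ≠ ⊤ := by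
    rw [Ne, AnalyticOnNhd.analyticOrderAt_eq_top_iff_eq_zero x fun z => hf z trivial]
    rintro rfl
    simp at h0
  obtain ⟨g, hg, hgx, hfg⟩ := hfx.analyticOrderAt_ne_top.1 htop
  set k := analyticOrderNatAt f x
  -- `f = (t - x)^k g` near `x`, so `(t - x) f'(t) = f(t) r(t)` with `r(t) → k`
  set r : ℝ → ℝ := fun t => k + (t - x) * (deriv g t / g t)
  have hr : ContinuousAt r x := by
    have h1 := hg.deriv.continuousAt
    have h2 := hg.continuousAt
    exact continuousAt_const.add ((continuousAt_id.sub continuousAt_const).mul (h1.div h2 hgx))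
  have hrx : r x = k := by simp [r]
  have hev : ∀ᶠ t in 𝓝 x, (t - x) * deriv f t = f t * r t ∧ |r t - k| < 1 / 2 ∧
      (t ≠ x → f t ≠ 0) := by
    have h1 : ∀ᶠ t in 𝓝 x, |r t - k| < 1 / 2 := by
      have := hr.eventually_mem (Metric.ball_mem_nhds (r x) (by norm_num : (0 : ℝ) < 1 / 2))
      rwa [hrx] at this
    filter_upwards [h1, hfg.eventually_nhds, hg.eventually_analyticAt,
      hg.continuousAt.eventually_ne hgx] with t ht1 ht2 ht3 ht4
    have hft : f t = (t - x) ^ k * g t := ht2.self_of_nhds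
    refine ⟨?_, ht1, fun htx => ?_⟩
    · have hd : HasDerivAt (fun z => (z - x) ^ k • g z)
          ((t - x) ^ k • deriv g t + (k * (t - x) ^ (k - 1) * 1) • g t) t :=
        (((hasDerivAt_id t).sub_const x).pow k).smul ht3.differentiableAt.hasDerivAt
      rw [Filter.EventuallyEq.deriv_eq ht2, hd.deriv, hft]
      simp only [smul_eq_mul, r]
      rcases Nat.eq_zero_or_pos k with hk | hk
      · rw [hk]; field_simp; simp
      · obtain ⟨j, hj⟩ := Nat.exists_eq_succ_of_ne_zero hk.ne'
        rw [hj]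
        simp only [Nat.succ_eq_add_one, Nat.add_sub_cancel]
        field_simp
        ring
    · rw [hft]
      exact mul_ne_zero (pow_ne_zero _ (sub_ne_zero.2 htx)) ht4
  refine ⟨_, hev, fun ψ hψ => ?_⟩
  -- the condition `|f| < ε |f'|` becomes `|t - x| < ε |r t|`
  have hcond : ∀ {t ε : ℝ}, 0 < ε → ((t - x) * deriv f t = f t * r t ∧ |r t - k| < 1 / 2 ∧
      (t ≠ x → f t ≠ 0)) → t ≠ x → (|f t| < ε * |deriv f t| ↔ |t - x| < ε * |r t|) := by
    intro t ε hε ht htx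
    have h1 : 0 < |t - x| := abs_pos.2 (sub_ne_zero.2 htx)
    have h2 : 0 < |f t| := abs_pos.2 (ht.2.2 htx)
    have h3 : |t - x| * |deriv f t| = |f t| * |r t| := by rw [← abs_mul, ht.1, abs_mul]
    rw [← mul_lt_mul_iff_right₀ h1,
      show |t - x| * (ε * |deriv f t|) = |f t| * (ε * |r t|) by linear_combination ε * h3,
      mul_comm |t - x|, mul_lt_mul_iff_right₀ h2]
  have hlim0 : ∫ t, ψ t ∂(realZeros f).1 = 2⁻¹ *
      ∫ s, (Set.Ioo (-(k : ℝ)) k).indicator (fun _ => ψ x) s := by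
    rw [integral_realZeros_of_forall_ne hf h0 ψ x fun t ht htx => (hψ ht).2.2 htx,
      integral_indicator measurableSet_Ioo, setIntegral_const, measureReal_def, Real.volume_Ioo,
      ENNReal.toReal_ofReal (by simp)]
    simp only [smul_eq_mul]
    ring
  rw [hlim0]
  obtain ⟨C, hC⟩ := ψ.hasCompactSupport.exists_bound_of_continuous ψ.continuous
  have hC0 : 0 ≤ C := (norm_nonneg _).trans (hC x)
  -- after rescaling `t = x + ε s` the indicator tends to that of `(-k, k)`, except possibly at
  -- `s = 0` and `s = ±k`
  have main : Tendsto (fun ε : ℝ => ∫ s, {t | |f t| < ε * |deriv f t|}.indicator ψ (x + ε * s))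
      (𝓝[>] 0) (𝓝 (∫ s, (Set.Ioo (-(k : ℝ)) k).indicator (fun _ => ψ x) s)) := by
    refine tendsto_integral_filter_of_dominated_convergence
      ((Set.Icc (-(k + 1 : ℝ)) (k + 1)).indicator fun _ => C) ?_ ?_ ?_ ?_
    · refine Eventually.of_forall fun ε => ?_
      exact ((ψ.continuous.measurable.indicator (measurableSet_logDeriv hf ε)).comp
        (by fun_prop : Measurable fun s : ℝ => x + ε * s)).aestronglyMeasurable
    · filter_upwards [self_mem_nhdsWithin] with ε hε
      refine Eventually.of_forall fun s => ?_
      have hε : 0 < ε := hε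
      by_cases hs : s ∈ Set.Icc (-(k + 1 : ℝ)) (k + 1)
      · rw [Set.indicator_of_mem hs]
        exact (norm_indicator_le_norm_self _ _).trans (hC _)
      · rw [Set.indicator_of_notMem hs]
        refine (norm_eq_zero.2 ?_).le
        rw [Set.indicator_apply_eq_zero]
        intro hmem
        by_contra hne
        have hU := hψ (subset_tsupport _ hne)
        have hs0 : s ≠ 0 := by
          rintro rfl
          exact hs ⟨by linarith [k.cast_nonneg (α := ℝ)], by positivity⟩
        have h1 := (hcond hε hU (by simpa using ⟨hε.ne', hs0⟩)).1 hmem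
        rw [add_sub_cancel_left, abs_mul, abs_of_pos hε, mul_lt_mul_iff_right₀ hε] at h1
        have h2 := abs_lt.1 hU.2.1
        have h3 : |r (x + ε * s)| ≤ k + 1 := by
          rw [abs_le]; constructor <;> linarith [k.cast_nonneg (α := ℝ)]
        exact hs (abs_le.1 (h1.le.trans h3))
    · exact (integrable_indicator_iff measurableSet_Icc).2
        (integrableOn_const (by simp))
    · have hae : ∀ᵐ s : ℝ, s ∉ ({0, (k : ℝ), -(k : ℝ)} : Set ℝ) :=
        (Set.toFinite _).countable.ae_notMem volume
      filter_upwards [hae] with s hs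
      simp only [Set.mem_insert_iff, Set.mem_singleton_iff, not_or] at hs
      have ht : Tendsto (fun ε : ℝ => x + ε * s) (𝓝[>] 0) (𝓝 x) := by
        have : Tendsto (fun ε : ℝ => x + ε * s) (𝓝 0) (𝓝 (x + 0 * s)) :=
          (by fun_prop : Continuous fun ε : ℝ => x + ε * s).tendsto 0
        rw [zero_mul, add_zero] at this
        exact this.mono_left nhdsWithin_le_nhds
      have hrt : Tendsto (fun ε : ℝ => |r (x + ε * s)|) (𝓝[>] 0) (𝓝 k) := by
        have := (hr.tendsto.comp ht).abs
        rwa [hrx, Nat.abs_cast] at this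
      have hev' := ht.eventually hev
      rcases lt_or_gt_of_ne (show |s| ≠ k from fun h => by
        rcases abs_choice s with h' | h'
        · exact hs.2.1 (h' ▸ h)
        · exact hs.2.2 (by rw [← h, h', neg_neg])) with hsk | hsk
      · rw [Set.indicator_of_mem (show s ∈ Set.Ioo (-(k : ℝ)) k from abs_lt.1 hsk)]
        refine (ψ.continuous.continuousAt.tendsto.comp ht).congr' ?_
        filter_upwards [hev', self_mem_nhdsWithin, hrt.eventually_const_lt hsk] with ε h1 hε h2
        have hε : 0 < ε := hε
        rw [Set.indicator_of_mem]
        · rfl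
        refine (hcond hε h1 (by simpa using ⟨hε.ne', hs.1⟩)).2 ?_
        rwa [add_sub_cancel_left, abs_mul, abs_of_pos hε, mul_lt_mul_iff_right₀ hε]
      · rw [Set.indicator_of_notMem (show s ∉ Set.Ioo (-(k : ℝ)) k from
          fun h => hsk.not_gt (abs_lt.2 h))]
        refine tendsto_const_nhds.congr' ?_
        filter_upwards [hev', self_mem_nhdsWithin, hrt.eventually_lt_const hsk] with ε h1 hε h2
        have hε : 0 < ε := hε
        rw [Set.indicator_of_notMem]
        intro hmem
        have h3 := (hcond hε h1 (by simpa using ⟨hε.ne', hs.1⟩)).1 hmem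
        rw [add_sub_cancel_left, abs_mul, abs_of_pos hε, mul_lt_mul_iff_right₀ hε] at h3
        exact h2.not_gt h3
  refine (main.const_mul 2⁻¹).congr' ?_
  filter_upwards [self_mem_nhdsWithin] with ε hε
  have hε : 0 < ε := hε
  rw [integral_logDerivMeasure hf hε]
  have e1 := Measure.integral_comp_mul_left
    (fun y => {t | |f t| < ε * |deriv f t|}.indicator ψ (x + y)) ε
  rw [e1, integral_add_left_eq_self, abs_of_pos (inv_pos.2 hε), smul_eq_mul, mul_inv, mul_assoc]

/-- The point process of zeros of a random real-analytic function is measurable. -/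
theorem measurable_realZeros {Ω : Type*} [MeasurableSpace Ω] {f : Ω → ℝ → ℝ}
    (hf : ∀ ω, AnalyticOnNhd ℝ (f ω) Set.univ) (hm : ∀ t, Measurable fun ω => f ω t) :
    Measurable fun ω => realZeros (f ω) := by
  refine PointMeasure.measurable_of_integral fun φ => ?_
  have hcont : ∀ ω, Continuous (f ω) := fun ω => continuousOn_univ.1 (hf ω).continuousOn
  have hfm : Measurable fun p : Ω × ℝ => f p.1 p.2 :=
    (measurable_uncurry_of_continuous_of_measurable (u := fun t ω => f ω t) hcont hm).comp
      measurable_swap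
  have hu : Tendsto (fun n : ℕ => (1 : ℝ) / (n + 1)) atTop (𝓝[>] 0) :=
    tendsto_nhdsWithin_iff.2 ⟨tendsto_one_div_add_atTop_nhds_zero_nat,
      Eventually.of_forall fun n => by simp only [Set.mem_Ioi]; positivity⟩
  -- joint measurability of the derivative: it is a limit of difference quotients
  have hdm : Measurable fun p : Ω × ℝ => deriv (f p.1) p.2 := by
    refine measurable_of_tendsto_metrizable (f := fun (n : ℕ) (p : Ω × ℝ) =>
      ((1 : ℝ) / (n + 1))⁻¹ * (f p.1 (p.2 + 1 / (n + 1)) - f p.1 p.2)) (fun n => ?_) ?_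
    · exact ((hfm.comp (measurable_fst.prodMk (measurable_snd.add_const _))).sub hfm).const_mul _
    · refine tendsto_pi_nhds.2 fun p => ?_
      exact (((hf p.1) p.2 trivial).differentiableAt.hasDerivAt.tendsto_slope_zero_right).comp hu
  refine measurable_of_tendsto_metrizable (f := fun (n : ℕ) ω =>
    ∫ t, φ t ∂logDerivMeasure (f ω) (1 / (n + 1))) (fun n => ?_)
    (tendsto_pi_nhds.2 fun ω => (tendsto_integral_logDerivMeasure (hf ω) φ).comp hu)
  have hpos : (0 : ℝ) < 1 / (n + 1) := by positivity
  simp only [fun ω => integral_logDerivMeasure (hf ω) hpos φ]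
  refine Measurable.const_mul (StronglyMeasurable.measurable ?_) _
  refine StronglyMeasurable.integral_prod_right
    (f := fun ω t => {t | |f ω t| < 1 / (n + 1) * |deriv (f ω) t|}.indicator φ t) ?_
  refine Measurable.stronglyMeasurable ?_
  exact Measurable.indicator (φ.continuous.measurable.comp measurable_snd)
    (measurableSet_lt (continuous_abs.measurable.comp hfm)
      ((continuous_abs.measurable.comp hdm).const_mul _))

/-- Real Hurwitz theorem: if all real zeros of the limit are simple, then locally uniform convergence
together with the derivatives implies vague convergence of the zeros. -/
theorem tendsto_realZeros {ι : Type*} {L : Filter ι} {F : ι → ℝ → ℝ} {f : ℝ → ℝ}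
    (hF : ∀ i, AnalyticOnNhd ℝ (F i) Set.univ) (hf : AnalyticOnNhd ℝ f Set.univ)
    (h0 : TendstoLocallyUniformly F f L)
    (h1 : TendstoLocallyUniformly (fun i => deriv (F i)) (deriv f) L)
    (hs : ∀ t, f t = 0 → deriv f t ≠ 0) :
    Tendsto (fun i => realZeros (F i)) L (𝓝 (realZeros f)) := by
  rw [PointMeasure.tendsto_iff]
  have := (realZeros f).2.1
  have := fun i => (realZeros (F i)).2.1
  have hne : ∃ t, f t ≠ 0 := by
    by_contra! hc
    refine hs 0 (hc 0) ?_
    rw [show f = fun _ => 0 from funext hc, deriv_const]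
  have hpt : ∀ t, Tendsto (fun i => F i t) L (𝓝 (f t)) := fun t =>
    ((tendstoLocallyUniformly_iff_forall_isCompact.1 h0) {t} isCompact_singleton).tendsto_at
      (Set.mem_singleton t)
  have hneF : ∀ᶠ i in L, ∃ t, F i t ≠ 0 := by
    obtain ⟨t, ht⟩ := hne
    exact ((hpt t).eventually_ne ht).mono fun i hi => ⟨t, hi⟩
  have hcf : Continuous f := continuousOn_univ.1 hf.continuousOn
  have hcf' : Continuous (deriv f) := continuousOn_univ.1 hf.deriv.continuousOn
  refine tendsto_integral_of_forall_tsupport_subset fun x => ?_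
  by_cases hx : f x = 0
  · -- near a simple zero, `F i` is strictly monotone and changes sign
    set d := deriv f x with hd
    have hd0 : 0 < |d| := abs_pos.2 (hs x hx)
    obtain ⟨r, hr, hrd⟩ := Metric.nhds_basis_closedBall.mem_iff.1
      (hcf'.continuousAt.eventually_mem (Metric.ball_mem_nhds d (by positivity : 0 < |d| / 4)))
    have hev1 : ∀ᶠ i in L, ∀ t ∈ Metric.closedBall x r, |deriv (F i) t - d| ≤ |d| / 2 := by
      have h2 := (tendstoLocallyUniformly_iff_forall_isCompact.1 h1) _ (isCompact_closedBall x r)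
      filter_upwards [Metric.tendstoUniformlyOn_iff.1 h2 (|d| / 4) (by positivity)] with i hi t ht
      have a1 := hi t ht
      have a2 : dist (deriv f t) d < |d| / 4 := hrd ht
      rw [← Real.dist_eq]
      linarith [dist_triangle_left (deriv (F i) t) d (deriv f t)]
    have hFx : Tendsto (fun i => F i x) L (𝓝 0) := hx ▸ hpt x
    have hfz : ∀ t ∈ Metric.closedBall x r, t ≠ x → f t ≠ 0 := by
      intro t ht htx hft
      have h3 := (convex_closedBall x r).norm_image_sub_le_of_norm_hasDerivWithin_le
        (f := fun t => f t - d * t) (f' := fun t => deriv f t - d) (C := |d| / 4)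
        (fun s _ => ((hf s trivial).differentiableAt.hasDerivAt.sub
          (by simpa using (hasDerivAt_id s).const_mul d)).hasDerivWithinAt)
        (fun s hs' => by rw [Real.norm_eq_abs, ← Real.dist_eq]; exact (hrd hs').le)
        (Metric.mem_closedBall_self hr.le) ht
      rw [hft, hx, Real.norm_eq_abs, Real.norm_eq_abs,
        show 0 - d * t - (0 - d * x) = -(d * (t - x)) by ring, abs_neg, abs_mul] at h3
      have := abs_pos.2 (sub_ne_zero.2 htx)
      nlinarith
    refine ⟨Metric.ball x r, Metric.ball_mem_nhds x hr, fun φ hφ => ?_⟩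
    rw [integral_realZeros_of_forall_ne hf hne φ x fun t ht htx =>
      hfz t (Metric.ball_subset_closedBall (hφ ht)) htx]
    have hord : analyticOrderNatAt f x = 1 := by
      rw [analyticOrderNatAt,
        (hf x trivial).analyticOrderAt_eq_one_of_zero_deriv_ne_zero hx (hs x hx)]
      rfl
    rw [hord, Nat.cast_one, one_mul, Metric.tendsto_nhds]
    intro ε hε
    obtain ⟨ρ, hρ, hφρ⟩ := Metric.continuousAt_iff.1 φ.continuous.continuousAt ε hε
    have hFx' : ∀ᶠ i in L, |F i x| < |d| / 2 * min ρ r := by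
      have := hFx.abs
      rw [abs_zero] at this
      exact this.eventually_lt_const (by positivity)
    filter_upwards [hev1, hFx', hneF] with i hi hix hin
    have hlip : ∀ s ∈ Metric.closedBall x r, ∀ t ∈ Metric.closedBall x r,
        |F i t - F i s - d * (t - s)| ≤ |d| / 2 * |t - s| := by
      intro s hs' t ht
      have h3 := (convex_closedBall x r).norm_image_sub_le_of_norm_hasDerivWithin_le
        (f := fun t => F i t - d * t) (f' := fun t => deriv (F i) t - d) (C := |d| / 2)
        (fun s _ => ((hF i s trivial).differentiableAt.hasDerivAt.sub
          (by simpa using (hasDerivAt_id s).const_mul d)).hasDerivWithinAt)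
        (fun s hs' => hi s hs') hs' ht
      rw [Real.norm_eq_abs, Real.norm_eq_abs] at h3
      convert h3 using 2
      ring
    -- zeros of `F i` in the ball are unique, and the zero is as close to `x` as `F i x` is to `0`
    have hsep : ∀ s ∈ Metric.closedBall x r, ∀ t ∈ Metric.closedBall x r,
        |d| / 2 * |t - s| ≤ |F i t - F i s| := by
      intro s hs' t ht
      have h3 := hlip s hs' t ht
      have h4 : |d * (t - s)| ≤ |F i t - F i s| + |F i t - F i s - d * (t - s)| := by
        have := abs_sub (F i t - F i s) (F i t - F i s - d * (t - s))
        rwa [sub_sub_cancel] at this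
      rw [abs_mul] at h4
      linarith
    -- intermediate value theorem for `F i / d`, whose increments are those of `t` up to a factor `2`
    obtain ⟨s, hsI, hsz⟩ : ∃ s ∈ Metric.closedBall x r, F i s = 0 := by
      have hc : ContinuousOn (fun t => F i t / d) (Set.Icc (x - r) (x + r)) :=
        ((continuousOn_univ.1 (hF i).continuousOn).div_const d).continuousOn
      have hd0' : d ≠ 0 := abs_pos.1 hd0
      have hxb : x ∈ Metric.closedBall x r := Metric.mem_closedBall_self hr.le
      have hix2 : |F i x / d| < r / 2 := by
        rw [abs_div, div_lt_iff₀ hd0]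
        calc |F i x| < |d| / 2 * min ρ r := hix
          _ ≤ |d| / 2 * r := by gcongr; exact min_le_right _ _
          _ = r / 2 * |d| := by ring
      have key : ∀ t ∈ Metric.closedBall x r, |F i t / d - F i x / d - (t - x)| ≤ |t - x| / 2 := by
        intro t ht
        have h3 := hlip x hxb t ht
        have : F i t / d - F i x / d - (t - x) = (F i t - F i x - d * (t - x)) / d := by
          field_simp
        rw [this, abs_div, div_le_iff₀ hd0]
        linarith
      have hl := key (x - r) (by simp [abs_of_pos hr])
      have hr' := key (x + r) (by simp [abs_of_pos hr])
      rw [show x - r - x = -r by ring, abs_neg, abs_of_pos hr] at hl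
      rw [add_sub_cancel_left, abs_of_pos hr] at hr'
      have hl2 := abs_le.1 hl
      have hr2 := abs_le.1 hr'
      have hx2 := abs_lt.1 hix2
      obtain ⟨s, hs1, hs2⟩ := intermediate_value_Icc (by linarith : x - r ≤ x + r) hc
        (show (0 : ℝ) ∈ Set.Icc _ _ from ⟨by linarith, by linarith⟩)
      refine ⟨s, by rwa [Real.closedBall_eq_Icc], ?_⟩
      simpa [hd0'] using hs2
    have huniq : ∀ t ∈ tsupport φ, t ≠ s → F i t ≠ 0 := by
      intro t ht hts hFt
      have h3 := hsep s hsI t (Metric.ball_subset_closedBall (hφ ht))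
      rw [hFt, hsz, sub_zero, abs_zero] at h3
      have := abs_pos.2 (sub_ne_zero.2 hts)
      nlinarith
    have hord' : analyticOrderNatAt (F i) s = 1 := by
      rw [analyticOrderNatAt,
        (hF i s trivial).analyticOrderAt_eq_one_of_zero_deriv_ne_zero hsz fun h3 => ?_]
      · rfl
      · have := hi s hsI
        rw [h3, zero_sub, abs_neg] at this
        linarith
    rw [integral_realZeros_of_forall_ne (hF i) hin φ s huniq, hord', Nat.cast_one, one_mul]
    apply hφρ
    have h3 := hsep x (Metric.mem_closedBall_self hr.le) s hsI
    rw [hsz, zero_sub, abs_neg] at h3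
    rw [Real.dist_eq]
    have h4 : |d| / 2 * |s - x| < |d| / 2 * min ρ r := h3.trans_lt hix
    exact (lt_of_mul_lt_mul_left h4 (by positivity)).trans_le (min_le_left _ _)
  · -- near a point where `f` does not vanish, `F i` does not vanish either
    have hx0 : 0 < |f x| := abs_pos.2 hx
    obtain ⟨r, hr, hrd⟩ := Metric.nhds_basis_closedBall.mem_iff.1
      (hcf.continuousAt.eventually_mem (Metric.ball_mem_nhds (f x) (by positivity : 0 < |f x| / 2)))
    have hfz : ∀ t ∈ Metric.closedBall x r, |f x| / 2 < |f t| := by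
      intro t ht
      have : dist (f t) (f x) < |f x| / 2 := hrd ht
      rw [Real.dist_eq, abs_sub_comm] at this
      linarith [abs_sub_abs_le_abs_sub (f x) (f t)]
    refine ⟨Metric.ball x r, Metric.ball_mem_nhds x hr, fun φ hφ => ?_⟩
    rw [integral_realZeros_of_forall_ne hf hne φ x fun t ht _ =>
      abs_pos.1 (by linarith [hfz t (Metric.ball_subset_closedBall (hφ ht))]),
      analyticOrderNatAt_eq_zero_of_ne hx, Nat.cast_zero, zero_mul]
    refine tendsto_const_nhds.congr' ?_
    have h2 := (tendstoLocallyUniformly_iff_forall_isCompact.1 h0) _ (isCompact_closedBall x r)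
    filter_upwards [Metric.tendstoUniformlyOn_iff.1 h2 (|f x| / 2) (by positivity), hneF]
      with i hi hin
    have hFz : ∀ t ∈ Metric.closedBall x r, F i t ≠ 0 := by
      intro t ht h3
      have := hi t ht
      rw [h3, Real.dist_eq, sub_zero] at this
      linarith [hfz t ht]
    rw [integral_realZeros_of_forall_ne (hF i) hin φ x fun t ht _ =>
      hFz t (Metric.ball_subset_closedBall (hφ ht)),
      analyticOrderNatAt_eq_zero_of_ne (hFz x (Metric.mem_closedBall_self hr.le)),
      Nat.cast_zero, zero_mul]

/-- A version of `measurable_realZeros` up to null sets: on a measurable null set `f` is replaced by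
`0`, and measurability of the values at a dense sequence passes to all points by continuity. -/
theorem aemeasurable_realZeros {Ω : Type*} [MeasurableSpace Ω] {P : Measure Ω} {f : Ω → ℝ → ℝ}
    (hf : ∀ᵐ ω ∂P, AnalyticOnNhd ℝ (f ω) Set.univ) (hm : ∀ t, AEMeasurable (fun ω => f ω t) P) :
    AEMeasurable (fun ω => realZeros (f ω)) P := by
  set q := TopologicalSpace.denseSeq ℝ
  have hq : DenseRange q := TopologicalSpace.denseRange_denseSeq ℝ
  have hgood : ∀ᵐ ω ∂P, AnalyticOnNhd ℝ (f ω) Set.univ ∧ ∀ i, f ω (q i) = (hm (q i)).mk _ ω :=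
    hf.and (ae_all_iff.2 fun i => (hm (q i)).ae_eq_mk)
  obtain ⟨S, hSsub, hSm, hS0⟩ := exists_measurable_superset_of_null (ae_iff.1 hgood)
  have hSgood : ∀ ω, ω ∉ S → AnalyticOnNhd ℝ (f ω) Set.univ ∧
      ∀ i, f ω (q i) = (hm (q i)).mk _ ω := fun ω hω => by
    by_contra hc
    exact hω (hSsub hc)
  classical
  set g : Ω → ℝ → ℝ := fun ω => if ω ∈ S then 0 else f ω with hg
  have hga : ∀ ω, AnalyticOnNhd ℝ (g ω) Set.univ := by
    intro ω
    by_cases h : ω ∈ S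
    · simp only [hg, h, if_true]; exact analyticOnNhd_const
    · simp only [hg, h, if_false]; exact (hSgood ω h).1
  have hgq : ∀ i, Measurable fun ω => g ω (q i) := by
    intro i
    have : (fun ω => g ω (q i)) = fun ω => if ω ∈ S then 0 else (hm (q i)).mk _ ω := by
      funext ω
      by_cases h : ω ∈ S
      · simp [hg, h]
      · simp [hg, h, (hSgood ω h).2 i]
    rw [this]
    exact Measurable.ite hSm measurable_const (hm (q i)).measurable_mk
  have hgm : ∀ t, Measurable fun ω => g ω t := by
    intro t
    obtain ⟨u, hur, hu⟩ := mem_closure_iff_seq_limit.1 (hq t)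
    choose i hi using hur
    refine measurable_of_tendsto_metrizable (f := fun n ω => g ω (q (i n))) (fun n => hgq _)
      (tendsto_pi_nhds.2 fun ω => ?_)
    have hc : Continuous (g ω) := continuousOn_univ.1 (hga ω).continuousOn
    simp only [hi]
    exact (hc.tendsto t).comp hu
  refine ⟨_, measurable_realZeros hga hgm, ?_⟩
  have : ∀ᵐ ω ∂P, ω ∉ S := measure_eq_zero_iff_ae_notMem.1 hS0
  filter_upwards [this] with ω hω
  simp only [hg, hω, if_false]

/-! ### Entire functions with geometrically bounded derivatives at the origin -/

/-- The function `∑ dₙ tⁿ / n!` with derivatives `dₙ` at the origin. -/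
noncomputable def expSeries {𝕜 : Type*} [RCLike 𝕜] (d : ℕ → 𝕜) (t : 𝕜) : 𝕜 :=
  ∑' n, d n * t ^ n / n.factorial

section expSeries

variable {𝕜 : Type*} [RCLike 𝕜] {d : ℕ → 𝕜} {R B : ℝ}

theorem norm_expSeries_term_le (hd : ∀ n, ‖d n‖ ≤ R * B ^ n) {A : ℝ} {t : 𝕜} (ht : ‖t‖ ≤ A)
    (n : ℕ) : ‖d n * t ^ n / (n.factorial : 𝕜)‖ ≤ R * ((B * A) ^ n / n.factorial) := by
  rw [norm_div, norm_mul, norm_pow, RCLike.norm_natCast, mul_pow, ← mul_div_assoc, ← mul_assoc]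
  have := (norm_nonneg _).trans (hd n)
  gcongr
  exact hd n

theorem summable_expSeries_bound (R B A : ℝ) :
    Summable fun n : ℕ => R * ((B * A) ^ n / n.factorial) :=
  (Real.summable_pow_div_factorial (B * A)).mul_left R

theorem summable_expSeries (hd : ∀ n, ‖d n‖ ≤ R * B ^ n) (t : 𝕜) :
    Summable fun n => d n * t ^ n / (n.factorial : 𝕜) :=
  .of_norm_bounded (summable_expSeries_bound R B ‖t‖) fun n => norm_expSeries_term_le hd le_rfl n

theorem hasDerivAt_expSeries (hd : ∀ n, ‖d n‖ ≤ R * B ^ n) (t : 𝕜) :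
    HasDerivAt (expSeries d) (expSeries (fun n => d (n + 1)) t) t := by
  have hd' : ∀ n, ‖d (n + 1)‖ ≤ (R * B) * B ^ n := fun n => by
    have := hd (n + 1)
    rwa [pow_succ', ← mul_assoc] at this
  set A := ‖t‖ + 1
  have hg : ∀ (n : ℕ), ∀ y ∈ Metric.ball (0 : 𝕜) A,
      HasDerivAt (fun y => d n * y ^ n / (n.factorial : 𝕜))
        (if n = 0 then 0 else d n * y ^ (n - 1) / ((n - 1).factorial : 𝕜)) y := by
    intro n y _
    have h1 := ((hasDerivAt_pow n y).const_mul (d n)).div_const (n.factorial : 𝕜)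
    refine h1.congr_deriv ?_
    cases n with
    | zero => simp
    | succ n =>
      simp only [Nat.succ_ne_zero, if_false, Nat.add_sub_cancel, Nat.factorial_succ]
      have : (n.factorial : 𝕜) ≠ 0 := by exact_mod_cast n.factorial_ne_zero
      have h2 : ((n : 𝕜) + 1) ≠ 0 := by exact_mod_cast n.succ_ne_zero
      push_cast
      field_simp
  set u : ℕ → ℝ := fun n => if n = 0 then 0 else
    (R * B) * ((B * A) ^ (n - 1) / (n - 1).factorial)
  have hu : Summable u := by
    rw [← summable_nat_add_iff 1]
    simpa [u] using summable_expSeries_bound (R * B) B A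
  have h := hasDerivAt_tsum_of_isPreconnected (g := fun n y => d n * y ^ n / (n.factorial : 𝕜)) hu
    Metric.isOpen_ball
    (convex_ball (0 : 𝕜) A).isPreconnected hg (fun n y hy => by
      cases n with
      | zero => simp [u]
      | succ n =>
        simpa [u] using norm_expSeries_term_le hd' (mem_ball_zero_iff.1 hy).le n)
    (Metric.mem_ball_self (by positivity)) (summable_expSeries hd 0)
    (show t ∈ Metric.ball (0 : 𝕜) A by simp [A])
  refine HasDerivAt.congr_deriv h ?_
  have hs : Summable fun n => if n = 0 then (0 : 𝕜) else
      d n * t ^ (n - 1) / ((n - 1).factorial : 𝕜) := by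
    rw [← summable_nat_add_iff 1]
    simpa using summable_expSeries hd' t
  rw [hs.tsum_eq_zero_add]
  simp [expSeries]

end expSeries

theorem differentiable_expSeries {d : ℕ → ℂ} {R B : ℝ} (hd : ∀ n, ‖d n‖ ≤ R * B ^ n) :
    Differentiable ℂ (expSeries d) := fun t => (hasDerivAt_expSeries hd t).differentiableAt

/-- The real part of an entire function is real-analytic on the real line. -/
theorem Differentiable.analyticOnNhd_re {g : ℂ → ℂ} (hg : Differentiable ℂ g) :
    AnalyticOnNhd ℝ (fun t : ℝ => (g t).re) Set.univ := fun t _ =>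
  (Complex.reCLM.analyticAt _).comp
    ((hg.analyticAt (t : ℂ)).restrictScalars.comp (Complex.ofRealCLM.analyticAt t))

theorem analyticOnNhd_expSeries {d : ℕ → ℝ} {R B : ℝ} (hd : ∀ n, ‖d n‖ ≤ R * B ^ n) :
    AnalyticOnNhd ℝ (expSeries d) Set.univ := by
  have h := (differentiable_expSeries (d := fun n => (d n : ℂ)) (R := R) (B := B)
    (by simpa using hd)).analyticOnNhd_re
  convert h using 2 with t
  rw [expSeries, ← Complex.ofReal_re (∑' n, _)]
  congr 1
  rw [expSeries, Complex.ofReal_tsum]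
  push_cast
  rfl

/-- Sequences with `|dₙ| ≤ R 3ⁿ`. -/
def coeffBox (R : ℝ) : Set (ℕ → ℝ) := {d | ∀ n, ‖d n‖ ≤ R * 3 ^ n}

theorem isCompact_coeffBox (R : ℝ) : IsCompact (coeffBox R) := by
  have : coeffBox R = Set.univ.pi fun n => Metric.closedBall (0 : ℝ) (R * 3 ^ n) := by
    ext d; simp [coeffBox]
  rw [this]
  exact isCompact_univ_pi fun n => isCompact_closedBall _ _

theorem shift_mem_coeffBox {R : ℝ} {d : ℕ → ℝ} (hd : d ∈ coeffBox R) :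
    (fun n => d (n + 1)) ∈ coeffBox (R * 3) := fun n => by
  have := hd (n + 1)
  rwa [pow_succ', ← mul_assoc] at this

theorem tendstoLocallyUniformly_expSeries {ι : Type*} {L : Filter ι} {R : ℝ} {d : ι → ℕ → ℝ}
    {e : ℕ → ℝ} (hd : ∀ i, d i ∈ coeffBox R) (he : e ∈ coeffBox R)
    (h : Tendsto d L (𝓝 e)) :
    TendstoLocallyUniformly (fun i => expSeries (d i)) (expSeries e) L := by
  rw [tendstoLocallyUniformly_iff_forall_isCompact]
  intro K hK
  obtain ⟨A, hA⟩ := hK.isBounded.exists_norm_le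
  have hdiff : ∀ i n, ‖d i n - e n‖ ≤ (2 * R) * 3 ^ n := fun i n => by
    have := norm_sub_le (d i n) (e n)
    have h1 := hd i n
    have h2 := he n
    linarith
  have hlim : Tendsto (fun i => ∑' n, ‖d i n - e n‖ * A ^ n / n.factorial) L (𝓝 0) := by
    have := tendsto_tsum_of_dominated_convergence (𝓕 := L)
      (f := fun i n => ‖d i n - e n‖ * A ^ n / (n.factorial : ℝ))
      (g := fun _ => 0) (summable_expSeries_bound (2 * R) 3 ‖A‖) (fun n => ?_)
      (Eventually.of_forall fun i n => ?_)
    · simpa using this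
    · have h1 := ((tendsto_pi_nhds.1 h n).sub_const (e n)).norm
      rw [sub_self, norm_zero] at h1
      simpa using (h1.mul_const (A ^ n)).div_const (n.factorial : ℝ)
    · refine norm_expSeries_term_le (𝕜 := ℝ) (d := fun n => ‖d i n - e n‖) (fun n => ?_) le_rfl n
      rw [norm_norm]
      exact hdiff i n
  rw [Metric.tendstoUniformlyOn_iff]
  intro ε hε
  filter_upwards [hlim.eventually_lt_const hε] with i hi t ht
  refine lt_of_le_of_lt ?_ hi
  have htA : ‖t‖ ≤ A := hA t ht
  rw [dist_comm, dist_eq_norm, expSeries, expSeries,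
    ← (summable_expSeries (hd i) t).tsum_sub (summable_expSeries he t)]
  have hb : ∀ n : ℕ, ‖d i n * t ^ n / (n.factorial : ℝ) - e n * t ^ n / (n.factorial : ℝ)‖ ≤
      ‖d i n - e n‖ * A ^ n / n.factorial := by
    intro n
    rw [← sub_div, ← sub_mul, norm_div, norm_mul, norm_pow, Real.norm_natCast]
    gcongr
  have hs : Summable fun n : ℕ => ‖d i n - e n‖ * A ^ n / (n.factorial : ℝ) :=
    summable_expSeries (𝕜 := ℝ) (d := fun n => ‖d i n - e n‖) (R := 2 * R) (B := 3)
      (fun n => by rw [norm_norm]; exact hdiff i n) A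
  exact tsum_of_norm_bounded hs.hasSum hb

/-- On a coefficient box, coordinatewise convergence to a function with simple real zeros implies
convergence of the zeros. -/
theorem tendsto_realZeros_expSeries {ι : Type*} {L : Filter ι} {R : ℝ} {d : ι → ℕ → ℝ}
    {e : ℕ → ℝ} (hd : ∀ i, d i ∈ coeffBox R) (he : e ∈ coeffBox R) (h : Tendsto d L (𝓝 e))
    (hs : ∀ t, expSeries e t = 0 → deriv (expSeries e) t ≠ 0) :
    Tendsto (fun i => realZeros (expSeries (d i))) L (𝓝 (realZeros (expSeries e))) := by
  have hder : ∀ {c : ℕ → ℝ}, c ∈ coeffBox R →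
      deriv (expSeries c) = expSeries fun n => c (n + 1) := fun hc =>
    funext fun t => (hasDerivAt_expSeries hc t).deriv
  refine tendsto_realZeros (fun i => analyticOnNhd_expSeries (hd i)) (analyticOnNhd_expSeries he)
    (tendstoLocallyUniformly_expSeries hd he h) ?_ hs
  simp only [hder (hd _), hder he]
  exact tendstoLocallyUniformly_expSeries (fun i => shift_mem_coeffBox (hd i))
    (shift_mem_coeffBox he) (tendsto_pi_nhds.2 fun n => tendsto_pi_nhds.1 h (n + 1))

/-! ### From finite-dimensional distributions to the zeros -/

theorem measurable_firstCoords (N : ℕ) : Measurable fun x : ℕ → ℝ =>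
    (WithLp.toLp 2 fun i : Fin N => x i : EuclideanSpace ℝ (Fin N)) :=
  (WithLp.measurable_toLp 2 _).comp (by fun_prop)

theorem charFun_map_firstCoords {Ω : Type*} [MeasurableSpace Ω] {P : Measure Ω}
    {X : Ω → ℕ → ℝ} (hX : AEMeasurable X P) (N : ℕ) (t : EuclideanSpace ℝ (Fin N)) :
    charFun (P.map fun ω => (WithLp.toLp 2 fun i : Fin N => X ω i : EuclideanSpace ℝ (Fin N))) t =
      ∫ ω, Complex.exp (((∑ j ∈ Finset.range N,
        (fun j => if h : j < N then t ⟨j, h⟩ else 0) j * X ω j : ℝ) : ℂ) * Complex.I) ∂P := by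
  have hm : AEMeasurable (fun ω =>
      (WithLp.toLp 2 fun i : Fin N => X ω i : EuclideanSpace ℝ (Fin N))) P :=
    (measurable_firstCoords N).comp_aemeasurable hX
  rw [charFun_apply, integral_map hm]
  · refine integral_congr_ae (Eventually.of_forall fun ω => ?_)
    simp only
    congr 3
    rw [Finset.sum_range, PiLp.inner_apply]
    refine Finset.sum_congr rfl fun i _ => ?_
    simp [mul_comm]
  · exact (by fun_prop : Continuous fun x : EuclideanSpace ℝ (Fin N) =>
      Complex.exp ((inner ℝ x t : ℂ) * Complex.I)).aestronglyMeasurable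

/-- Convergence of the finite-dimensional distributions of random sequences implies the portmanteau
inequality for compact sets of sequences: a compact set is the decreasing intersection of the
cylinders over its projections. -/
theorem limsup_measure_mem_compact_le {Ω Ω' : Type*} [MeasurableSpace Ω] [MeasurableSpace Ω']
    {P : Measure Ω} [IsProbabilityMeasure P] {P' : Measure Ω'} [IsProbabilityMeasure P']
    {X : ℕ → Ω → ℕ → ℝ} {Y : Ω' → ℕ → ℝ} (hX : ∀ m, AEMeasurable (X m) P)
    (hY : AEMeasurable Y P')
    (h : ∀ (N : ℕ) (c : ℕ → ℝ), Tendsto (fun m => ∫ ω,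
      Complex.exp (((∑ j ∈ Finset.range N, c j * X m ω j : ℝ) : ℂ) * Complex.I) ∂P) atTop
      (𝓝 (∫ ω, Complex.exp (((∑ j ∈ Finset.range N, c j * Y ω j : ℝ) : ℂ) * Complex.I) ∂P')))
    {K : Set (ℕ → ℝ)} (hK : IsCompact K) :
    limsup (fun m => P {ω | X m ω ∈ K}) atTop ≤ P' {ω | Y ω ∈ K} := by
  set π : (N : ℕ) → (ℕ → ℝ) → EuclideanSpace ℝ (Fin N) :=
    fun N x => WithLp.toLp 2 fun i : Fin N => x i with hπ
  have hπm : ∀ N, Measurable (π N) := measurable_firstCoords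
  have hπc : ∀ N, Continuous (π N) := fun N =>
    (PiLp.continuous_toLp 2 _).comp (by fun_prop)
  have hC : ∀ N, IsClosed (π N '' K) := fun N => (hK.image (hπc N)).isClosed
  have hπeq : ∀ {N : ℕ} {x y : ℕ → ℝ}, π N x = π N y ↔ ∀ j < N, x j = y j := by
    intro N x y
    constructor
    · intro hxy j hj
      exact congrFun (congrArg WithLp.ofLp hxy) ⟨j, hj⟩
    · intro hxy
      simp only [hπ]
      congr 1
      funext i
      exact hxy i i.2
  -- for each `N`, Lévy continuity and the portmanteau theorem in dimension `N`
  have hstep : ∀ N, limsup (fun m => P {ω | X m ω ∈ K}) atTop ≤ P' {ω | π N (Y ω) ∈ π N '' K} := by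
    intro N
    have mX : ∀ m, AEMeasurable (fun ω => π N (X m ω)) P := fun m =>
      (hπm N).comp_aemeasurable (hX m)
    have mY : AEMeasurable (fun ω => π N (Y ω)) P' := (hπm N).comp_aemeasurable hY
    let μ : ℕ → ProbabilityMeasure (EuclideanSpace ℝ (Fin N)) := fun m =>
      ⟨P.map fun ω => π N (X m ω), Measure.isProbabilityMeasure_map (mX m)⟩
    let ν : ProbabilityMeasure (EuclideanSpace ℝ (Fin N)) :=
      ⟨P'.map fun ω => π N (Y ω), Measure.isProbabilityMeasure_map mY⟩
    have hμν : Tendsto μ atTop (𝓝 ν) := by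
      refine ProbabilityMeasure.tendsto_of_tendsto_charFun fun t => ?_
      change Tendsto (fun m => charFun (P.map fun ω => π N (X m ω)) t) atTop
        (𝓝 (charFun (P'.map fun ω => π N (Y ω)) t))
      simp only [hπ, charFun_map_firstCoords (hX _), charFun_map_firstCoords hY]
      exact h N _
    have := ProbabilityMeasure.limsup_measure_closed_le_of_tendsto hμν (hC N)
    have e1 : ∀ m, (μ m : Measure _) (π N '' K) = P {ω | π N (X m ω) ∈ π N '' K} := fun m =>
      Measure.map_apply_of_aemeasurable (mX m) (hC N).measurableSet
    have e2 : (ν : Measure _) (π N '' K) = P' {ω | π N (Y ω) ∈ π N '' K} :=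
      Measure.map_apply_of_aemeasurable mY (hC N).measurableSet
    simp only [e1, e2] at this
    refine le_trans (limsup_le_limsup (Eventually.of_forall fun m => ?_)) this
    exact measure_mono fun ω hω => ⟨_, hω, rfl⟩
  have hanti : Antitone fun N => {ω | π N (Y ω) ∈ π N '' K} := by
    rintro N M hNM ω ⟨x, hx, hxY⟩
    exact ⟨x, hx, hπeq.2 fun j hj => hπeq.1 hxY j (hj.trans_le hNM)⟩
  -- points of `K` that agree with `Y ω` in the first `N` coordinates converge to `Y ω`
  have hinter : ⋂ N, {ω | π N (Y ω) ∈ π N '' K} = {ω | Y ω ∈ K} := by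
    ext ω
    simp only [Set.mem_iInter, Set.mem_ofPred_eq]
    refine ⟨fun hω => ?_, fun hω N => ⟨_, hω, rfl⟩⟩
    choose x hxK hx using hω
    refine hK.isClosed.mem_of_tendsto (f := x) (b := atTop) ?_ (Eventually.of_forall hxK)
    refine tendsto_pi_nhds.2 fun j => tendsto_const_nhds.congr' ?_
    filter_upwards [eventually_gt_atTop j] with N hN
    exact (hπeq.1 (hx N) j hN).symm
  have hlim := tendsto_measure_iInter_atTop (μ := P')
    (s := fun N => {ω | π N (Y ω) ∈ π N '' K})
    (fun N => ((hπm N).comp_aemeasurable hY).nullMeasurable (hC N).measurableSet) hanti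
    ⟨0, measure_ne_top _ _⟩
  rw [hinter] at hlim
  exact ge_of_tendsto' hlim hstep

/-- Chebyshev's inequality and a union bound: second moments `O(4ⁿ)` keep the coefficients below
`R 3ⁿ` with high probability. -/
theorem measure_notMem_coeffBox_le {Ω : Type*} [MeasurableSpace Ω] {P : Measure Ω}
    {D : Ω → ℕ → ℝ} {C : ℝ} (hC : 0 ≤ C) (hDm : ∀ n, AEMeasurable (fun ω => D ω n) P)
    (hD : ∀ n, ∫⁻ ω, ENNReal.ofReal (D ω n ^ 2) ∂P ≤ ENNReal.ofReal (C * 4 ^ n)) {R : ℝ}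
    (hR : 0 < R) : P {ω | D ω ∉ coeffBox R} ≤ ENNReal.ofReal (9 / 5 * C / R ^ 2) := by
  have hsub : {ω | D ω ∉ coeffBox R} ⊆
      ⋃ n, {ω | ENNReal.ofReal ((R * 3 ^ n) ^ 2) ≤ ENNReal.ofReal (D ω n ^ 2)} := by
    intro ω hω
    simp only [coeffBox, Set.mem_ofPred_eq, not_forall, not_le, Set.mem_iUnion,
      Real.norm_eq_abs] at hω ⊢
    obtain ⟨n, hn⟩ := hω
    refine ⟨n, ENNReal.ofReal_le_ofReal ?_⟩
    rw [← sq_abs (D ω n)]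
    exact pow_le_pow_left₀ (by positivity) hn.le 2
  have hterm : ∀ n, P {ω | ENNReal.ofReal ((R * 3 ^ n) ^ 2) ≤ ENNReal.ofReal (D ω n ^ 2)} ≤
      ENNReal.ofReal (C / R ^ 2 * (4 / 9) ^ n) := by
    intro n
    have hpos : 0 < (R * 3 ^ n) ^ 2 := by positivity
    refine (meas_ge_le_lintegral_div ((hDm n).pow_const 2).ennreal_ofReal
      (by simpa using hR.ne') ENNReal.ofReal_ne_top).trans ?_
    refine (ENNReal.div_le_div_right (hD n) _).trans ?_
    rw [← ENNReal.ofReal_div_of_pos hpos]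
    refine ENNReal.ofReal_le_ofReal (le_of_eq ?_)
    rw [mul_pow, ← pow_mul, mul_comm n 2, pow_mul, div_pow]
    norm_num
    field_simp
  have hs : HasSum (fun n : ℕ => C / R ^ 2 * (4 / 9 : ℝ) ^ n) (9 / 5 * C / R ^ 2) := by
    have h := (hasSum_geometric_of_lt_one (by norm_num : (0 : ℝ) ≤ 4 / 9)
      (by norm_num)).mul_left (C / R ^ 2)
    rwa [show C / R ^ 2 * (1 - 4 / 9 : ℝ)⁻¹ = 9 / 5 * C / R ^ 2 by norm_num; ring] at h
  calc P {ω | D ω ∉ coeffBox R} ≤ _ := measure_mono hsub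
    _ ≤ _ := measure_iUnion_le _
    _ ≤ _ := ENNReal.tsum_le_tsum hterm
    _ = _ := by
      rw [← ENNReal.ofReal_tsum_of_nonneg (fun n => by positivity) hs.summable, hs.tsum_eq]

/-- Zeros of random entire functions converge in distribution when the finite-dimensional
distributions converge, the derivatives at the origin satisfy a uniform second-moment bound, and the
real zeros of the limit are almost surely simple. The moment bound confines the coefficients to a
compact box on which values at a dense set of points determine the zeros continuously. -/
theorem tendstoInDistribution_realZeros {Ω Ω' : Type*} [MeasurableSpace Ω] [MeasurableSpace Ω']
    {P : Measure Ω} [IsProbabilityMeasure P] {P' : Measure Ω'} [IsProbabilityMeasure P']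
    {Z : ℕ → Ω → PointMeasure ℝ} {D : ℕ → Ω → ℕ → ℝ} {Y : Ω' → ℝ → ℝ} {C : ℝ}
    (hZm : ∀ m, AEMeasurable (Z m) P)
    (hZ : ∀ᶠ m in atTop, ∀ ω, Z m ω = realZeros (expSeries (D m ω)))
    (hDm : ∀ m n, AEMeasurable (fun ω => D m ω n) P)
    (hXm : ∀ m t, AEMeasurable (fun ω => expSeries (D m ω) t) P) (hC : 0 ≤ C)
    (hD : ∀ᶠ m in atTop, ∀ n,
      ∫⁻ ω, ENNReal.ofReal (D m ω n ^ 2) ∂P ≤ ENNReal.ofReal (C * 4 ^ n))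
    (hYm : ∀ t, AEMeasurable (fun ω => Y ω t) P')
    (hYa : ∀ᵐ ω ∂P', AnalyticOnNhd ℝ (Y ω) Set.univ)
    (hYs : ∀ᵐ ω ∂P', ∀ t, Y ω t = 0 → deriv (Y ω) t ≠ 0)
    (h : ∀ (N : ℕ) (c q : ℕ → ℝ), Tendsto (fun m => ∫ ω, Complex.exp
      (((∑ j ∈ Finset.range N, c j * expSeries (D m ω) (q j) : ℝ) : ℂ) * Complex.I) ∂P) atTop
      (𝓝 (∫ ω, Complex.exp (((∑ j ∈ Finset.range N, c j * Y ω (q j) : ℝ) : ℂ) * Complex.I) ∂P'))) :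
    TendstoInDistribution Z atTop (fun ω => realZeros (Y ω)) (fun _ => P) P' := by
  have hYZ := aemeasurable_realZeros hYa hYm
  refine ⟨hZm, hYZ, ?_⟩
  refine tendsto_of_forall_isClosed_limsup_le' fun F hF => ?_
  have e1 : ∀ m, (P.map (Z m)) F = P {ω | Z m ω ∈ F} := fun m =>
    Measure.map_apply_of_aemeasurable (hZm m) hF.measurableSet
  have e2 : (P'.map fun ω => realZeros (Y ω)) F = P' {ω | realZeros (Y ω) ∈ F} :=
    Measure.map_apply_of_aemeasurable hYZ hF.measurableSet
  change limsup (fun m => (P.map (Z m)) F) atTop ≤ (P'.map fun ω => realZeros (Y ω)) F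
  simp only [e1, e2]
  set q := TopologicalSpace.denseSeq ℝ
  have hq : DenseRange q := TopologicalSpace.denseRange_denseSeq ℝ
  set J : (ℕ → ℝ) → ℕ → ℝ := fun d i => expSeries d (q i) with hJ
  have hbound : ∀ R : ℝ, 0 < R → limsup (fun m => P {ω | Z m ω ∈ F}) atTop ≤
      P' {ω | realZeros (Y ω) ∈ F} + ENNReal.ofReal (9 / 5 * C / R ^ 2) := by
    intro R hR
    -- coefficient sequences in the box whose zeros lie in `F`; the closure keeps this property at
    -- sequences with simple zeros
    set S : Set (ℕ → ℝ) := {d | d ∈ coeffBox R ∧ realZeros (expSeries d) ∈ F}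
    have hSsub : closure S ⊆ coeffBox R :=
      closure_minimal (fun d hd => hd.1) (isCompact_coeffBox R).isClosed
    have hScomp : IsCompact (closure S) :=
      (isCompact_coeffBox R).of_isClosed_subset isClosed_closure hSsub
    -- so that the values on the dense sequence range over a compact set
    have hJc : ContinuousOn J (coeffBox R) := by
      refine continuousOn_pi.2 fun i d hd => ?_
      have h1 := tendstoLocallyUniformly_expSeries (L := 𝓝 (⟨d, hd⟩ : coeffBox R))
        (d := fun x : coeffBox R => x.1) (fun x => x.2) hd continuous_subtype_val.continuousAt
      have h2 := ((tendstoLocallyUniformly_iff_forall_isCompact.1 h1) {q i}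
        isCompact_singleton).tendsto_at (Set.mem_singleton (q i))
      rw [continuousWithinAt_iff_continuousAt_domRestrict _ hd]
      exact h2
    have hKc : IsCompact (J '' closure S) := hScomp.image_of_continuousOn (hJc.mono hSsub)
    have hlim := limsup_measure_mem_compact_le (P := P) (P' := P')
      (X := fun m ω i => expSeries (D m ω) (q i)) (Y := fun ω i => Y ω (q i))
      (fun m => aemeasurable_pi_lambda _ fun i => hXm m (q i))
      (aemeasurable_pi_lambda _ fun i => hYm (q i)) (fun N c => h N c q) hKc
    have hle1 : ∀ᶠ m in atTop, P {ω | Z m ω ∈ F} ≤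
        P {ω | (fun i => expSeries (D m ω) (q i)) ∈ J '' closure S} +
          ENNReal.ofReal (9 / 5 * C / R ^ 2) := by
      filter_upwards [hZ, hD] with m hm1 hm2
      refine le_trans ?_ (add_le_add_right (measure_notMem_coeffBox_le hC (hDm m) hm2 hR) _)
      refine le_trans (measure_mono fun ω hω => ?_) (measure_union_le _ _)
      by_cases hb : D m ω ∈ coeffBox R
      · left
        refine ⟨D m ω, subset_closure ⟨hb, ?_⟩, rfl⟩
        rw [← hm1 ω]
        exact hω
      · exact Or.inr hb
    have hle2 : P' {ω | (fun i => Y ω (q i)) ∈ J '' closure S} ≤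
        P' {ω | realZeros (Y ω) ∈ F} := by
      refine measure_mono_ae ?_
      filter_upwards [hYa, hYs] with ω ha hs hω
      obtain ⟨e, he, hJe⟩ := hω
      have heb := hSsub he
      have hYe : Y ω = expSeries e := by
        have hc1 : Continuous (Y ω) := continuousOn_univ.1 ha.continuousOn
        have hc2 : Continuous (expSeries e) :=
          continuousOn_univ.1 (analyticOnNhd_expSeries heb).continuousOn
        exact hq.equalizer hc1 hc2 (funext fun i => (congrFun hJe i).symm)
      obtain ⟨d, hdS, hde⟩ := mem_closure_iff_seq_limit.1 he
      have hconv := tendsto_realZeros_expSeries (fun i => (hdS i).1) heb hde (hYe ▸ hs)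
      change realZeros (Y ω) ∈ F
      rw [hYe]
      exact hF.mem_of_tendsto hconv (Eventually.of_forall fun i => (hdS i).2)
    refine (limsup_le_limsup hle1).trans ?_
    rw [limsup_add_const _ _ _ (by isBoundedDefault) (by isBoundedDefault)]
    exact add_le_add_left (hlim.trans hle2) _
  have hlim : Tendsto (fun R : ℝ => P' {ω | realZeros (Y ω) ∈ F} +
      ENNReal.ofReal (9 / 5 * C / R ^ 2)) atTop (𝓝 (P' {ω | realZeros (Y ω) ∈ F} + 0)) := by
    refine Tendsto.const_add _ ?_
    rw [← ENNReal.ofReal_zero]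
    refine ENNReal.tendsto_ofReal ?_
    exact tendsto_const_nhds.div_atTop (tendsto_pow_atTop two_ne_zero)
  rw [add_zero] at hlim
  exact ge_of_tendsto hlim ((eventually_gt_atTop 0).mono fun R hR => hbound R hR)

/-! ### A central limit theorem for weighted sums -/

theorem norm_exp_mul_I_sub_le (x : ℝ) :
    ‖Complex.exp (x * Complex.I) - (1 + x * Complex.I - x ^ 2 / 2)‖ ≤ 4 * (x ^ 2 * min 1 |x|) := by
  rcases le_total |x| 1 with h | h
  · have h1 : ‖(x * Complex.I : ℂ)‖ = |x| := by simp
    have := Complex.exp_bound (x := x * Complex.I) (n := 3) (by rwa [h1]) (by norm_num)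
    have h2 : ∑ m ∈ Finset.range 3, (x * Complex.I : ℂ) ^ m / (m.factorial : ℂ)
        = 1 + x * Complex.I - x ^ 2 / 2 := by
      simp [Finset.sum_range_succ, Nat.factorial, mul_pow]
      ring
    rw [h2, h1] at this
    refine this.trans ?_
    rw [min_eq_right h]
    norm_num [Nat.factorial]
    nlinarith [pow_nonneg (abs_nonneg x) 3, show x ^ 2 * |x| = |x| ^ 3 by rw [← sq_abs x]; ring]
  · rw [min_eq_left h]
    have h1 : ‖Complex.exp (x * Complex.I)‖ = 1 := Complex.norm_exp_ofReal_mul_I x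
    have h2 : ‖(1 + x * Complex.I - x ^ 2 / 2 : ℂ)‖ ≤ 1 + |x| + x ^ 2 / 2 := by
      refine (norm_sub_le _ _).trans (add_le_add ((norm_add_le _ _).trans (by simp)) ?_)
      simp
    refine (norm_sub_le _ _).trans ?_
    rw [h1]
    have : x ^ 2 = |x| ^ 2 := (sq_abs x).symm
    nlinarith

theorem norm_prod_sub_prod_le {ι : Type*} (s : Finset ι) (f g : ι → ℂ) (hf : ∀ i ∈ s, ‖f i‖ ≤ 1)
    (hg : ∀ i ∈ s, ‖g i‖ ≤ 1) : ‖∏ i ∈ s, f i - ∏ i ∈ s, g i‖ ≤ ∑ i ∈ s, ‖f i - g i‖ := by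
  classical
  induction s using Finset.induction_on with
  | empty => simp
  | insert a s ha ih =>
    rw [Finset.prod_insert ha, Finset.prod_insert ha, Finset.sum_insert ha]
    have ih' := ih (fun i hi => hf i (Finset.mem_insert_of_mem hi))
      fun i hi => hg i (Finset.mem_insert_of_mem hi)
    have hp : ‖∏ i ∈ s, f i‖ ≤ 1 := by
      rw [norm_prod]
      exact Finset.prod_le_one (fun _ _ => norm_nonneg _)
        fun i hi => hf i (Finset.mem_insert_of_mem hi)
    rw [show f a * ∏ i ∈ s, f i - g a * ∏ i ∈ s, g i
      = (f a - g a) * ∏ i ∈ s, f i + g a * (∏ i ∈ s, f i - ∏ i ∈ s, g i) by ring]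
    refine (norm_add_le _ _).trans (add_le_add ?_ ?_)
    · rw [norm_mul]
      exact mul_le_of_le_one_right (norm_nonneg _) hp
    · rw [norm_mul]
      exact (mul_le_of_le_one_left (norm_nonneg _) (hg a (Finset.mem_insert_self _ _))).trans ih'

section CLT

variable {Ω : Type*} [MeasurableSpace Ω] {P : Measure Ω} [IsProbabilityMeasure P]

theorem abs_re_mul_add_im_mul_le (p q : ℝ) (z : ℂ) :
    |p * z.re + q * z.im| ≤ √(p ^ 2 + q ^ 2) * ‖z‖ := by
  rw [Complex.norm_eq_sqrt_sq_add_sq, ← Real.sqrt_mul (by positivity)]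
  exact Real.abs_le_sqrt (by nlinarith [sq_nonneg (p * z.im - q * z.re)])

theorem integral_sq_re_mul_add_im_mul {ζ : Ω → ℂ} (hL2 : MemLp ζ 2 P) (hmean : ∫ ω, ζ ω ∂P = 0)
    (hcov : cov[fun ω => (ζ ω).re, fun ω => (ζ ω).im; P] = 0) (p q : ℝ) :
    ∫ ω, (p * (ζ ω).re + q * (ζ ω).im) ∂P = 0 ∧
    ∫ ω, (p * (ζ ω).re + q * (ζ ω).im) ^ 2 ∂P
      = (∫ ω, (ζ ω).re ^ 2 ∂P) * p ^ 2 + (∫ ω, (ζ ω).im ^ 2 ∂P) * q ^ 2 := by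
  have hre : MemLp (fun ω => (ζ ω).re) 2 P := hL2.re
  have him : MemLp (fun ω => (ζ ω).im) 2 P := hL2.im
  have hi : Integrable ζ P := hL2.integrable (by norm_num)
  have h1 : ∫ ω, (ζ ω).re ∂P = 0 := by
    have := integral_re hi
    simpa [hmean] using this
  have h2 : ∫ ω, (ζ ω).im ∂P = 0 := by
    have := integral_im hi
    simpa [hmean] using this
  have h3 : ∫ ω, (ζ ω).re * (ζ ω).im ∂P = 0 := by
    have := covariance_eq_sub hre him
    rw [hcov] at this
    simp only [h1, h2, mul_zero, sub_zero] at this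
    exact this.symm
  have hir := hre.integrable (by norm_num : (1 : ℝ≥0∞) ≤ 2)
  have hii := him.integrable (by norm_num : (1 : ℝ≥0∞) ≤ 2)
  refine ⟨?_, ?_⟩
  · rw [integral_add (hir.const_mul p) (hii.const_mul q), integral_const_mul, integral_const_mul,
      h1, h2]
    simp
  · have e : ∀ ω, (p * (ζ ω).re + q * (ζ ω).im) ^ 2
        = p ^ 2 * (ζ ω).re ^ 2 + q ^ 2 * (ζ ω).im ^ 2 + 2 * p * q * ((ζ ω).re * (ζ ω).im) :=
      fun ω => by ring
    simp only [e]
    have i1 : Integrable (fun ω => (ζ ω).re ^ 2) P := hre.integrable_sq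
    have i2 : Integrable (fun ω => (ζ ω).im ^ 2) P := him.integrable_sq
    have i3 : Integrable (fun ω => (ζ ω).re * (ζ ω).im) P := hre.integrable_mul him
    have i12 : Integrable (fun ω => p ^ 2 * (ζ ω).re ^ 2 + q ^ 2 * (ζ ω).im ^ 2) P :=
      (i1.const_mul _).add (i2.const_mul _)
    rw [integral_add i12 (i3.const_mul _),
      integral_add (i1.const_mul _) (i2.const_mul _), integral_const_mul, integral_const_mul,
      integral_const_mul, h3]
    ring

/-- The second-order expansion at `0` of the characteristic function of a planar random vector. -/
theorem exists_norm_charFun_sub_le {ζ : Ω → ℂ} (hL2 : MemLp ζ 2 P) (hmean : ∫ ω, ζ ω ∂P = 0)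
    (hcov : cov[fun ω => (ζ ω).re, fun ω => (ζ ω).im; P] = 0) {ε : ℝ} (hε : 0 < ε) :
    ∃ δ > 0, ∀ p q : ℝ, p ^ 2 + q ^ 2 ≤ δ →
      ‖∫ ω, Complex.exp (((p * (ζ ω).re + q * (ζ ω).im : ℝ) : ℂ) * Complex.I) ∂P -
        (1 - (((∫ ω, (ζ ω).re ^ 2 ∂P) * p ^ 2 + (∫ ω, (ζ ω).im ^ 2 ∂P) * q ^ 2 : ℝ) : ℂ) / 2)‖
        ≤ ε * (p ^ 2 + q ^ 2) := by
  have hn : Integrable (fun ω => ‖ζ ω‖ ^ 2) P := hL2.integrable_norm_pow (by norm_num)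
  -- dominated convergence for `E[|ζ|² min(1, ρ |ζ|)]`, as `ρ → 0`
  have hlim : Tendsto (fun ρ : ℝ => ∫ ω, 4 * (‖ζ ω‖ ^ 2 * min 1 (√ρ * ‖ζ ω‖)) ∂P) (𝓝 0) (𝓝 0) := by
    rw [show (0 : ℝ) = ∫ ω : Ω, (0 : ℝ) ∂P by simp]
    refine tendsto_integral_filter_of_dominated_convergence (fun ω => 4 * ‖ζ ω‖ ^ 2) ?_ ?_
      (hn.const_mul 4) ?_
    · refine Eventually.of_forall fun ρ => ?_
      have := hL2.aestronglyMeasurable.norm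
      exact ((this.pow 2).mul (aestronglyMeasurable_const.inf (this.const_mul _))).const_mul 4
    · refine Eventually.of_forall fun ρ => Eventually.of_forall fun ω => ?_
      have h0 : 0 ≤ min 1 (√ρ * ‖ζ ω‖) := le_min zero_le_one (by positivity)
      rw [Real.norm_of_nonneg (by positivity)]
      have : min 1 (√ρ * ‖ζ ω‖) ≤ 1 := min_le_left _ _
      nlinarith [sq_nonneg ‖ζ ω‖]
    · refine Eventually.of_forall fun ω => ?_
      have : Continuous fun ρ : ℝ => 4 * (‖ζ ω‖ ^ 2 * min 1 (√ρ * ‖ζ ω‖)) := by fun_prop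
      have h := this.tendsto 0
      simpa using h
  obtain ⟨δ, hδ, h⟩ := Metric.eventually_nhds_iff.1 (hlim.eventually (gt_mem_nhds hε))
  refine ⟨δ / 2, by positivity, fun p q hpq => ?_⟩
  have hr := h (y := p ^ 2 + q ^ 2) (by
    rw [Real.dist_eq, sub_zero, abs_of_nonneg (by positivity)]; linarith)
  set X : Ω → ℝ := fun ω => p * (ζ ω).re + q * (ζ ω).im with hX
  obtain ⟨e1, e2⟩ := integral_sq_re_mul_add_im_mul hL2 hmean hcov p q
  have hXL : MemLp X 2 P := (hL2.re.const_mul p).add (hL2.im.const_mul q)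
  have iX : Integrable X P := hXL.integrable (by norm_num)
  have iX2 : Integrable (fun ω => X ω ^ 2) P := hXL.integrable_sq
  have iE : Integrable (fun ω => Complex.exp ((X ω : ℂ) * Complex.I)) P := by
    refine Integrable.of_bound (C := 1) ?_ (Eventually.of_forall fun ω => ?_)
    · have : Continuous fun x : ℝ => Complex.exp ((x : ℂ) * Complex.I) := by fun_prop
      exact this.comp_aestronglyMeasurable hXL.aestronglyMeasurable
    · rw [Complex.norm_exp_ofReal_mul_I]
  have iT : Integrable (fun ω => (1 + X ω * Complex.I - X ω ^ 2 / 2 : ℂ)) P := by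
    refine ((integrable_const _).add (iX.ofReal.mul_const _)).sub ?_
    have := (iX2.ofReal (𝕜 := ℂ)).div_const 2
    simpa using this
  have eT : ∫ ω, (1 + X ω * Complex.I - X ω ^ 2 / 2 : ℂ) ∂P
      = 1 - (((∫ ω, (ζ ω).re ^ 2 ∂P) * p ^ 2 + (∫ ω, (ζ ω).im ^ 2 ∂P) * q ^ 2 : ℝ) : ℂ) / 2 := by
    have i1 : Integrable (fun ω => (X ω * Complex.I : ℂ)) P := iX.ofReal.mul_const _
    have i2 : Integrable (fun ω => (X ω ^ 2 / 2 : ℂ)) P := by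
      have := (iX2.ofReal (𝕜 := ℂ)).div_const 2
      simpa using this
    have i0 : Integrable (fun ω => (1 + X ω * Complex.I : ℂ)) P := (integrable_const _).add i1
    rw [integral_sub i0 i2, integral_add (integrable_const _) i1,
      integral_mul_const, integral_div]
    have h1 : ∫ ω, (X ω : ℂ) ∂P = 0 := by
      rw [integral_complex_ofReal]; simp [hX, e1]
    have h2 : ∫ ω, (X ω : ℂ) ^ 2 ∂P = ((∫ ω, X ω ^ 2 ∂P : ℝ) : ℂ) := by
      rw [← integral_complex_ofReal]; simp
    rw [h1, h2, hX, e2]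
    simp
  rw [← eT, ← integral_sub iE iT]
  calc _ ≤ ∫ ω, (p ^ 2 + q ^ 2) * (4 * (‖ζ ω‖ ^ 2 * min 1 (√(p ^ 2 + q ^ 2) * ‖ζ ω‖))) ∂P := by
        refine norm_integral_le_of_norm_le ?_ (Eventually.of_forall fun ω => ?_)
        · refine Integrable.const_mul ((Integrable.mono' hn ?_
            (Eventually.of_forall fun ω => ?_)).const_mul 4) _
          · have := hL2.aestronglyMeasurable.norm
            exact (this.pow 2).mul (aestronglyMeasurable_const.inf (this.const_mul _))
          · have h0 : 0 ≤ min 1 (√(p ^ 2 + q ^ 2) * ‖ζ ω‖) := le_min zero_le_one (by positivity)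
            rw [Real.norm_of_nonneg (by positivity)]
            exact mul_le_of_le_one_right (by positivity) (min_le_left _ _)
        · refine (norm_exp_mul_I_sub_le (X ω)).trans ?_
          have hb := abs_re_mul_add_im_mul_le p q (ζ ω)
          have hsq : X ω ^ 2 ≤ (p ^ 2 + q ^ 2) * ‖ζ ω‖ ^ 2 := by
            rw [← sq_abs, ← Real.sq_sqrt (show 0 ≤ p ^ 2 + q ^ 2 by positivity), ← mul_pow]
            exact pow_le_pow_left₀ (abs_nonneg _) hb 2
          calc 4 * (X ω ^ 2 * min 1 |X ω|)
              ≤ 4 * ((p ^ 2 + q ^ 2) * ‖ζ ω‖ ^ 2 * min 1 (√(p ^ 2 + q ^ 2) * ‖ζ ω‖)) := by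
                gcongr
            _ = _ := by ring
    _ ≤ _ := by
        rw [integral_const_mul, mul_comm ε]
        gcongr

/-- The Lindeberg central limit theorem for triangular arrays of real linear functionals of
independent copies of a planar random vector, in terms of characteristic functions. -/
theorem tendsto_integral_exp_sum {ξ : ℕ → Ω → ℂ} (hindep : iIndepFun ξ P)
    (hident : ∀ k, IdentDistrib (ξ k) (ξ 0) P P) (hL2 : MemLp (ξ 0) 2 P)
    (hmean : ∫ ω, ξ 0 ω ∂P = 0) {σ₁ σ₂ : ℝ}
    (hσ₁ : σ₁ ^ 2 = ∫ ω, (ξ 0 ω).re ^ 2 ∂P) (hσ₂ : σ₂ ^ 2 = ∫ ω, (ξ 0 ω).im ^ 2 ∂P)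
    (hcov : cov[fun ω => (ξ 0 ω).re, fun ω => (ξ 0 ω).im; P] = 0)
    {p q : ℕ → ℕ → ℝ} {M V : ℝ}
    (hV : Tendsto (fun m => ∑ k ∈ Finset.Icc 1 m, (σ₁ ^ 2 * p m k ^ 2 + σ₂ ^ 2 * q m k ^ 2))
      atTop (𝓝 V))
    (hM : ∀ᶠ m in atTop, ∑ k ∈ Finset.Icc 1 m, (p m k ^ 2 + q m k ^ 2) ≤ M)
    (hmax : ∀ δ > 0, ∀ᶠ m in atTop, ∀ k, 1 ≤ k → k ≤ m → p m k ^ 2 + q m k ^ 2 ≤ δ) :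
    Tendsto (fun m => ∫ ω, Complex.exp (((∑ k ∈ Finset.Icc 1 m,
      (p m k * (ξ k ω).re + q m k * (ξ k ω).im) : ℝ) : ℂ) * Complex.I) ∂P) atTop
      (𝓝 (Complex.exp (-(V : ℂ) / 2))) := by
  set φ : ℝ → ℝ → ℂ := fun x y =>
    ∫ ω, Complex.exp (((x * (ξ 0 ω).re + y * (ξ 0 ω).im : ℝ) : ℂ) * Complex.I) ∂P with hφ
  set v : ℕ → ℕ → ℝ := fun m k => σ₁ ^ 2 * p m k ^ 2 + σ₂ ^ 2 * q m k ^ 2 with hv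
  have hξm : ∀ k, AEMeasurable (ξ k) P := fun k => (hident k).aemeasurable_fst
  have hprod : ∀ m, ∫ ω, Complex.exp (((∑ k ∈ Finset.Icc 1 m,
      (p m k * (ξ k ω).re + q m k * (ξ k ω).im) : ℝ) : ℂ) * Complex.I) ∂P
      = ∏ k ∈ Finset.Icc 1 m, φ (p m k) (q m k) := by
    intro m
    have hc : ∀ x y : ℝ, Continuous fun z : ℂ =>
        Complex.exp (((x * z.re + y * z.im : ℝ) : ℂ) * Complex.I) := fun x y => by fun_prop
    have h1 := iIndepFun.integral_fun_prod_comp (X := fun k : Finset.Icc 1 m => ξ k)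
      (hindep.precomp (g := ((↑) : Finset.Icc 1 m → ℕ)) Subtype.val_injective)
      (f := fun k z => Complex.exp (((p m k * z.re + q m k * z.im : ℝ) : ℂ) * Complex.I))
      (fun k => hξm k) (fun k => (hc _ _).aestronglyMeasurable)
    rw [← Finset.prod_coe_sort]
    convert h1 using 1
    · refine integral_congr_ae (Eventually.of_forall fun ω => ?_)
      simp only
      rw [← Complex.exp_sum, ← Finset.sum_mul, ← Complex.ofReal_sum]
      congr 3
      exact (Finset.sum_coe_sort (Finset.Icc 1 m)
        (fun k => p m k * (ξ k ω).re + q m k * (ξ k ω).im)).symm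
    · refine Finset.prod_congr rfl fun k _ => ?_
      exact ((hident k).comp (hc (p m k) (q m k)).measurable).integral_eq.symm
  have hφ1 : ∀ x y, ‖φ x y‖ ≤ 1 := fun x y => by
    refine (norm_integral_le_of_norm_le_const (C := 1) (Eventually.of_forall fun ω => ?_)).trans
      (by simp)
    rw [Complex.norm_exp_ofReal_mul_I]
  -- the comparison product of Gaussian characteristic functions
  have hgauss : Tendsto (fun m => ∏ k ∈ Finset.Icc 1 m, ((Real.exp (-(v m k / 2)) : ℝ) : ℂ)) atTop
      (𝓝 (Complex.exp (-(V : ℂ) / 2))) := by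
    have h1 : ∀ m, ∏ k ∈ Finset.Icc 1 m, ((Real.exp (-(v m k / 2)) : ℝ) : ℂ)
        = ((Real.exp (-((∑ k ∈ Finset.Icc 1 m, v m k) / 2)) : ℝ) : ℂ) := fun m => by
      rw [← Complex.ofReal_prod, ← Real.exp_sum, Finset.sum_neg_distrib, Finset.sum_div]
    simp only [h1]
    rw [show Complex.exp (-(V : ℂ) / 2) = ((Real.exp (-(V / 2)) : ℝ) : ℂ) by
      rw [Complex.ofReal_exp]; congr 1; push_cast; ring]
    exact (Complex.continuous_ofReal.tendsto _).comp
      ((Real.continuous_exp.tendsto _).comp (hV.div_const 2).neg)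
  simp only [hprod]
  rw [← tendsto_sub_nhds_zero_iff] at hgauss ⊢
  have hM0 : 0 ≤ M := by
    obtain ⟨m, hm⟩ := hM.exists
    exact le_trans (Finset.sum_nonneg fun _ _ => by positivity) hm
  have hdiff : Tendsto (fun m => ∏ k ∈ Finset.Icc 1 m, φ (p m k) (q m k) -
      ∏ k ∈ Finset.Icc 1 m, ((Real.exp (-(v m k / 2)) : ℝ) : ℂ)) atTop (𝓝 0) := by
    set S : ℝ := σ₁ ^ 2 + σ₂ ^ 2 with hS
    have hS0 : 0 ≤ S := by positivity
    rw [NormedAddGroup.tendsto_nhds_zero]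
    intro η hη
    -- each factor will cost `2 ε (p² + q²)`, and `∑ (p² + q²) ≤ M`
    set ε : ℝ := η / (4 * (M + 1)) with hε
    have hε0 : 0 < ε := by positivity
    obtain ⟨δ, hδ, hφδ⟩ := exists_norm_charFun_sub_le hL2 hmean hcov hε0
    have hδ' : 0 < min δ (min (1 / (S + 1)) (ε / (S ^ 2 + 1))) := by positivity
    filter_upwards [hM, hmax _ hδ'] with m hm hk
    calc _ ≤ ∑ k ∈ Finset.Icc 1 m, ‖φ (p m k) (q m k) - ((Real.exp (-(v m k / 2)) : ℝ) : ℂ)‖ := by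
          refine norm_prod_sub_prod_le _ _ _ (fun _ _ => hφ1 _ _) fun k _ => ?_
          rw [Complex.norm_real, Real.norm_of_nonneg (Real.exp_nonneg _), Real.exp_le_one_iff]
          have : 0 ≤ v m k := by positivity
          linarith
      _ ≤ ∑ k ∈ Finset.Icc 1 m, 2 * ε * (p m k ^ 2 + q m k ^ 2) := by
          refine Finset.sum_le_sum fun k hkm => ?_
          obtain ⟨hk1, hk2⟩ := Finset.mem_Icc.1 hkm
          have hρ := hk k hk1 hk2
          set ρ : ℝ := p m k ^ 2 + q m k ^ 2 with hρd
          have hρ0 : 0 ≤ ρ := by positivity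
          have hv0 : 0 ≤ v m k := by positivity
          have hvS : v m k ≤ S * ρ := by
            simp only [hv, hS, hρd]
            nlinarith [mul_nonneg (sq_nonneg σ₁) (sq_nonneg (q m k)),
              mul_nonneg (sq_nonneg σ₂) (sq_nonneg (p m k))]
          have hρS : ρ * (S + 1) ≤ 1 := by
            rw [← le_div_iff₀ (by positivity)]
            exact hρ.trans ((min_le_right _ _).trans (min_le_left _ _))
          have hρε : ρ * (S ^ 2 + 1) ≤ ε := by
            rw [← le_div_iff₀ (by positivity)]
            exact hρ.trans ((min_le_right _ _).trans (min_le_right _ _))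
          have h1 := hφδ (p m k) (q m k) (hρ.trans (min_le_left _ _))
          rw [← hσ₁, ← hσ₂] at h1
          have h2 := Real.abs_exp_sub_one_sub_id_le (x := -(v m k / 2)) (by
            rw [abs_neg, abs_of_nonneg (by positivity)]; nlinarith)
          have h3 : ‖(1 - ((v m k : ℝ) : ℂ) / 2) - ((Real.exp (-(v m k / 2)) : ℝ) : ℂ)‖
              ≤ ε * ρ := by
            rw [show (1 - ((v m k : ℝ) : ℂ) / 2) - ((Real.exp (-(v m k / 2)) : ℝ) : ℂ)
              = ((-(Real.exp (-(v m k / 2)) - 1 - -(v m k / 2)) : ℝ) : ℂ) by push_cast; ring,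
              Complex.norm_real, norm_neg, Real.norm_eq_abs]
            refine h2.trans ?_
            calc (-(v m k / 2)) ^ 2 ≤ v m k ^ 2 := by nlinarith
              _ ≤ (S * ρ) ^ 2 := pow_le_pow_left₀ hv0 hvS 2
              _ = ρ * S ^ 2 * ρ := by ring
              _ ≤ ε * ρ := mul_le_mul_of_nonneg_right (by nlinarith) hρ0
          have h4 := norm_add_le_of_le h1 h3
          rw [show 2 * ε * ρ = ε * ρ + ε * ρ by ring]
          refine le_trans (le_of_eq ?_) h4
          congr 1
          simp only [hv, hφ]
          ring
      _ = 2 * ε * ∑ k ∈ Finset.Icc 1 m, (p m k ^ 2 + q m k ^ 2) := by rw [Finset.mul_sum]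
      _ ≤ 2 * ε * M := by gcongr
      _ < η := by
          have : ε * (4 * (M + 1)) = η := by rw [hε]; field_simp
          nlinarith
  have := hdiff.add hgauss
  simpa using this

end CLT

/-! ### The self-inversive polynomials on the unit circle -/

/-- The frequencies `k/m - 1 - 1/(2m)` of the trigonometric polynomial obtained from
`t ↦ K_m(exp(it/m))` by removing the phase `exp(it(1 + 1/(2m)))`. -/
noncomputable def phaseFreq (m k : ℕ) : ℝ := (k : ℝ) / m - 1 - 1 / (2 * m)

/-- The real trigonometric polynomial `t ↦ exp(-it(1 + 1/(2m))) K_m(exp(it/m))`. -/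
noncomputable def phaseReduced (b : ℝ → ℝ) (x : ℕ → ℂ) (m : ℕ) (t : ℝ) : ℝ :=
  2 * (Complex.exp (phaseFreq m 0 * Complex.I * t) +
    ∑ k ∈ Finset.Icc 1 m, (b k : ℂ) * x k * Complex.exp (phaseFreq m k * Complex.I * t)).re

/-- The `n`-th derivative at `0` of `phaseReduced b x m`. -/
noncomputable def phaseCoeff (b : ℝ → ℝ) (x : ℕ → ℂ) (m n : ℕ) : ℝ :=
  2 * ((phaseFreq m 0 * Complex.I : ℂ) ^ n +
    ∑ k ∈ Finset.Icc 1 m, (b k : ℂ) * x k * (phaseFreq m k * Complex.I : ℂ) ^ n).re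

theorem abs_phaseFreq_le {m k : ℕ} (hkm : k ≤ m) : |phaseFreq m k| ≤ 2 := by
  rcases Nat.eq_zero_or_pos m with rfl | hm
  · simp [phaseFreq]
  have hm' : (1 : ℝ) ≤ m := by exact_mod_cast hm
  have h1 : (k : ℝ) / m ≤ 1 := (div_le_one (by linarith)).2 (by exact_mod_cast hkm)
  have h2 : 0 ≤ (k : ℝ) / m := by positivity
  have h3 : 1 / (2 * (m : ℝ)) ≤ 1 := by rw [div_le_one (by linarith)]; linarith
  have h4 : 0 ≤ 1 / (2 * (m : ℝ)) := by positivity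
  rw [phaseFreq, abs_le]
  constructor <;> linarith

theorem norm_phaseFreq_pow_le {m k : ℕ} (hkm : k ≤ m) (n : ℕ) :
    ‖(phaseFreq m k * Complex.I : ℂ) ^ n‖ ≤ 2 ^ n := by
  rw [norm_pow]
  refine pow_le_pow_left₀ (norm_nonneg _) ?_ n
  simpa using abs_phaseFreq_le hkm

/-- The terms `k` and `2m + 1 - k` of `K_m` on the unit circle are conjugate up to the phase of the
middle exponent `m + 1/2`. -/
theorem selfInversive_eq_phaseReduced_smul (b : ℝ → ℝ) (x : ℕ → ℂ) {m : ℕ} (hm : m ≠ 0) (t : ℝ) :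
    selfInversive b x m (Complex.exp (Complex.I * t / m)) =
      phaseReduced b x m t • Complex.exp (Complex.I * t * (1 + 1 / (2 * m))) := by
  have hmc : (m : ℂ) ≠ 0 := by exact_mod_cast hm
  set w : ℂ := Complex.exp (Complex.I * t * (1 + 1 / (2 * m))) with hw
  set e : ℕ → ℂ := fun k => Complex.exp (phaseFreq m k * Complex.I * t) with he
  have h1 : ∀ k : ℕ, Complex.exp (Complex.I * t / m) ^ k = w * e k := fun k => by
    rw [hw, he, ← Complex.exp_nat_mul, ← Complex.exp_add]
    congr 1
    simp only [phaseFreq]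
    push_cast
    field_simp
    ring
  have hconj : ∀ k, conj (e k) = Complex.exp (-(phaseFreq m k * Complex.I * t)) := fun k => by
    rw [he, ← Complex.exp_conj]
    simp
  have h2 : ∀ k : ℕ, k ≤ m → Complex.exp (Complex.I * t / m) ^ (2 * m + 1 - k) = w * conj (e k) :=
    fun k hk => by
    rw [hw, hconj, ← Complex.exp_nat_mul, ← Complex.exp_add]
    congr 1
    rw [Nat.cast_sub (by omega)]
    simp only [phaseFreq]
    push_cast
    field_simp
    ring
  have h3 : phaseReduced b x m t • w = (e 0 + ∑ k ∈ Finset.Icc 1 m, (b k : ℂ) * x k * e k +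
      conj (e 0 + ∑ k ∈ Finset.Icc 1 m, (b k : ℂ) * x k * e k)) * w := by
    rw [Complex.add_conj, phaseReduced, Complex.real_smul]
  have h0 := h1 0
  have h4 := h2 0 (Nat.zero_le _)
  rw [pow_zero] at h0
  rw [Nat.sub_zero] at h4
  rw [h3, selfInversive, h4]
  simp only [map_add, map_sum, map_mul, Complex.conj_ofReal]
  rw [show (1 : ℂ) = w * e 0 from h0]
  have s1 : ∑ k ∈ Finset.Icc 1 m, (b k : ℂ) * x k * Complex.exp (Complex.I * t / m) ^ k
      = (∑ k ∈ Finset.Icc 1 m, (b k : ℂ) * x k * e k) * w := by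
    rw [Finset.sum_mul]
    exact Finset.sum_congr rfl fun k _ => by rw [h1]; ring
  have s2 : ∑ k ∈ Finset.Icc 1 m, (b k : ℂ) * conj (x k) *
      Complex.exp (Complex.I * t / m) ^ (2 * m + 1 - k)
      = (∑ k ∈ Finset.Icc 1 m, (b k : ℂ) * conj (x k) * conj (e k)) * w := by
    rw [Finset.sum_mul]
    exact Finset.sum_congr rfl fun k hk => by rw [h2 k (Finset.mem_Icc.1 hk).2]; ring
  rw [s1, s2]
  ring

theorem abs_phaseCoeff_le (b : ℝ → ℝ) (x : ℕ → ℂ) (m n : ℕ) :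
    |phaseCoeff b x m n| ≤ 2 * (1 + ∑ k ∈ Finset.Icc 1 m, ‖(b k : ℂ) * x k‖) * 2 ^ n := by
  rw [phaseCoeff, abs_mul, abs_two, mul_assoc]
  gcongr
  refine (Complex.abs_re_le_norm _).trans ((norm_add_le _ _).trans ?_)
  rw [add_mul, one_mul, Finset.sum_mul]
  refine add_le_add (norm_phaseFreq_pow_le (Nat.zero_le _) n) ((norm_sum_le _ _).trans ?_)
  refine Finset.sum_le_sum fun k hk => ?_
  rw [norm_mul]
  gcongr
  exact norm_phaseFreq_pow_le (Finset.mem_Icc.1 hk).2 n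

theorem expSeries_phaseCoeff (b : ℝ → ℝ) (x : ℕ → ℂ) (m : ℕ) :
    expSeries (phaseCoeff b x m) = phaseReduced b x m := by
  funext t
  have h : ∀ k : ℕ, HasSum (fun n : ℕ => (phaseFreq m k * Complex.I : ℂ) ^ n *
      ((t : ℂ) ^ n / (n.factorial : ℂ))) (Complex.exp (phaseFreq m k * Complex.I * t)) := fun k => by
    have := NormedSpace.expSeries_div_hasSum_exp (phaseFreq m k * Complex.I * t : ℂ)
    rw [← Complex.exp_eq_exp_ℂ] at this
    simpa only [mul_pow _ (t : ℂ), mul_div_assoc] using this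
  have hs := (h 0).add (hasSum_sum (s := Finset.Icc 1 m)
    fun k _ => (h k).mul_left ((b k : ℂ) * x k))
  have hr := ((Complex.hasSum_re hs).mul_left 2).tsum_eq
  rw [phaseReduced, ← hr, expSeries]
  refine tsum_congr fun n => ?_
  have e : ((t : ℂ) ^ n / (n.factorial : ℂ)) = ((t ^ n / n.factorial : ℝ) : ℂ) := by push_cast; rfl
  rw [phaseCoeff, e, mul_div_assoc, mul_assoc, ← Complex.re_mul_ofReal, add_mul, Finset.sum_mul]
  congr 3
  exact Finset.sum_congr rfl fun k _ => by ring

theorem analyticOnNhd_phaseReduced (b : ℝ → ℝ) (x : ℕ → ℂ) (m : ℕ) :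
    AnalyticOnNhd ℝ (phaseReduced b x m) Set.univ := by
  rw [← expSeries_phaseCoeff]
  exact analyticOnNhd_expSeries (abs_phaseCoeff_le b x m)

theorem realZeros_selfInversive (b : ℝ → ℝ) (x : ℕ → ℂ) {m : ℕ} (hm : m ≠ 0) :
    realZeros (fun t : ℝ => selfInversive b x m (Complex.exp (Complex.I * t / m))) =
      realZeros (phaseReduced b x m) := by
  simp only [selfInversive_eq_phaseReduced_smul b x hm]
  refine realZeros_smul (analyticOnNhd_phaseReduced b x m) (fun t _ => ?_)
    fun t => Complex.exp_ne_zero _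
  have h : AnalyticAt ℂ (fun z : ℂ => Complex.exp (Complex.I * z * (1 + 1 / (2 * m)))) t := by
    fun_prop
  exact h.restrictScalars.comp (g := fun z : ℂ => Complex.exp (Complex.I * z * (1 + 1 / (2 * m))))
    (Complex.ofRealCLM.analyticAt t)

theorem expSeries_const_mul (a : ℝ) (d : ℕ → ℝ) (t : ℝ) :
    expSeries (fun n => a * d n) t = a * expSeries d t := by
  simp only [expSeries, mul_assoc, mul_div_assoc]
  exact tsum_mul_left

theorem phaseReduced_eq (b : ℝ → ℝ) (x : ℕ → ℂ) (m : ℕ) (t : ℝ) :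
    phaseReduced b x m t = 2 * Real.cos (phaseFreq m 0 * t) + ∑ k ∈ Finset.Icc 1 m,
      (2 * b k * Real.cos (phaseFreq m k * t) * (x k).re +
        -(2 * b k * Real.sin (phaseFreq m k * t)) * (x k).im) := by
  have h : ∀ k, Complex.exp (phaseFreq m k * Complex.I * t) =
      ⟨Real.cos (phaseFreq m k * t), Real.sin (phaseFreq m k * t)⟩ := fun k => by
    rw [show (phaseFreq m k * Complex.I * t : ℂ) = ((phaseFreq m k * t : ℝ) : ℂ) * Complex.I by
      push_cast; ring]
    apply Complex.ext
    · rw [Complex.exp_ofReal_mul_I_re]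
    · rw [Complex.exp_ofReal_mul_I_im]
  simp only [phaseReduced, h, Complex.add_re, Complex.re_sum, mul_add, Finset.mul_sum]
  congr 1
  refine Finset.sum_congr rfl fun k _ => ?_
  simp [Complex.mul_re]
  ring

/-! ### Limit theorem for the finite-dimensional distributions -/

/-- The variance of the linear combination `∑ c_j Y(t_j)` of the values of the limiting process. -/
noncomputable def tildeVariance {ι : Type*} (σ₁ σ₂ α : ℝ) (s : Finset ι) (c t : ι → ℝ) : ℝ :=
  4 * ∫ x in (0 : ℝ)..1, x ^ (2 * α) * (σ₁ ^ 2 * (∑ j ∈ s, c j * Real.cos (t j * (x - 1))) ^ 2 +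
    σ₂ ^ 2 * (∑ j ∈ s, c j * Real.sin (t j * (x - 1))) ^ 2)

theorem abs_sum_mul_le_sum_abs {ι : Type*} (s : Finset ι) (c f : ι → ℝ) (hf : ∀ j, |f j| ≤ 1) :
    |∑ j ∈ s, c j * f j| ≤ ∑ j ∈ s, |c j| := by
  refine (Finset.abs_sum_le_sum_abs _ _).trans (Finset.sum_le_sum fun j _ => ?_)
  rw [abs_mul]
  exact mul_le_of_le_one_right (abs_nonneg _) (hf j)

theorem tendsto_phaseFreq_ceil {s : ℝ} (hs : 0 < s) :
    Tendsto (fun m : ℕ => phaseFreq m ⌈m * s⌉₊) atTop (𝓝 (s - 1)) := by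
  have h1 : Tendsto (fun m : ℕ => ((⌈m * s⌉₊ : ℕ) : ℝ) / m) atTop (𝓝 s) := by
    simpa only [mul_comm s, Function.comp_def] using
      (tendsto_nat_ceil_mul_div_atTop hs.le).comp tendsto_natCast_atTop_atTop
  have h2 : Tendsto (fun m : ℕ => 1 / (2 * (m : ℝ))) atTop (𝓝 0) := by
    have := (tendsto_const_div_atTop_nhds_zero_nat (1 / 2 : ℝ))
    refine this.congr fun m => ?_
    rw [div_div]
  simpa [phaseFreq] using (h1.sub_const 1).sub h2

section Array

variable {Ω : Type*} [MeasurableSpace Ω] {P : Measure Ω} [IsProbabilityMeasure P] {ξ : ℕ → Ω → ℂ}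
  {σ₁ σ₂ : ℝ} {b : ℝ → ℝ} {α : ℝ}

/-- The normalising constant `1 / (b(m) √m)`. -/
noncomputable def phaseScale (b : ℝ → ℝ) (m : ℕ) : ℝ := (b m * √m)⁻¹

theorem phaseScale_sq (b : ℝ → ℝ) (m : ℕ) : phaseScale b m ^ 2 = (m : ℝ)⁻¹ / b m ^ 2 := by
  rw [phaseScale, inv_pow, mul_pow, Real.sq_sqrt (Nat.cast_nonneg m), mul_inv, div_eq_mul_inv,
    mul_comm]

theorem tendsto_phaseScale (hb : IsRegularlyVarying b α) (hα : -(1 / 2) < α) :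
    Tendsto (phaseScale b) atTop (𝓝 0) := by
  rw [NormedAddGroup.tendsto_nhds_zero]
  intro ε hε
  filter_upwards [hb.tendsto_max_weight hα (pow_pos hε 2)] with m hm
  rw [← phaseScale_sq] at hm
  exact abs_lt_of_sq_lt_sq hm.1 hε.le

theorem tendsto_sum_phaseScale (hb : IsRegularlyVarying b α) (hα : -(1 / 2) < α) {A : ℝ → ℝ}
    {M : ℝ} (hA : Continuous A) (hM : ∀ x, |A x| ≤ M) :
    Tendsto (fun m : ℕ => ∑ k ∈ Finset.Icc 1 m, (phaseScale b m * b k) ^ 2 * A (phaseFreq m k))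
      atTop (𝓝 (∫ s in (0 : ℝ)..1, s ^ (2 * α) * A (s - 1))) := by
  refine (hb.tendsto_sum_sq hα (a := fun m k => A (phaseFreq m k)) (M := M)
    (A := fun s => A (s - 1)) (fun m k _ _ => hM _) fun s h0 _ =>
      (hA.tendsto _).comp (tendsto_phaseFreq_ceil h0)).congr fun m => ?_
  rw [Finset.mul_sum]
  refine Finset.sum_congr rfl fun k _ => ?_
  rw [mul_pow, phaseScale_sq]
  ring

/-- Convergence of the finite-dimensional distributions of the normalised trigonometric polynomials,
in terms of characteristic functions. -/
theorem tendsto_integral_exp_phaseReduced (hindep : iIndepFun ξ P)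
    (hident : ∀ k, IdentDistrib (ξ k) (ξ 0) P P) (hL2 : MemLp (ξ 0) 2 P)
    (hmean : ∫ ω, ξ 0 ω ∂P = 0)
    (hσ₁ : σ₁ ^ 2 = ∫ ω, (ξ 0 ω).re ^ 2 ∂P) (hσ₂ : σ₂ ^ 2 = ∫ ω, (ξ 0 ω).im ^ 2 ∂P)
    (hcov : cov[fun ω => (ξ 0 ω).re, fun ω => (ξ 0 ω).im; P] = 0)
    (hb : IsRegularlyVarying b α) (hα : -(1 / 2) < α) {ι : Type*} (s : Finset ι) (c t : ι → ℝ) :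
    Tendsto (fun m => ∫ ω, Complex.exp (((∑ j ∈ s, c j *
      (phaseScale b m * phaseReduced b (fun k => ξ k ω) m (t j)) : ℝ) : ℂ) * Complex.I) ∂P) atTop
      (𝓝 (Complex.exp (-(tildeVariance σ₁ σ₂ α s c t : ℂ) / 2))) := by
  set C : ℝ → ℝ := fun θ => ∑ j ∈ s, c j * Real.cos (t j * θ) with hC
  set S : ℝ → ℝ := fun θ => ∑ j ∈ s, c j * Real.sin (t j * θ) with hS
  set L : ℝ := ∑ j ∈ s, |c j| with hL
  have hCc : Continuous C := by fun_prop
  have hSc : Continuous S := by fun_prop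
  have hCL : ∀ θ, |C θ| ≤ L := fun θ => abs_sum_mul_le_sum_abs s c _ fun j => Real.abs_cos_le_one _
  have hSL : ∀ θ, |S θ| ≤ L := fun θ => abs_sum_mul_le_sum_abs s c _ fun j => Real.abs_sin_le_one _
  have hL0 : 0 ≤ L := Finset.sum_nonneg fun _ _ => abs_nonneg _
  have hC2 : ∀ θ, C θ ^ 2 ≤ L ^ 2 := fun θ => sq_le_sq' (abs_le.1 (hCL θ)).1 (abs_le.1 (hCL θ)).2
  have hS2 : ∀ θ, S θ ^ 2 ≤ L ^ 2 := fun θ => sq_le_sq' (abs_le.1 (hSL θ)).1 (abs_le.1 (hSL θ)).2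
  set p : ℕ → ℕ → ℝ := fun m k => 2 * (phaseScale b m * b k) * C (phaseFreq m k) with hp
  set q : ℕ → ℕ → ℝ := fun m k => -(2 * (phaseScale b m * b k) * S (phaseFreq m k)) with hq
  have hdecomp : ∀ m ω, ∑ j ∈ s, c j * (phaseScale b m * phaseReduced b (fun k => ξ k ω) m (t j))
      = 2 * phaseScale b m * C (phaseFreq m 0) +
        ∑ k ∈ Finset.Icc 1 m, (p m k * (ξ k ω).re + q m k * (ξ k ω).im) := fun m ω => by
    simp only [phaseReduced_eq, mul_add, Finset.sum_add_distrib, hC, hS, hp, hq]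
    congr 1
    · rw [Finset.mul_sum]
      exact Finset.sum_congr rfl fun j _ => by rw [mul_comm (t j)]; ring
    · simp only [Finset.mul_sum]
      rw [Finset.sum_comm]
      congr 1
      · refine Finset.sum_congr rfl fun k _ => ?_
        rw [Finset.sum_mul]
        exact Finset.sum_congr rfl fun j _ => by rw [mul_comm (t j)]; ring
      · rw [Finset.sum_comm]
        refine Finset.sum_congr rfl fun k _ => ?_
        rw [← Finset.sum_neg_distrib, Finset.sum_mul]
        exact Finset.sum_congr rfl fun j _ => by rw [mul_comm (t j)]; ring
  have hsq : ∀ m k, p m k ^ 2 + q m k ^ 2 ≤ (phaseScale b m * b k) ^ 2 * (8 * L ^ 2) := fun m k => by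
    simp only [hp, hq]
    have := mul_le_mul_of_nonneg_left (add_le_add (hC2 (phaseFreq m k)) (hS2 (phaseFreq m k)))
      (sq_nonneg (phaseScale b m * b k))
    nlinarith
  have hclt := tendsto_integral_exp_sum hindep hident hL2 hmean hσ₁ hσ₂ hcov (p := p) (q := q)
    (V := tildeVariance σ₁ σ₂ α s c t)
    (M := (∫ x in (0 : ℝ)..1, x ^ (2 * α) * (8 * L ^ 2)) + 1) ?_ ?_ ?_
  -- the deterministic term, coming from `1 + z^(2m+1)`, is negligible
  · have hconst : Tendsto (fun m => Complex.exp (((2 * phaseScale b m * C (phaseFreq m 0) : ℝ) : ℂ)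
        * Complex.I)) atTop (𝓝 1) := by
      have h0 : Tendsto (fun m => 2 * phaseScale b m * C (phaseFreq m 0)) atTop (𝓝 0) := by
        refine Tendsto.zero_mul_isBoundedUnder_le ?_
          (isBoundedUnder_of ⟨L, fun m => hCL _⟩)
        simpa using (tendsto_phaseScale hb hα).const_mul 2
      have hc : Continuous fun x : ℝ => Complex.exp ((x : ℂ) * Complex.I) := by fun_prop
      have := (hc.tendsto 0).comp h0
      simpa [Function.comp_def] using this
    have h := hconst.mul hclt
    rw [one_mul] at h
    refine h.congr fun m => ?_
    rw [← integral_const_mul]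
    refine integral_congr_ae (Eventually.of_forall fun ω => ?_)
    simp only
    rw [hdecomp, ← Complex.exp_add]
    congr 1
    push_cast
    ring
  · have := (tendsto_sum_phaseScale hb hα (A := fun θ => σ₁ ^ 2 * C θ ^ 2 + σ₂ ^ 2 * S θ ^ 2)
      (M := σ₁ ^ 2 * L ^ 2 + σ₂ ^ 2 * L ^ 2) (by fun_prop) fun θ => ?_).const_mul 4
    · refine this.congr fun m => ?_
      rw [Finset.mul_sum]
      exact Finset.sum_congr rfl fun k _ => by simp only [hp, hq]; ring
    · rw [abs_of_nonneg (by positivity)]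
      exact add_le_add (mul_le_mul_of_nonneg_left (hC2 θ) (sq_nonneg _))
        (mul_le_mul_of_nonneg_left (hS2 θ) (sq_nonneg _))
  · have := tendsto_sum_phaseScale hb hα (A := fun _ => 8 * L ^ 2)
      (M := 8 * L ^ 2) (by fun_prop) fun θ => by rw [abs_of_nonneg (by positivity)]
    filter_upwards [this.eventually (gt_mem_nhds (lt_add_one _))] with m hm
    exact (Finset.sum_le_sum fun k _ => hsq m k).trans hm.le
  · intro δ hδ
    filter_upwards [hb.tendsto_max_weight hα (show 0 < δ / (8 * L ^ 2 + 1) by positivity)]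
      with m hm k hk1 hkm
    refine (hsq m k).trans ?_
    have h1 := hm.2 k hk1 hkm
    rw [lt_div_iff₀ (by positivity)] at h1
    have h2 : (phaseScale b m * b k) ^ 2 = (m : ℝ)⁻¹ * (b k ^ 2 / b m ^ 2) := by
      rw [mul_pow, phaseScale_sq]; ring
    rw [h2]
    have h3 : 0 ≤ (m : ℝ)⁻¹ * (b k ^ 2 / b m ^ 2) := by positivity
    nlinarith

/-- A uniform second moment bound for the normalised Taylor coefficients. -/
theorem exists_lintegral_sq_phaseCoeff_le (hindep : iIndepFun ξ P)
    (hident : ∀ k, IdentDistrib (ξ k) (ξ 0) P P) (hL2 : MemLp (ξ 0) 2 P)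
    (hmean : ∫ ω, ξ 0 ω ∂P = 0)
    (hcov : cov[fun ω => (ξ 0 ω).re, fun ω => (ξ 0 ω).im; P] = 0)
    (hb : IsRegularlyVarying b α) (hα : -(1 / 2) < α) :
    ∃ C : ℝ, 0 ≤ C ∧ ∀ᶠ m in atTop, ∀ n, ∫⁻ ω, ENNReal.ofReal
      ((phaseScale b m * phaseCoeff b (fun k => ξ k ω) m n) ^ 2) ∂P ≤
        ENNReal.ofReal (C * 4 ^ n) := by
  set s₁ : ℝ := ∫ ω, (ξ 0 ω).re ^ 2 ∂P with hs₁
  set s₂ : ℝ := ∫ ω, (ξ 0 ω).im ^ 2 ∂P with hs₂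
  have hs₁0 : 0 ≤ s₁ := integral_nonneg fun _ => sq_nonneg _
  have hs₂0 : 0 ≤ s₂ := integral_nonneg fun _ => sq_nonneg _
  set J : ℝ := ∫ x in (0 : ℝ)..1, x ^ (2 * α) * (4 * (s₁ + s₂)) with hJ
  have hJ0 : 0 ≤ J := intervalIntegral.integral_nonneg zero_le_one fun x hx =>
    mul_nonneg (Real.rpow_nonneg hx.1 _) (by positivity)
  refine ⟨4 + (J + 1), by positivity, ?_⟩
  have hlim := tendsto_sum_phaseScale hb hα (A := fun _ => 4 * (s₁ + s₂))
      (M := 4 * (s₁ + s₂)) (by fun_prop) fun θ => by rw [abs_of_nonneg (by positivity)]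
  filter_upwards [hlim.eventually (gt_mem_nhds (lt_add_one _)),
    hb.tendsto_max_weight hα one_pos] with m hm hm1 n
  rw [← phaseScale_sq] at hm1
  set r : ℕ → ℂ := fun k => (phaseFreq m k * Complex.I : ℂ) ^ n with hr
  -- frequencies are at most `2` in absolute value
  have hrn : ∀ k, k ≤ m → (r k).re ^ 2 ≤ 4 ^ n ∧ (r k).im ^ 2 ≤ 4 ^ n := fun k hk => by
    have h1 := norm_phaseFreq_pow_le hk n
    have h4 : ((2 : ℝ) ^ n) ^ 2 = 4 ^ n := by rw [← pow_mul, mul_comm, pow_mul]; norm_num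
    rw [← h4, ← sq_abs (r k).re, ← sq_abs (r k).im]
    exact ⟨pow_le_pow_left₀ (abs_nonneg _) ((Complex.abs_re_le_norm _).trans h1) 2,
      pow_le_pow_left₀ (abs_nonneg _) ((Complex.abs_im_le_norm _).trans h1) 2⟩
  set X : ℕ → Ω → ℝ := fun k ω => (2 * (phaseScale b m * b k) * (r k).re) * (ξ k ω).re +
    (-(2 * (phaseScale b m * b k) * (r k).im)) * (ξ k ω).im with hX
  have hξL : ∀ k, MemLp (ξ k) 2 P := fun k => (hident k).memLp_iff.2 hL2
  have hXL : ∀ k, MemLp (X k) 2 P := fun k =>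
    ((hξL k).re.const_mul _).add ((hξL k).im.const_mul _)
  have hmom : ∀ k, ∫ ω, X k ω ∂P = 0 ∧ ∫ ω, X k ω ^ 2 ∂P =
      s₁ * (2 * (phaseScale b m * b k) * (r k).re) ^ 2 +
        s₂ * (-(2 * (phaseScale b m * b k) * (r k).im)) ^ 2 := fun k => by
    obtain ⟨h1, h2⟩ := integral_sq_re_mul_add_im_mul hL2 hmean hcov
      (2 * (phaseScale b m * b k) * (r k).re) (-(2 * (phaseScale b m * b k) * (r k).im))
    have e1 := ((hident k).comp (u := fun z : ℂ => (2 * (phaseScale b m * b k) * (r k).re) * z.re +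
      (-(2 * (phaseScale b m * b k) * (r k).im)) * z.im)
      (by fun_prop)).integral_eq
    have e2 := ((hident k).comp (u := fun z : ℂ => ((2 * (phaseScale b m * b k) * (r k).re) * z.re +
      (-(2 * (phaseScale b m * b k) * (r k).im)) * z.im) ^ 2)
      (by fun_prop)).integral_eq
    exact ⟨e1.trans h1, e2.trans h2⟩
  set a : ℝ := 2 * (phaseScale b m * (r 0).re) with ha
  have hdecomp : ∀ ω, phaseScale b m * phaseCoeff b (fun k => ξ k ω) m n =
      a + ∑ k ∈ Finset.Icc 1 m, X k ω := fun ω => by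
    rw [phaseCoeff, Complex.add_re, Complex.re_sum, ha, mul_add, mul_add, Finset.mul_sum,
      Finset.mul_sum]
    congr 1
    · ring
    · refine Finset.sum_congr rfl fun k _ => ?_
      simp only [hX, hr, Complex.mul_re, Complex.mul_im, Complex.ofReal_re, Complex.ofReal_im]
      ring
  set T : Ω → ℝ := ∑ k ∈ Finset.Icc 1 m, X k with hT
  have hTL : MemLp T 2 P := memLp_finsetSum' _ fun k _ => hXL k
  have hT0 : ∫ ω, T ω ∂P = 0 := by
    simp only [hT, Finset.sum_apply]
    rw [integral_finsetSum _ fun k _ => (hXL k).integrable (by norm_num)]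
    exact Finset.sum_eq_zero fun k _ => (hmom k).1
  have hT2 : ∫ ω, T ω ^ 2 ∂P = ∑ k ∈ Finset.Icc 1 m, ∫ ω, X k ω ^ 2 ∂P := by
    have h1 := IndepFun.variance_sum (s := Finset.Icc 1 m) (fun k _ => hXL k) (by
      intro i _ j _ hij
      have := (hindep.indepFun hij).comp
        (φ := fun z : ℂ => (2 * (phaseScale b m * b i) * (r i).re) * z.re +
          (-(2 * (phaseScale b m * b i) * (r i).im)) * z.im)
        (ψ := fun z : ℂ => (2 * (phaseScale b m * b j) * (r j).re) * z.re +
          (-(2 * (phaseScale b m * b j) * (r j).im)) * z.im) (by fun_prop) (by fun_prop)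
      exact this)
    have h2 := variance_of_integral_eq_zero hTL.aemeasurable hT0
    rw [← h2, hT, h1]
    exact Finset.sum_congr rfl fun k _ =>
      variance_of_integral_eq_zero (hXL k).aemeasurable (hmom k).1
  have hTi : Integrable (fun ω => (a + T ω) ^ 2) P := ((memLp_const a).add hTL).integrable_sq
  simp only [hdecomp]
  have hTe : ∀ ω, ∑ k ∈ Finset.Icc 1 m, X k ω = T ω := fun ω => by rw [hT, Finset.sum_apply]
  simp only [hTe]
  rw [← ofReal_integral_eq_lintegral_ofReal hTi (Eventually.of_forall fun _ => sq_nonneg _)]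
  refine ENNReal.ofReal_le_ofReal ?_
  have hint : ∫ ω, (a + T ω) ^ 2 ∂P = a ^ 2 + ∫ ω, T ω ^ 2 ∂P := by
    have e : ∀ ω, (a + T ω) ^ 2 = a ^ 2 + 2 * a * T ω + T ω ^ 2 := fun ω => by ring
    simp only [e]
    have i1 : Integrable (fun ω => 2 * a * T ω) P := (hTL.integrable (by norm_num)).const_mul _
    have i2 : Integrable (fun ω => a ^ 2 + 2 * a * T ω) P := (integrable_const _).add i1
    rw [integral_add i2 hTL.integrable_sq, integral_add (integrable_const _) i1,
      integral_const_mul, hT0]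
    simp
  rw [hint, hT2, add_mul]
  refine add_le_add ?_ ?_
  · have h1 := (hrn 0 (Nat.zero_le _)).1
    rw [ha, show (2 * (phaseScale b m * (r 0).re)) ^ 2 =
      4 * (phaseScale b m ^ 2 * (r 0).re ^ 2) by ring]
    have := mul_le_mul hm1.1.le h1 (sq_nonneg _) zero_le_one
    linarith
  · calc _ ≤ ∑ k ∈ Finset.Icc 1 m, (phaseScale b m * b k) ^ 2 * (4 * (s₁ + s₂)) * 4 ^ n := by
          refine Finset.sum_le_sum fun k hk => ?_
          obtain ⟨h1, h2⟩ := hrn k (Finset.mem_Icc.1 hk).2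
          rw [(hmom k).2]
          have := mul_le_mul_of_nonneg_left (add_le_add (mul_le_mul_of_nonneg_left h1 hs₁0)
            (mul_le_mul_of_nonneg_left h2 hs₂0)) (sq_nonneg (phaseScale b m * b k))
          nlinarith
      _ ≤ (J + 1) * 4 ^ n := by
          rw [← Finset.sum_mul]
          exact mul_le_mul_of_nonneg_right hm.le (by positivity)

/-- Convergence of the point processes of zeros, for a limiting process `Y` with simple zeros and
with the finite-dimensional distributions found above. -/
theorem tendstoInDistribution_realZeros_selfInversive (hindep : iIndepFun ξ P)
    (hident : ∀ k, IdentDistrib (ξ k) (ξ 0) P P) (hL2 : MemLp (ξ 0) 2 P)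
    (hmean : ∫ ω, ξ 0 ω ∂P = 0)
    (hσ₁ : σ₁ ^ 2 = ∫ ω, (ξ 0 ω).re ^ 2 ∂P) (hσ₂ : σ₂ ^ 2 = ∫ ω, (ξ 0 ω).im ^ 2 ∂P)
    (hcov : cov[fun ω => (ξ 0 ω).re, fun ω => (ξ 0 ω).im; P] = 0)
    (hb : IsRegularlyVarying b α) (hα : -(1 / 2) < α)
    {Ω' : Type*} [MeasurableSpace Ω'] {P' : Measure Ω'} [IsProbabilityMeasure P'] {Y : Ω' → ℝ → ℝ}
    (hYm : ∀ t, AEMeasurable (fun ω => Y ω t) P')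
    (hYa : ∀ᵐ ω ∂P', AnalyticOnNhd ℝ (Y ω) Set.univ)
    (hYs : ∀ᵐ ω ∂P', ∀ t, Y ω t = 0 → deriv (Y ω) t ≠ 0)
    (hY : ∀ (N : ℕ) (c q : ℕ → ℝ), ∫ ω, Complex.exp
      (((∑ j ∈ Finset.range N, c j * Y ω (q j) : ℝ) : ℂ) * Complex.I) ∂P' =
        Complex.exp (-(tildeVariance σ₁ σ₂ α (Finset.range N) c q : ℂ) / 2)) :
    TendstoInDistribution (fun (m : ℕ) (ω : Ω) => realZeros fun t : ℝ =>
      selfInversive b (fun k => ξ k ω) m (Complex.exp (Complex.I * t / m)))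
      atTop (fun ω => realZeros (Y ω)) (fun _ => P) P' := by
  obtain ⟨C, hC, hD⟩ := exists_lintegral_sq_phaseCoeff_le hindep hident hL2 hmean hcov hb hα
  have hξm : ∀ k, AEMeasurable (ξ k) P := fun k => (hident k).aemeasurable_fst
  have hRm : ∀ m t, AEMeasurable (fun ω => phaseReduced b (fun k => ξ k ω) m t) P := fun m t => by
    simp only [phaseReduced]
    fun_prop
  have hexp : ∀ m ω, expSeries (fun n => phaseScale b m * phaseCoeff b (fun k => ξ k ω) m n) =
      fun t => phaseScale b m * phaseReduced b (fun k => ξ k ω) m t := fun m ω => by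
    funext t
    rw [expSeries_const_mul, expSeries_phaseCoeff]
  refine tendstoInDistribution_realZeros
    (D := fun m ω n => phaseScale b m * phaseCoeff b (fun k => ξ k ω) m n)
    (fun m => ?_) ?_ (fun m n => ?_) (fun m t => ?_) hC hD hYm hYa hYs fun N c q => ?_
  -- `m = 0` divides by zero in the exponent, but there the polynomial is deterministic
  · rcases eq_or_ne m 0 with rfl | hm
    · simp only [selfInversive]
      simp
    · simp only [realZeros_selfInversive _ _ hm]
      exact aemeasurable_realZeros (Eventually.of_forall fun ω => analyticOnNhd_phaseReduced _ _ _)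
        (hRm m)
  · filter_upwards [tendsto_natCast_atTop_atTop.eventually hb.eventually_pos,
      eventually_ne_atTop 0] with m hbm hm ω
    have hs : phaseScale b m ≠ 0 := by
      have : (0 : ℝ) < m := by exact_mod_cast Nat.pos_of_ne_zero hm
      rw [phaseScale]
      positivity
    rw [realZeros_selfInversive _ _ hm, hexp,
      ← realZeros_smul (g := fun _ => phaseScale b m) (analyticOnNhd_phaseReduced b _ m)
        analyticOnNhd_const fun _ => hs]
    simp only [smul_eq_mul, mul_comm]
  · simp only [phaseCoeff]
    fun_prop
  · simp only [hexp]
    exact (hRm m t).const_mul _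
  · simp only [hexp, hY]
    exact tendsto_integral_exp_phaseReduced hindep hident hL2 hmean hσ₁ hσ₂ hcov hb hα _ c q

end Array

/-! ### Absence of multiple zeros (Bulinskaya's argument) -/

theorem gaussianReal_Icc_le {v : ℝ} (hv : 0 < v) {δ : ℝ} (hδ : 0 ≤ δ) :
    gaussianReal 0 v.toNNReal (Set.Icc (-δ) δ) ≤ ENNReal.ofReal (δ / √v) := by
  have hv' : v.toNNReal ≠ 0 := (Real.toNNReal_pos.2 hv).ne'
  rw [gaussianReal_apply 0 hv']
  have hpdf : ∀ x, gaussianPDF 0 v.toNNReal x ≤ ENNReal.ofReal (√(2 * Real.pi * v))⁻¹ := fun x => by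
    refine ENNReal.ofReal_le_ofReal ?_
    rw [gaussianPDFReal, Real.coe_toNNReal _ hv.le]
    refine mul_le_of_le_one_right (by positivity) (Real.exp_le_one_iff.2 ?_)
    exact div_nonpos_of_nonpos_of_nonneg (neg_nonpos.2 (sq_nonneg _)) (by positivity)
  calc _ ≤ ∫⁻ _ in Set.Icc (-δ) δ, ENNReal.ofReal (√(2 * Real.pi * v))⁻¹ :=
        lintegral_mono fun x => hpdf x
    _ = ENNReal.ofReal ((√(2 * Real.pi * v))⁻¹ * (2 * δ)) := by
        rw [setLIntegral_const, Real.volume_Icc, ← ENNReal.ofReal_mul (by positivity)]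
        congr 2
        ring
    _ ≤ _ := by
        refine ENNReal.ofReal_le_ofReal ?_
        rw [Real.sqrt_mul (by positivity), mul_inv, div_eq_mul_inv]
        have h2 : 2 ≤ √(2 * Real.pi) := by
          refine Real.le_sqrt_of_sq_le ?_
          nlinarith [Real.pi_gt_three]
        have h3 : (√(2 * Real.pi))⁻¹ ≤ 2⁻¹ := inv_anti₀ two_pos h2
        have h4 : 0 ≤ (√v)⁻¹ * δ := by positivity
        nlinarith

/-- The bound `M` is a natural number so that a countable union over `M` exhausts all cases. -/
theorem exists_abs_le_mul_sq_of_double_zero {f : ℝ → ℝ} (hf : AnalyticOnNhd ℝ f Set.univ) {τ : ℝ}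
    (h0 : f τ = 0) (h1 : deriv f τ = 0) (a b : ℝ) :
    ∃ M : ℕ, τ ∈ Set.Icc a b → ∀ t ∈ Set.Icc a b, |f t| ≤ M * (t - τ) ^ 2 := by
  have hf1 : AnalyticOnNhd ℝ (deriv f) Set.univ := hf.deriv
  have hf2 : AnalyticOnNhd ℝ (deriv (deriv f)) Set.univ := hf1.deriv
  have hc : Continuous (deriv (deriv f)) := continuousOn_univ.1 hf2.continuousOn
  obtain ⟨C, hC⟩ := isCompact_Icc.exists_bound_of_continuousOn (s := Set.Icc a b) hc.continuousOn
  refine ⟨⌈C⌉₊, fun hτ t ht => ?_⟩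
  have hCM : C ≤ (⌈C⌉₊ : ℝ) := Nat.le_ceil C
  have hsub : Set.uIcc τ t ⊆ Set.Icc a b := (convex_Icc a b).ordConnected.uIcc_subset hτ ht
  have hd1 : ∀ s ∈ Set.uIcc τ t, ‖deriv f s‖ ≤ (⌈C⌉₊ : ℝ) * |t - τ| := fun s hs => by
    have := (convex_Icc a b).norm_image_sub_le_of_norm_deriv_le (f := deriv f)
      (fun x _ => (hf1 x (Set.mem_univ x)).differentiableAt) (fun x hx => (hC x hx).trans hCM)
      hτ (hsub hs)
    rw [h1, sub_zero] at this
    refine this.trans (mul_le_mul_of_nonneg_left ?_ (Nat.cast_nonneg _))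
    exact Set.abs_sub_left_of_mem_uIcc hs
  have := (convex_uIcc τ t).norm_image_sub_le_of_norm_deriv_le (f := f)
      (fun x _ => (hf x (Set.mem_univ x)).differentiableAt) hd1
      Set.left_mem_uIcc Set.right_mem_uIcc
  rw [h0, sub_zero, Real.norm_eq_abs, Real.norm_eq_abs, mul_assoc, ← sq, sq_abs] at this
  exact this

section Bulinskaya

variable {Ω : Type*} [MeasurableSpace Ω] {P : Measure Ω} {Y : Ω → ℝ → ℝ} {v : ℝ → ℝ}

theorem measure_abs_le_of_hasLaw {X : Ω → ℝ} {v δ : ℝ}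
    (h : HasLaw X (gaussianReal 0 v.toNNReal) P) (hv : 0 < v) (hδ : 0 ≤ δ) :
    P {ω | |X ω| ≤ δ} ≤ ENNReal.ofReal (δ / √v) := by
  refine le_trans (le_of_eq ?_) (gaussianReal_Icc_le hv hδ)
  rw [← h.map_eq, Measure.map_apply_of_aemeasurable h.aemeasurable measurableSet_Icc]
  congr 1
  ext ω
  simp [abs_le]

/-- Near a multiple zero `Y` is quadratically small, hence smaller than `M (l / n)²` at a point of the
grid of mesh `l / n`; this has probability `O(n⁻²)` at each of the `n + 1` points. -/
theorem ae_forall_mem_Icc_deriv_ne_zero (hYa : ∀ᵐ ω ∂P, AnalyticOnNhd ℝ (Y ω) Set.univ)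
    (hlaw : ∀ t, HasLaw (fun ω => Y ω t) (gaussianReal 0 (v t).toNNReal) P) {a b κ : ℝ}
    (hκ : 0 < κ) (hv : ∀ t ∈ Set.Icc a b, κ ≤ v t) :
    ∀ᵐ ω ∂P, ∀ t ∈ Set.Icc a b, Y ω t = 0 → deriv (Y ω) t ≠ 0 := by
  have hnull : ∀ M : ℕ, ∀ᵐ ω ∂P, ¬ ∃ τ ∈ Set.Icc a b, ∀ t ∈ Set.Icc a b,
      |Y ω t| ≤ M * (t - τ) ^ 2 := fun M => by
    rw [ae_iff]
    simp only [not_not]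
    rcases lt_or_ge b a with hab | hab
    · simp [Set.Icc_eq_empty_of_lt hab]
    set l := b - a with hl
    have hl0 : 0 ≤ l := by rw [hl]; linarith
    -- union bound over the grid of mesh `(b - a) / n`
    have hle : ∀ n : ℕ, 0 < n → P {ω | ∃ τ ∈ Set.Icc a b, ∀ t ∈ Set.Icc a b,
        |Y ω t| ≤ M * (t - τ) ^ 2} ≤ ENNReal.ofReal ((n + 1) * (M * (l / n) ^ 2 / √κ)) := by
      intro n hn
      have hn' : (0 : ℝ) < n := by exact_mod_cast hn
      have hmem : ∀ j ∈ Finset.range (n + 1), a + l * j / n ∈ Set.Icc a b := fun j hj => by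
        have hj' : (j : ℝ) ≤ n := by
          exact_mod_cast Nat.lt_succ_iff.1 (Finset.mem_range.1 hj)
        have : l * j / n ≤ l := by
          rw [div_le_iff₀ hn']
          exact mul_le_mul_of_nonneg_left hj' hl0
        have : 0 ≤ l * j / n := by positivity
        constructor <;> linarith
      calc _ ≤ P (⋃ j ∈ Finset.range (n + 1), {ω | |Y ω (a + l * j / n)| ≤ M * (l / n) ^ 2}) := by
            refine measure_mono fun ω => ?_
            rintro ⟨τ, hτ, h⟩
            simp only [Set.mem_iUnion]
            rcases hl0.eq_or_lt with hl1 | hl1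
            · refine ⟨0, by simp, ?_⟩
              have hτa : τ = a := le_antisymm (by linarith [hτ.2]) hτ.1
              have := h a ⟨le_rfl, hab⟩
              simpa [hτa, ← hl1] using this
            · have hx0 : 0 ≤ (τ - a) * n / l := by
                have := hτ.1
                exact div_nonneg (mul_nonneg (by linarith) hn'.le) hl0
              have hj1 := Nat.floor_le hx0
              have hj2 := Nat.lt_floor_add_one ((τ - a) * n / l)
              set j := ⌊(τ - a) * n / l⌋₊
              have hxn : (τ - a) * n / l ≤ n := by
                rw [div_le_iff₀ hl1, mul_comm]
                exact mul_le_mul_of_nonneg_left (by linarith [hτ.2]) hn'.le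
              have hjn : j ∈ Finset.range (n + 1) := by
                rw [Finset.mem_range, Nat.lt_succ_iff]
                exact_mod_cast hj1.trans hxn
              refine ⟨j, hjn, (h _ (hmem j hjn)).trans ?_⟩
              refine mul_le_mul_of_nonneg_left ?_ (Nat.cast_nonneg M)
              refine sq_le_sq' ?_ ?_
              · rw [div_lt_iff₀ hl1] at hj2
                have : (a + l * j / n - τ) * n ≥ -(l / n) * n := by
                  have e1 : (a + l * j / n - τ) * n = l * j - (τ - a) * n := by field_simp; ring
                  have e2 : -(l / n) * n = -l := by field_simp
                  rw [e1, e2]; nlinarith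
                exact le_of_mul_le_mul_right this hn'
              · rw [le_div_iff₀ hl1] at hj1
                have : (a + l * j / n - τ) * n ≤ l / n * n := by
                  have e1 : (a + l * j / n - τ) * n = l * j - (τ - a) * n := by field_simp; ring
                  have e2 : (l / n) * n = l := by field_simp
                  rw [e1, e2]; nlinarith
                exact le_of_mul_le_mul_right this hn'
        _ ≤ ∑ j ∈ Finset.range (n + 1), P {ω | |Y ω (a + l * j / n)| ≤ M * (l / n) ^ 2} :=
            measure_biUnion_finset_le _ _
        _ ≤ ∑ j ∈ Finset.range (n + 1), ENNReal.ofReal (M * (l / n) ^ 2 / √κ) := by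
            refine Finset.sum_le_sum fun j hj => ?_
            have hvj := hv _ (hmem j hj)
            refine (measure_abs_le_of_hasLaw (hlaw _) (hκ.trans_le hvj) (by positivity)).trans
              (ENNReal.ofReal_le_ofReal ?_)
            have := Real.sqrt_pos.2 hκ
            gcongr
        _ = _ := by
            rw [Finset.sum_const, Finset.card_range, nsmul_eq_mul,
              ENNReal.ofReal_mul (by positivity)]
            congr 1
            rw [ENNReal.ofReal_add (by positivity) zero_le_one, ENNReal.ofReal_natCast]
            simp
    have hlim : Tendsto (fun n : ℕ => ENNReal.ofReal ((n + 1) * (M * (l / n) ^ 2 / √κ))) atTop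
        (𝓝 0) := by
      rw [← ENNReal.ofReal_zero]
      refine ENNReal.tendsto_ofReal ?_
      have h1 : Tendsto (fun n : ℕ => (1 : ℝ) / n) atTop (𝓝 0) :=
        tendsto_const_div_atTop_nhds_zero_nat 1
      have h2 := ((h1.add (h1.mul h1)).mul_const (M * l ^ 2 / √κ))
      simp only [mul_zero, add_zero, zero_mul] at h2
      refine h2.congr' ?_
      filter_upwards [eventually_gt_atTop 0] with n hn
      have hn' : (0 : ℝ) < n := by exact_mod_cast hn
      field_simp
    refine le_antisymm (ge_of_tendsto hlim ?_) zero_le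
    filter_upwards [eventually_gt_atTop 0] with n hn using hle n hn
  filter_upwards [hYa, ae_all_iff.2 hnull] with ω ha hn t ht h0 h1
  obtain ⟨M, hM⟩ := exists_abs_le_mul_sq_of_double_zero ha h0 h1 a b
  exact hn M ⟨t, ht, hM ht⟩

/-- At the origin the variance may vanish, but not faster than `t²`, and a multiple zero there forces
`Y(1/n) = O(n⁻²)`. -/
theorem ae_deriv_ne_zero_at_zero (hYa : ∀ᵐ ω ∂P, AnalyticOnNhd ℝ (Y ω) Set.univ)
    (hlaw : ∀ t, HasLaw (fun ω => Y ω t) (gaussianReal 0 (v t).toNNReal) P) {κ : ℝ}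
    (hκ : 0 < κ) (hv : ∀ n : ℕ, 0 < n → κ / n ^ 2 ≤ v (1 / n)) :
    ∀ᵐ ω ∂P, Y ω 0 = 0 → deriv (Y ω) 0 ≠ 0 := by
  have hnull : ∀ M : ℕ, ∀ᵐ ω ∂P, ¬ ∀ n : ℕ, 0 < n → |Y ω (1 / n)| ≤ M * (1 / n) ^ 2 := fun M => by
    rw [ae_iff]
    simp only [not_not]
    have hle : ∀ n : ℕ, 0 < n → P {ω | ∀ n : ℕ, 0 < n → |Y ω (1 / n)| ≤ M * (1 / n) ^ 2} ≤
        ENNReal.ofReal (M / √κ * (1 / n)) := fun n hn => by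
      have hn' : (0 : ℝ) < n := by exact_mod_cast hn
      have hvn := hv n hn
      have hp : 0 < κ / (n : ℝ) ^ 2 := by positivity
      refine (measure_mono (t := {ω | |Y ω (1 / n)| ≤ M * (1 / n) ^ 2})
        (Set.ofPred_subset_ofPred.2 fun ω h => h n hn)).trans ((measure_abs_le_of_hasLaw (hlaw _)
        (hp.trans_le hvn) (by positivity)).trans (ENNReal.ofReal_le_ofReal ?_))
      calc M * (1 / (n : ℝ)) ^ 2 / √(v (1 / n)) ≤ M * (1 / (n : ℝ)) ^ 2 / √(κ / n ^ 2) := by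
            have := Real.sqrt_pos.2 hp
            gcongr
        _ = _ := by
            have := Real.sqrt_pos.2 hκ
            rw [Real.sqrt_div hκ.le, Real.sqrt_sq hn'.le]
            field_simp
    have hlim : Tendsto (fun n : ℕ => ENNReal.ofReal (M / √κ * (1 / n))) atTop (𝓝 0) := by
      rw [← ENNReal.ofReal_zero]
      refine ENNReal.tendsto_ofReal ?_
      simpa using (tendsto_const_div_atTop_nhds_zero_nat (1 : ℝ)).const_mul (M / √κ)
    refine le_antisymm (ge_of_tendsto hlim ?_) zero_le
    filter_upwards [eventually_gt_atTop 0] with n hn using hle n hn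
  filter_upwards [hYa, ae_all_iff.2 hnull] with ω ha hn h0 h1
  obtain ⟨M, hM⟩ := exists_abs_le_mul_sq_of_double_zero ha h0 h1 0 1
  refine hn M fun n hn0 => ?_
  have hn1 : (1 : ℝ) ≤ n := by exact_mod_cast hn0
  simpa using hM ⟨le_rfl, zero_le_one⟩ (1 / n)
    ⟨by positivity, (div_le_one (by linarith)).2 hn1⟩

/-- A centred Gaussian process with analytic paths and variance at least `c_T (s₁ + s₂ t²)` on
`[-T, T]` has no multiple zeros. -/
theorem ae_forall_deriv_ne_zero (hYa : ∀ᵐ ω ∂P, AnalyticOnNhd ℝ (Y ω) Set.univ)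
    (hlaw : ∀ t, HasLaw (fun ω => Y ω t) (gaussianReal 0 (v t).toNNReal) P) {s₁ s₂ : ℝ}
    (hs₁ : 0 ≤ s₁) (hs₂ : 0 ≤ s₂) (hs : 0 < s₁ + s₂)
    (hv : ∀ T : ℝ, 2 ≤ T → ∃ κ > 0, ∀ t, |t| ≤ T → κ * (s₁ + s₂ * t ^ 2) ≤ v t) :
    ∀ᵐ ω ∂P, ∀ t, Y ω t = 0 → deriv (Y ω) t ≠ 0 := by
  have hkey : ∀ (k : ℕ) (t : ℝ), 1 / ((k : ℝ) + 1) ≤ |t| →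
      (s₁ + s₂) * (1 / ((k : ℝ) + 1)) ^ 2 ≤ s₁ + s₂ * t ^ 2 := fun k t ht => by
    have h0 : 0 < 1 / ((k : ℝ) + 1) := by positivity
    have h1 : 1 / ((k : ℝ) + 1) ≤ 1 :=
      (div_le_one (by positivity)).2 (by linarith [k.cast_nonneg (α := ℝ)])
    have h2 : (1 / ((k : ℝ) + 1)) ^ 2 ≤ t ^ 2 := by
      rw [← sq_abs t]; exact pow_le_pow_left₀ h0.le ht 2
    have h3 : (1 / ((k : ℝ) + 1)) ^ 2 ≤ 1 := pow_le_one₀ h0.le h1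
    nlinarith
  -- away from the origin the variance is bounded below on compact intervals
  have hI : ∀ (k : ℕ) (a b : ℝ), (∀ t ∈ Set.Icc a b, 1 / ((k : ℝ) + 1) ≤ |t| ∧ |t| ≤ (k : ℝ) + 2) →
      ∀ᵐ ω ∂P, ∀ t ∈ Set.Icc a b, Y ω t = 0 → deriv (Y ω) t ≠ 0 := fun k a b hab => by
    obtain ⟨κ, hκ, h⟩ := hv (k + 2) (by linarith [k.cast_nonneg (α := ℝ)])
    refine ae_forall_mem_Icc_deriv_ne_zero hYa hlaw
      (κ := κ * ((s₁ + s₂) * (1 / ((k : ℝ) + 1)) ^ 2)) (by positivity) fun t ht => ?_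
    exact (mul_le_mul_of_nonneg_left (hkey k t (hab t ht).1) hκ.le).trans (h t (hab t ht).2)
  have h0 : ∀ᵐ ω ∂P, Y ω 0 = 0 → deriv (Y ω) 0 ≠ 0 := by
    obtain ⟨κ, hκ, h⟩ := hv 2 le_rfl
    refine ae_deriv_ne_zero_at_zero hYa hlaw (κ := κ * (s₁ + s₂)) (by positivity) fun n hn => ?_
    have hn1 : (1 : ℝ) ≤ n := by exact_mod_cast hn
    have hle : 1 / (n : ℝ) ≤ 1 := (div_le_one (by linarith)).2 hn1
    have hpos : 0 < 1 / (n : ℝ) := by positivity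
    refine le_trans ?_ (h (1 / n) (by rw [abs_of_pos hpos]; linarith))
    have h3 : (1 / (n : ℝ)) ^ 2 ≤ 1 := pow_le_one₀ hpos.le hle
    have : κ * (s₁ + s₂) / (n : ℝ) ^ 2 = κ * ((s₁ + s₂) * (1 / (n : ℝ)) ^ 2) := by
      field_simp
    rw [this]
    refine mul_le_mul_of_nonneg_left ?_ hκ.le
    nlinarith
  have hpos := ae_all_iff.2 fun k : ℕ => hI k (1 / ((k : ℝ) + 1)) (k + 2) fun t ht => by
    have : 0 < 1 / ((k : ℝ) + 1) := by positivity
    rw [abs_of_pos (this.trans_le ht.1)]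
    exact ht
  have hneg := ae_all_iff.2 fun k : ℕ => hI k (-(k + 2)) (-(1 / ((k : ℝ) + 1))) fun t ht => by
    have : 0 < 1 / ((k : ℝ) + 1) := by positivity
    rw [abs_of_neg (by linarith [ht.2])]
    exact ⟨by linarith [ht.2], by linarith [ht.1]⟩
  filter_upwards [h0, hpos, hneg] with ω e0 ep en t
  rcases eq_or_ne t 0 with rfl | ht
  · exact e0
  · obtain ⟨k₁, hk₁⟩ := exists_nat_one_div_lt (abs_pos.2 ht)
    obtain ⟨k₂, hk₂⟩ := exists_nat_ge |t|
    set k := max k₁ k₂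
    have c1 : (k₁ : ℝ) ≤ k := by exact_mod_cast le_max_left _ _
    have c2 : (k₂ : ℝ) ≤ k := by exact_mod_cast le_max_right _ _
    have h1 : 1 / ((k : ℝ) + 1) ≤ |t| := by
      refine le_trans ?_ hk₁.le
      gcongr
    rcases lt_or_gt_of_ne ht with h | h
    · rw [abs_of_neg h] at h1 hk₂
      exact en k t ⟨by linarith, by linarith⟩
    · rw [abs_of_pos h] at h1 hk₂
      exact ep k t ⟨h1, by linarith⟩

end Bulinskaya

/-- The lower bound for the variance of the limiting process comes from the part of the integral
near `x = 1`, where `t (x - 1)` is small. -/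
theorem exists_mul_le_tildeVariance {σ₁ σ₂ α : ℝ} (hα : -(1 / 2) < α) {T : ℝ} (hT : 2 ≤ T) :
    ∃ κ > 0, ∀ t, |t| ≤ T → κ * (σ₁ ^ 2 + σ₂ ^ 2 * t ^ 2) ≤
      tildeVariance σ₁ σ₂ α {()} (fun _ => 1) fun _ => t := by
  set ρ : ℝ := min 1 ((1 / 2 : ℝ) ^ (2 * α)) with hρ
  have hρ0 : 0 < ρ := by positivity
  have hT0 : 0 < T := by linarith
  have hTi : 1 / T ≤ 1 / 2 := one_div_le_one_div_of_le two_pos hT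
  have hTi0 : 0 < 1 / T := by positivity
  refine ⟨4 * (1 / (2 * T) * (ρ * (1 / (16 * T ^ 2)))), by positivity, fun t ht => ?_⟩
  set f : ℝ → ℝ := fun x => x ^ (2 * α) * (σ₁ ^ 2 * Real.cos (t * (x - 1)) ^ 2 +
    σ₂ ^ 2 * Real.sin (t * (x - 1)) ^ 2) with hf
  have hfi : IntervalIntegrable f volume 0 1 :=
    (intervalIntegral.intervalIntegrable_rpow' (by linarith)).mul_continuousOn (by fun_prop)
  have hlow : ∀ x ∈ Set.Icc (1 - 1 / T) (1 - 1 / (2 * T)),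
      ρ * (1 / (16 * T ^ 2)) * (σ₁ ^ 2 + σ₂ ^ 2 * t ^ 2) ≤ f x := fun x hx => by
    have hT2 : 1 / (2 * T) = 1 / T / 2 := by field_simp
    have hx1 : 1 / (2 * T) ≤ 1 - x := by linarith [hx.2]
    have hx2 : 1 - x ≤ 1 / T := by linarith [hx.1]
    have hx3 : 1 / 2 ≤ x := by linarith
    have hx4 : x ≤ 1 := by rw [hT2] at hx1; linarith
    have hpow : ρ ≤ x ^ (2 * α) := by
      rcases le_total 0 (2 * α) with h | h
      · exact (min_le_right _ _).trans (Real.rpow_le_rpow (by norm_num) hx3 h)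
      · exact (min_le_left _ _).trans
          (Real.one_le_rpow_of_pos_of_le_one_of_nonpos (by linarith) hx4 h)
    have habs : |t * (x - 1)| = |t| * (1 - x) := by
      rw [abs_mul, abs_sub_comm, abs_of_nonneg (show 0 ≤ 1 - x by linarith)]
    have hy1 : |t * (x - 1)| ≤ 1 := by
      rw [habs]
      calc |t| * (1 - x) ≤ T * (1 / T) := mul_le_mul ht hx2 (by linarith) hT0.le
        _ = 1 := by field_simp
    have hcos : 1 / 4 ≤ Real.cos (t * (x - 1)) ^ 2 := by
      have h1 := Real.one_sub_sq_div_two_le_cos (x := t * (x - 1))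
      have h2 : (t * (x - 1)) ^ 2 ≤ 1 := by rw [← sq_abs]; exact pow_le_one₀ (abs_nonneg _) hy1
      nlinarith
    have hsin : t ^ 2 * (1 / (16 * T ^ 2)) ≤ Real.sin (t * (x - 1)) ^ 2 := by
      have e : Real.sin (t * (x - 1)) ^ 2 = Real.sin |t * (x - 1)| ^ 2 := by
        rcases abs_choice (t * (x - 1)) with h | h <;> rw [h]
        rw [Real.sin_neg, neg_sq]
      have h1 := Real.mul_le_sin (abs_nonneg (t * (x - 1)))
        (by linarith [Real.pi_gt_three] : |t * (x - 1)| ≤ Real.pi / 2)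
      have h2 : 1 / 2 ≤ 2 / Real.pi := by
        rw [div_le_div_iff₀ two_pos Real.pi_pos]; linarith [Real.pi_le_four]
      have h3 : |t| * (1 / (4 * T)) ≤ Real.sin |t * (x - 1)| := by
        refine le_trans ?_ h1
        rw [habs]
        have h5 : |t| * (1 / (2 * T)) ≤ |t| * (1 - x) :=
          mul_le_mul_of_nonneg_left hx1 (abs_nonneg _)
        have h6 : 1 / (4 * T) = 1 / 2 * (1 / (2 * T)) := by field_simp; norm_num
        rw [h6]
        have h7 : 0 ≤ |t| * (1 - x) := mul_nonneg (abs_nonneg _) (by linarith)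
        nlinarith
      rw [e]
      calc t ^ 2 * (1 / (16 * T ^ 2)) = (|t| * (1 / (4 * T))) ^ 2 := by
            rw [mul_pow, sq_abs]; congr 1; field_simp; norm_num
        _ ≤ _ := pow_le_pow_left₀ (by positivity) h3 2
    have h16 : 1 / (16 * T ^ 2) ≤ 1 / 4 := by
      refine one_div_le_one_div_of_le (by norm_num) ?_
      nlinarith
    have hsum : 1 / (16 * T ^ 2) * (σ₁ ^ 2 + σ₂ ^ 2 * t ^ 2) ≤
        σ₁ ^ 2 * Real.cos (t * (x - 1)) ^ 2 + σ₂ ^ 2 * Real.sin (t * (x - 1)) ^ 2 := by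
      have h1 := mul_le_mul_of_nonneg_left (h16.trans hcos) (sq_nonneg σ₁)
      have h2 := mul_le_mul_of_nonneg_left hsin (sq_nonneg σ₂)
      linarith
    rw [mul_assoc]
    exact mul_le_mul hpow hsum (by positivity) (hρ0.le.trans hpow)
  have hf0 : ∀ x ∈ Set.Icc (0 : ℝ) 1, 0 ≤ f x := fun x hx =>
    mul_nonneg (Real.rpow_nonneg hx.1 _) (by positivity)
  have hT2 : 1 / (2 * T) = 1 / T / 2 := by field_simp
  have hmono : ∫ x in (1 - 1 / T)..(1 - 1 / (2 * T)), f x ≤ ∫ x in (0 : ℝ)..1, f x := by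
    refine intervalIntegral.integral_mono_interval (by linarith) (by linarith) (by linarith) ?_ hfi
    filter_upwards [ae_restrict_mem measurableSet_Ioc] with x hx
    exact hf0 x ⟨hx.1.le, hx.2⟩
  have hconst : 1 / (2 * T) * (ρ * (1 / (16 * T ^ 2)) * (σ₁ ^ 2 + σ₂ ^ 2 * t ^ 2)) ≤
      ∫ x in (1 - 1 / T)..(1 - 1 / (2 * T)), f x := by
    have h := intervalIntegral.integral_mono_on (a := 1 - 1 / T) (b := 1 - 1 / (2 * T))
      (f := fun _ => ρ * (1 / (16 * T ^ 2)) * (σ₁ ^ 2 + σ₂ ^ 2 * t ^ 2)) (g := f)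
      (by linarith) intervalIntegrable_const
      (hfi.mono_set (by
        rw [Set.uIcc_of_le (by linarith), Set.uIcc_of_le zero_le_one]
        exact Set.Icc_subset_Icc (by linarith) (by linarith))) hlow
    rw [intervalIntegral.integral_const, smul_eq_mul] at h
    refine le_trans (le_of_eq ?_) h
    congr 1
    rw [hT2]
    ring
  have := hconst.trans hmono
  rw [tildeVariance]
  simp only [Finset.sum_singleton, one_mul]
  linarith

/-! ### Centred Gaussian random variables -/

section Gaussian

variable {Ω : Type*} [MeasurableSpace Ω] {P : Measure Ω}

theorem integral_exp_of_hasLaw {X : Ω → ℝ} {v : ℝ} (hv : 0 ≤ v)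
    (h : HasLaw X (gaussianReal 0 v.toNNReal) P) (t : ℝ) :
    ∫ ω, Complex.exp ((t * X ω : ℝ) * Complex.I) ∂P = Complex.exp (-(v * t ^ 2 : ℝ) / 2) := by
  have hc : Continuous fun x : ℝ => Complex.exp ((t * x : ℝ) * Complex.I) := by fun_prop
  have h1 := h.integral_comp (f := fun x : ℝ => Complex.exp ((t * x : ℝ) * Complex.I))
    hc.aestronglyMeasurable
  have h2 := charFun_gaussianReal (μ := 0) (v := v.toNNReal) t
  rw [charFun_apply_real] at h2
  rw [show ∫ ω, Complex.exp ((t * X ω : ℝ) * Complex.I) ∂P =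
    P[(fun x : ℝ => Complex.exp ((t * x : ℝ) * Complex.I)) ∘ X] from rfl, h1]
  push_cast
  rw [h2, Real.coe_toNNReal _ hv]
  congr 1
  push_cast
  ring

theorem hasLaw_of_integral_exp [IsProbabilityMeasure P] {X : Ω → ℝ} (hX : AEMeasurable X P) {v : ℝ}
    (hv : 0 ≤ v) (h : ∀ t : ℝ, ∫ ω, Complex.exp ((t * X ω : ℝ) * Complex.I) ∂P =
      Complex.exp (-(v * t ^ 2 : ℝ) / 2)) : HasLaw X (gaussianReal 0 v.toNNReal) P := by
  have : IsProbabilityMeasure (P.map X) := Measure.isProbabilityMeasure_map hX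
  refine ⟨hX, Measure.ext_of_charFun (funext fun t => ?_)⟩
  have hid : HasLaw id (gaussianReal 0 v.toNNReal) (gaussianReal 0 v.toNNReal) := HasLaw.id
  have h1 := integral_exp_of_hasLaw hv hid t
  have hc : Continuous fun x : ℝ => Complex.exp (t * x * Complex.I) := by fun_prop
  rw [charFun_apply_real, charFun_apply_real, integral_map hX hc.aestronglyMeasurable]
  push_cast at h h1
  rw [h]
  exact h1.symm

theorem moments_of_hasLaw {X : Ω → ℝ} {v : ℝ} (hv : 0 ≤ v)
    (h : HasLaw X (gaussianReal 0 v.toNNReal) P) :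
    MemLp X 2 P ∧ ∫ ω, X ω ∂P = 0 ∧ ∫ ω, X ω ^ 2 ∂P = v := by
  have h0 : ∫ ω, X ω ∂P = 0 := by
    rw [h.integral_eq]; exact integral_id_gaussianReal
  refine ⟨?_, h0, ?_⟩
  · have := memLp_id_gaussianReal' (μ := 0) (v := v.toNNReal) 2 (by norm_num)
    rw [← h.map_eq] at this
    exact (memLp_map_measure_iff aestronglyMeasurable_id h.aemeasurable).1 this
  · rw [← variance_of_integral_eq_zero h.aemeasurable h0, h.variance_eq]
    have := variance_id_gaussianReal (μ := 0) (v := v.toNNReal)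
    rw [this, Real.coe_toNNReal _ hv]

/-- An almost sure limit of centred Gaussian random variables whose variances converge is
Gaussian. -/
theorem hasLaw_gaussianReal_of_tendsto [IsProbabilityMeasure P] {X : ℕ → Ω → ℝ} {Y : Ω → ℝ}
    {v : ℕ → ℝ} {w : ℝ} (hv : ∀ n, 0 ≤ v n)
    (hX : ∀ n, HasLaw (X n) (gaussianReal 0 (v n).toNNReal) P)
    (hlim : ∀ᵐ ω ∂P, Tendsto (fun n => X n ω) atTop (𝓝 (Y ω))) (hvw : Tendsto v atTop (𝓝 w)) :
    HasLaw Y (gaussianReal 0 w.toNNReal) P := by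
  have hY : AEMeasurable Y P :=
    aemeasurable_of_tendsto_metrizable_ae atTop (fun n => (hX n).aemeasurable) hlim
  refine hasLaw_of_integral_exp hY (ge_of_tendsto' hvw hv) fun t => ?_
  have hc : Continuous fun x : ℝ => Complex.exp ((t * x : ℝ) * Complex.I) := by fun_prop
  have h1 : Tendsto (fun n => ∫ ω, Complex.exp ((t * X n ω : ℝ) * Complex.I) ∂P) atTop
      (𝓝 (∫ ω, Complex.exp ((t * Y ω : ℝ) * Complex.I) ∂P)) := by
    refine tendsto_integral_of_dominated_convergence (fun _ => 1)
      (fun n => hc.comp_aestronglyMeasurable (hX n).aemeasurable.aestronglyMeasurable)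
      (integrable_const _) (fun n => Eventually.of_forall fun ω => ?_) ?_
    · rw [Complex.norm_exp_ofReal_mul_I]
    · filter_upwards [hlim] with ω hω
      exact (hc.tendsto _).comp hω
  simp only [fun n => integral_exp_of_hasLaw (hv n) (hX n) t] at h1
  have hc2 : Continuous fun x : ℝ => Complex.exp (-(x * t ^ 2 : ℝ) / 2) := by fun_prop
  exact tendsto_nhds_unique h1 ((hc2.tendsto w).comp hvw)

theorem hasLaw_gaussianReal_add {X Y : Ω → ℝ} {v w : ℝ} (hv : 0 ≤ v) (hw : 0 ≤ w)
    (hX : HasLaw X (gaussianReal 0 v.toNNReal) P) (hY : HasLaw Y (gaussianReal 0 w.toNNReal) P)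
    (h : IndepFun X Y P) : HasLaw (fun ω => X ω + Y ω) (gaussianReal 0 (v + w).toNNReal) P := by
  refine ⟨hX.aemeasurable.add hY.aemeasurable, ?_⟩
  have := gaussianReal_add_gaussianReal_of_indepFun h hX.map_eq hY.map_eq
  rw [add_zero] at this
  rw [Real.toNNReal_add hv hw, ← this]
  rfl

theorem HasGaussianLaw.hasLaw_of_moments {X : Ω → ℝ} (hX : HasGaussianLaw X P) {v : ℝ}
    (h0 : ∫ ω, X ω ∂P = 0) (h2 : ∫ ω, X ω ^ 2 ∂P = v) :
    HasLaw X (gaussianReal 0 v.toNNReal) P := by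
  refine ⟨hX.aemeasurable, ?_⟩
  rw [hX.map_eq_gaussianReal, h0, variance_of_integral_eq_zero hX.aemeasurable h0, h2]

end Gaussian

/-! ### Gaussian analytic functions from pairs of Gaussian integrals -/

section WienerPair

variable {Ω : Type*} [MeasurableSpace Ω] {P : Measure Ω} {α : ℝ}

/-- The integral `∫₀¹ x^(2α) ((Re ∑ a_j exp(u_j x))² + (Re ∑ b_j exp(u_j x))²) dx`. -/
noncomputable def wienerVariance {ι : Type*} (α : ℝ) (s : Finset ι) (u a b : ι → ℂ) : ℝ :=
  ∫ x in (0 : ℝ)..1, x ^ (2 * α) * ((∑ j ∈ s, (a j * Complex.exp (u j * x)).re) ^ 2 +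
    (∑ j ∈ s, (b j * Complex.exp (u j * x)).re) ^ 2)

/-- `Z₁ u` and `Z₂ u` behave like the integrals `∫₀¹ x^α exp(u x) dB_j(x)` against two independent
Brownian motions: real linear functionals of them are centred Gaussian with the variance given by
the Wiener isometry. -/
def IsWienerPair (α : ℝ) (Z₁ Z₂ : ℂ → Ω → ℂ) (P : Measure Ω) : Prop :=
  ∀ (ι : Type) (s : Finset ι) (u a b : ι → ℂ),
    HasLaw (fun ω => ∑ j ∈ s, ((a j * Z₁ (u j) ω).re + (b j * Z₂ (u j) ω).re))
      (gaussianReal 0 (wienerVariance α s u a b).toNNReal) P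

theorem wienerVariance_nonneg {ι : Type*} (s : Finset ι) (u a b : ι → ℂ) :
    0 ≤ wienerVariance α s u a b :=
  intervalIntegral.integral_nonneg zero_le_one fun x hx =>
    mul_nonneg (Real.rpow_nonneg hx.1 _) (by positivity)

theorem intervalIntegrable_rpow_mul {E : Type*} [NormedAddCommGroup E] [NormedSpace ℝ E]
    (hα : -(1 / 2) < α) {f : ℝ → E} (hf : Continuous f) :
    IntervalIntegrable (fun x : ℝ => x ^ (2 * α) • f x) volume 0 1 :=
  (intervalIntegral.intervalIntegrable_rpow' (by linarith)).smul_continuousOn hf.continuousOn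

/-- A real linear functional on `ℂ` is `z ↦ Re (c z)`. -/
theorem exists_eq_re_mul (L : ℂ →L[ℝ] ℝ) : ∃ c : ℂ, ∀ z, L z = (c * z).re := by
  refine ⟨⟨L 1, -L Complex.I⟩, fun z => ?_⟩
  have : z = z.re • (1 : ℂ) + z.im • Complex.I := by
    simp [Complex.re_add_im]
  conv_lhs => rw [this, map_add, map_smul, map_smul]
  simp [Complex.mul_re]
  ring

namespace IsWienerPair

variable {Z₁ Z₂ : ℂ → Ω → ℂ}

theorem hasLaw_gaf (h : IsWienerPair α Z₁ Z₂ P) (σ₁ σ₂ : ℝ) {ι : Type} (s : Finset ι)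
    (u a : ι → ℂ) : HasLaw (fun ω => ∑ j ∈ s, (a j *
      (σ₁ * Z₁ (u j) ω + Complex.I * σ₂ * Z₂ (u j) ω)).re) (gaussianReal 0
        (wienerVariance α s u (fun j => a j * σ₁) fun j => a j * (Complex.I * σ₂)).toNNReal) P := by
  have := h ι s u (fun j => a j * σ₁) fun j => a j * (Complex.I * σ₂)
  refine this.congr (Eventually.of_forall fun ω => Finset.sum_congr rfl fun j _ => ?_)
  rw [← Complex.add_re]
  congr 1
  ring

theorem integral_mul (h : IsWienerPair α Z₁ Z₂ P) (hα : -(1 / 2) < α) (σ₁ σ₂ : ℝ) (u v a b : ℂ) :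
    ∫ ω, (a * (σ₁ * Z₁ u ω + Complex.I * σ₂ * Z₂ u ω)).re *
      (b * (σ₁ * Z₁ v ω + Complex.I * σ₂ * Z₂ v ω)).re ∂P =
    ∫ x in (0 : ℝ)..1, x ^ (2 * α) * (σ₁ ^ 2 * ((a * Complex.exp (u * x)).re *
      (b * Complex.exp (v * x)).re) + σ₂ ^ 2 * ((a * Complex.exp (u * x)).im *
      (b * Complex.exp (v * x)).im)) := by
  set X : Ω → ℝ := fun ω => (a * (σ₁ * Z₁ u ω + Complex.I * σ₂ * Z₂ u ω)).re with hX
  set Y : Ω → ℝ := fun ω => (b * (σ₁ * Z₁ v ω + Complex.I * σ₂ * Z₂ v ω)).re with hY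
  have h1 := moments_of_hasLaw (wienerVariance_nonneg _ _ _ _)
    (h.hasLaw_gaf σ₁ σ₂ ({true} : Finset Bool) (fun _ => u) (fun _ => a))
  have h2 := moments_of_hasLaw (wienerVariance_nonneg _ _ _ _)
    (h.hasLaw_gaf σ₁ σ₂ ({true} : Finset Bool) (fun _ => v) (fun _ => b))
  have h3 := moments_of_hasLaw (wienerVariance_nonneg _ _ _ _)
    (h.hasLaw_gaf σ₁ σ₂ (Finset.univ : Finset Bool) (fun i => if i then u else v)
      (fun i => if i then a else b))
  simp only [Finset.sum_singleton, Fintype.sum_bool, if_true, Bool.false_eq_true, if_false,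
    wienerVariance] at h1 h2 h3
  obtain ⟨hXL, -, hX2⟩ := h1
  obtain ⟨hYL, -, hY2⟩ := h2
  obtain ⟨-, -, hXY2⟩ := h3
  have e : ∀ ω, X ω * Y ω = 1 / 2 * ((X ω + Y ω) ^ 2 - X ω ^ 2 - Y ω ^ 2) := fun ω => by ring
  have i1 : Integrable (fun ω => X ω ^ 2) P := hXL.integrable_sq
  have i2 : Integrable (fun ω => Y ω ^ 2) P := hYL.integrable_sq
  have i3 : Integrable (fun ω => (X ω + Y ω) ^ 2) P := (hXL.add hYL).integrable_sq
  have i4 : Integrable (fun ω => (X ω + Y ω) ^ 2 - X ω ^ 2) P := i3.sub i1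
  change ∫ ω, X ω * Y ω ∂P = _
  change ∫ ω, X ω ^ 2 ∂P = _ at hX2
  change ∫ ω, Y ω ^ 2 ∂P = _ at hY2
  change ∫ ω, (X ω + Y ω) ^ 2 ∂P = _ at hXY2
  simp only [e]
  rw [integral_const_mul, integral_sub i4 i2, integral_sub i3 i1, hX2, hY2, hXY2]
  have c : ∀ f : ℝ → ℝ, Continuous f →
      IntervalIntegrable (fun x : ℝ => x ^ (2 * α) * f x) volume 0 1 :=
    fun f hf => intervalIntegrable_rpow_mul hα hf
  rw [← intervalIntegral.integral_sub (c _ (by fun_prop)) (c _ (by fun_prop)),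
    ← intervalIntegral.integral_sub ((c _ (by fun_prop)).sub (c _ (by fun_prop)))
      (c _ (by fun_prop)), ← intervalIntegral.integral_const_mul]
  refine intervalIntegral.integral_congr fun x _ => ?_
  have e1 : ∀ (c w : ℂ) (σ : ℝ), (c * σ * w).re = σ * (c * w).re := fun c w σ => by
    rw [show c * σ * w = (σ : ℂ) * (c * w) by ring, Complex.re_ofReal_mul]
  have e2 : ∀ (c w : ℂ) (σ : ℝ), (c * (Complex.I * σ) * w).re = -(σ * (c * w).im) := fun c w σ => by
    rw [show c * (Complex.I * σ) * w = (σ : ℂ) * (Complex.I * (c * w)) by ring,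
      Complex.re_ofReal_mul, Complex.I_mul_re]
    ring
  simp only [e1, e2]
  ring

theorem hasLaw_re_mul (h : IsWienerPair α Z₁ Z₂ P) (σ₁ σ₂ : ℝ) (u a : ℂ) :
    HasLaw (fun ω => (a * (σ₁ * Z₁ u ω + Complex.I * σ₂ * Z₂ u ω)).re) (gaussianReal 0
      (wienerVariance α {()} (fun _ => u) (fun _ => a * σ₁)
        fun _ => a * (Complex.I * σ₂)).toNNReal) P := by
  simpa using h.hasLaw_gaf σ₁ σ₂ {()} (fun _ => u) fun _ => a

theorem memLp_re_mul (h : IsWienerPair α Z₁ Z₂ P) (σ₁ σ₂ : ℝ) (u a : ℂ) :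
    MemLp (fun ω => (a * (σ₁ * Z₁ u ω + Complex.I * σ₂ * Z₂ u ω)).re) 2 P :=
  (moments_of_hasLaw (wienerVariance_nonneg _ _ _ _) (h.hasLaw_re_mul σ₁ σ₂ u a)).1

theorem eq_re_add_im (z : ℂ) : z = (((1 * z).re : ℝ) : ℂ) + (((-Complex.I * z).re : ℝ) : ℂ) *
    Complex.I := by
  apply Complex.ext <;> simp

theorem aemeasurable_gaf (h : IsWienerPair α Z₁ Z₂ P) (σ₁ σ₂ : ℝ) (u : ℂ) :
    AEMeasurable (fun ω => σ₁ * Z₁ u ω + Complex.I * σ₂ * Z₂ u ω) P := by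
  have h1 := (h.hasLaw_re_mul σ₁ σ₂ u 1).aemeasurable
  have h2 := (h.hasLaw_re_mul σ₁ σ₂ u (-Complex.I)).aemeasurable
  rw [funext fun ω => eq_re_add_im (σ₁ * Z₁ u ω + Complex.I * σ₂ * Z₂ u ω)]
  exact (Complex.measurable_ofReal.comp_aemeasurable h1).add
    ((Complex.measurable_ofReal.comp_aemeasurable h2).mul_const _)

theorem isGaussianProcess_gaf (h : IsWienerPair α Z₁ Z₂ P) (σ₁ σ₂ : ℝ) :
    IsGaussianProcess (fun (u : ℂ) (ω : Ω) => σ₁ * Z₁ u ω + Complex.I * σ₂ * Z₂ u ω) P := by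
  refine ⟨fun I => ⟨isGaussian_of_map_eq_gaussianReal fun L => ?_⟩⟩
  have hm : AEMeasurable (fun ω => I.restrict
      (fun u => σ₁ * Z₁ u ω + Complex.I * σ₂ * Z₂ u ω)) P :=
    aemeasurable_pi_lambda _ fun i => h.aemeasurable_gaf σ₁ σ₂ i
  choose c hc using fun i : I =>
    exists_eq_re_mul (L.comp (ContinuousLinearMap.single ℝ (fun _ : I => ℂ) i))
  have hL : ∀ z : I → ℂ, L z = ∑ i, (c i * z i).re := fun z => by
    conv_lhs => rw [← Finset.univ_sum_single z, map_sum]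
    exact Finset.sum_congr rfl fun i _ => hc i (z i)
  classical
  have hlaw := h.hasLaw_gaf σ₁ σ₂ I (fun u => u) fun u => if hu : u ∈ I then c ⟨u, hu⟩ else 0
  refine ⟨0, _, Eq.trans ?_ hlaw.map_eq⟩
  rw [AEMeasurable.map_map_of_aemeasurable L.continuous.measurable.aemeasurable hm]
  congr 1
  funext ω
  rw [Function.comp_apply, hL, ← Finset.sum_coe_sort I]
  refine Finset.sum_congr rfl fun i _ => ?_
  rw [dif_pos i.2]
  rfl

theorem integral_gaf_eq_zero (h : IsWienerPair α Z₁ Z₂ P) (σ₁ σ₂ : ℝ) (u : ℂ) :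
    ∫ ω, (σ₁ * Z₁ u ω + Complex.I * σ₂ * Z₂ u ω) ∂P = 0 := by
  obtain ⟨m1, e1, -⟩ := moments_of_hasLaw (wienerVariance_nonneg _ _ _ _)
    (h.hasLaw_re_mul σ₁ σ₂ u 1)
  obtain ⟨m2, e2, -⟩ := moments_of_hasLaw (wienerVariance_nonneg _ _ _ _)
    (h.hasLaw_re_mul σ₁ σ₂ u (-Complex.I))
  have := h.isGaussianProcess_gaf σ₁ σ₂ |>.isProbabilityMeasure
  rw [integral_congr_ae (Eventually.of_forall fun ω =>
    eq_re_add_im (σ₁ * Z₁ u ω + Complex.I * σ₂ * Z₂ u ω)), integral_add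
    (m1.integrable (by norm_num)).ofReal ((m2.integrable (by norm_num)).ofReal.mul_const _),
    integral_mul_const, integral_complex_ofReal, integral_complex_ofReal, e1, e2]
  simp

/-- The expectation of a bilinear expression in the real and imaginary parts of two values. -/
theorem integral_bilinear (h : IsWienerPair α Z₁ Z₂ P) (hα : -(1 / 2) < α) (σ₁ σ₂ : ℝ) (u v : ℂ)
    {ι : Type*} (s : Finset ι) (κ a b : ι → ℂ) :
    ∫ ω, ∑ i ∈ s, κ i * (((a i * (σ₁ * Z₁ u ω + Complex.I * σ₂ * Z₂ u ω)).re *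
      (b i * (σ₁ * Z₁ v ω + Complex.I * σ₂ * Z₂ v ω)).re : ℝ) : ℂ) ∂P =
    ∫ x in (0 : ℝ)..1, ∑ i ∈ s, κ i * ((x ^ (2 * α) *
      (σ₁ ^ 2 * ((a i * Complex.exp (u * x)).re * (b i * Complex.exp (v * x)).re) +
        σ₂ ^ 2 * ((a i * Complex.exp (u * x)).im * (b i * Complex.exp (v * x)).im)) : ℝ) : ℂ) := by
  rw [integral_finsetSum, intervalIntegral.integral_finsetSum]
  · refine Finset.sum_congr rfl fun i _ => ?_
    rw [integral_const_mul, intervalIntegral.integral_const_mul, integral_complex_ofReal,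
      intervalIntegral.integral_ofReal, h.integral_mul hα]
  · intro i _
    refine IntervalIntegrable.const_mul ?_ _
    have := intervalIntegrable_rpow_mul hα (f := fun x : ℝ =>
      σ₁ ^ 2 * ((a i * Complex.exp (u * x)).re * (b i * Complex.exp (v * x)).re) +
        σ₂ ^ 2 * ((a i * Complex.exp (u * x)).im * (b i * Complex.exp (v * x)).im)) (by fun_prop)
    rw [intervalIntegrable_iff] at this ⊢
    exact this.ofReal
  · intro i _
    exact (((h.memLp_re_mul σ₁ σ₂ u (a i)).integrable_mul
      (h.memLp_re_mul σ₁ σ₂ v (b i))).ofReal).const_mul _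

theorem isLimitGAF (h : IsWienerPair α Z₁ Z₂ P) (hα : -(1 / 2) < α) (σ₁ σ₂ : ℝ)
    (hent : ∀ᵐ ω ∂P, Differentiable ℂ
      fun u => (σ₁ * Z₁ u ω + Complex.I * σ₂ * Z₂ u ω : ℂ)) :
    IsLimitGAF σ₁ σ₂ α (fun ω u => σ₁ * Z₁ u ω + Complex.I * σ₂ * Z₂ u ω) P := by
  have hre : ∀ z : ℂ, (1 * z).re = z.re := fun z => by simp
  have him : ∀ z : ℂ, (-Complex.I * z).re = z.im := fun z => by simp
  have him' : ∀ z : ℂ, (-Complex.I * z).im = -z.re := fun z => by simp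
  refine ⟨hent, h.isGaussianProcess_gaf σ₁ σ₂, h.integral_gaf_eq_zero σ₁ σ₂, fun u v => ?_,
    fun u v => ?_⟩
  · have key := h.integral_bilinear hα σ₁ σ₂ u v (Finset.univ : Finset (Fin 4))
      ![1, 1, Complex.I, -Complex.I] ![1, -Complex.I, -Complex.I, 1] ![1, -Complex.I, 1, -Complex.I]
    refine Eq.trans (integral_congr_ae (Eventually.of_forall fun ω => ?_))
      (key.trans ?_)
    · simp only [Fin.sum_univ_four, Matrix.cons_val, hre, him]
      apply Complex.ext <;> simp [Complex.mul_re, Complex.mul_im] <;> ring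
    · rw [← intervalIntegral.integral_const_mul]
      refine intervalIntegral.integral_congr fun x _ => ?_
      have e : Complex.exp (x * (u + conj v)) = Complex.exp (u * x) * conj (Complex.exp (v * x)) := by
        rw [← Complex.exp_conj, ← Complex.exp_add]
        congr 1
        rw [map_mul, Complex.conj_ofReal]
        ring
      simp only [e, Fin.sum_univ_four, Matrix.cons_val, him, him', one_mul]
      apply Complex.ext <;> simp [Complex.mul_re, Complex.mul_im] <;> ring
  · have key := h.integral_bilinear hα σ₁ σ₂ u v (Finset.univ : Finset (Fin 4))
      ![1, -1, Complex.I, Complex.I] ![1, -Complex.I, -Complex.I, 1] ![1, -Complex.I, 1, -Complex.I]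
    refine Eq.trans (integral_congr_ae (Eventually.of_forall fun ω => ?_))
      (key.trans ?_)
    · simp only [Fin.sum_univ_four, Matrix.cons_val, hre, him]
      apply Complex.ext <;> simp [Complex.mul_re, Complex.mul_im] <;> ring
    · rw [← intervalIntegral.integral_const_mul]
      refine intervalIntegral.integral_congr fun x _ => ?_
      have e : Complex.exp (x * (u + v)) = Complex.exp (u * x) * Complex.exp (v * x) := by
        rw [← Complex.exp_add]
        congr 1
        ring
      simp only [e, Fin.sum_univ_four, Matrix.cons_val, him, him', one_mul]
      apply Complex.ext <;> simp [Complex.mul_re, Complex.mul_im] <;> ring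

end IsWienerPair

end WienerPair

/-! ### The law of the transformed Gaussian analytic function -/

section Transform

variable {Ω : Type*} [MeasurableSpace Ω] {P : Measure Ω} {σ₁ σ₂ α : ℝ} {G : Ω → ℂ → ℂ}

/-- The real linear functional `z ↦ 2 Re (exp (-i t) z)`. -/
noncomputable def tildeFunctional (t : ℝ) : ℂ →L[ℝ] ℝ :=
  (2 : ℝ) • Complex.reCLM.comp
    ((ContinuousLinearMap.mul ℂ ℂ (Complex.exp (-(Complex.I * t)))).restrictScalars ℝ)

theorem tildeTransform_eq (g : ℂ → ℂ) (t : ℝ) :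
    tildeTransform g t = tildeFunctional t (g (Complex.I * t)) := by
  simp [tildeTransform, tildeFunctional]

theorem tildeVariance_nonneg {ι : Type*} (σ₁ σ₂ α : ℝ) (s : Finset ι) (c t : ι → ℝ) :
    0 ≤ tildeVariance σ₁ σ₂ α s c t :=
  mul_nonneg (by norm_num) (intervalIntegral.integral_nonneg zero_le_one fun x hx =>
    mul_nonneg (Real.rpow_nonneg hx.1 _) (by positivity))

namespace IsLimitGAF

theorem isGaussianProcess_tildeTransform (h : IsLimitGAF σ₁ σ₂ α G P) :
    IsGaussianProcess (fun (t : ℝ) (ω : Ω) => tildeTransform (G ω) t) P := by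
  simp only [tildeTransform_eq]
  exact (h.gaussian.comp_right (fun t : ℝ => Complex.I * t)).comp_left tildeFunctional

theorem memLp_two (h : IsLimitGAF σ₁ σ₂ α G P) (u : ℂ) : MemLp (fun ω => G ω u) 2 P :=
  (h.gaussian.hasGaussianLaw_eval u).memLp_two

theorem integral_tildeTransform (h : IsLimitGAF σ₁ σ₂ α G P) (t : ℝ) :
    ∫ ω, tildeTransform (G ω) t ∂P = 0 := by
  have := h.gaussian.isProbabilityMeasure
  simp only [tildeTransform_eq]
  rw [ContinuousLinearMap.integral_comp_comm _ ((h.memLp_two _).integrable (by norm_num)),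
    h.centred, map_zero]

theorem integral_tildeTransform_mul (h : IsLimitGAF σ₁ σ₂ α G P) (hα : -(1 / 2) < α) (s t : ℝ) :
    ∫ ω, tildeTransform (G ω) s * tildeTransform (G ω) t ∂P =
      4 * ∫ x in (0 : ℝ)..1, x ^ (2 * α) * (σ₁ ^ 2 * (Real.cos (s * (x - 1)) *
        Real.cos (t * (x - 1))) + σ₂ ^ 2 * (Real.sin (s * (x - 1)) * Real.sin (t * (x - 1)))) := by
  set E : ℝ → ℂ := fun r => Complex.exp (-(Complex.I * r)) with hE
  have e1 : ∀ ω, tildeTransform (G ω) s * tildeTransform (G ω) t =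
      Complex.reCLM (2 * (E s * conj (E t)) * (G ω (Complex.I * s) * conj (G ω (Complex.I * t))) +
        2 * (E s * E t) * (G ω (Complex.I * s) * G ω (Complex.I * t))) := fun ω => by
    simp only [tildeTransform, Complex.reCLM_apply]
    change 2 * (E s * _).re * (2 * (E t * _).re) = _
    simp [Complex.mul_re, Complex.mul_im]
    ring
  have hi : ∀ u v : ℂ, Integrable (fun ω => G ω u * G ω v) P := fun u v =>
    (h.memLp_two u).integrable_mul (h.memLp_two v)
  have hi' : ∀ u v : ℂ, Integrable (fun ω => G ω u * conj (G ω v)) P := fun u v =>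
    (h.memLp_two u).integrable_mul (h.memLp_two v).star
  simp only [e1]
  have hsum : Integrable (fun ω =>
      2 * (E s * conj (E t)) * (G ω (Complex.I * s) * conj (G ω (Complex.I * t))) +
        2 * (E s * E t) * (G ω (Complex.I * s) * G ω (Complex.I * t))) P :=
    ((hi' _ _).const_mul _).add ((hi _ _).const_mul _)
  rw [ContinuousLinearMap.integral_comp_comm _ hsum,
    integral_add ((hi' _ _).const_mul _) ((hi _ _).const_mul _), integral_const_mul,
    integral_const_mul, h.covariance, h.pseudoCovariance, ← intervalIntegral.integral_const_mul,
    ← intervalIntegral.integral_const_mul, ← intervalIntegral.integral_const_mul,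
    ← intervalIntegral.integral_const_mul, ← intervalIntegral.integral_const_mul]
  have hii : ∀ (κ₁ κ₂ u : ℂ), IntervalIntegrable (fun x : ℝ =>
      κ₁ * (κ₂ * (((x ^ (2 * α) : ℝ) : ℂ) * Complex.exp (x * u)))) volume 0 1 := fun κ₁ κ₂ u => by
    have := intervalIntegrable_rpow_mul hα (f := fun x : ℝ => Complex.exp (x * u)) (by fun_prop)
    simp only [Complex.real_smul] at this
    exact (this.const_mul _).const_mul _
  rw [← intervalIntegral.integral_add (hii _ _ _) (hii _ _ _),
    ← ContinuousLinearMap.intervalIntegral_comp_comm _ ((hii _ _ _).add (hii _ _ _))]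
  refine intervalIntegral.integral_congr fun x _ => ?_
  set F : ℝ → ℂ := fun r => Complex.exp ((r * (x - 1) : ℝ) * Complex.I) with hF
  have f1 : Complex.exp (x * (Complex.I * s + conj (Complex.I * t))) * (E s * conj (E t)) =
      F s * conj (F t) := by
    simp only [hE, hF, ← Complex.exp_conj, ← Complex.exp_add]
    congr 1
    simp
    ring
  have f2 : Complex.exp (x * (Complex.I * s + Complex.I * t)) * (E s * E t) = F s * F t := by
    simp only [hE, hF, ← Complex.exp_add]
    congr 1
    push_cast
    ring
  have hFre : ∀ r, (F r).re = Real.cos (r * (x - 1)) := fun r => Complex.exp_ofReal_mul_I_re _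
  have hFim : ∀ r, (F r).im = Real.sin (r * (x - 1)) := fun r => Complex.exp_ofReal_mul_I_im _
  have e2 : 2 * (E s * conj (E t)) * (((σ₁ ^ 2 + σ₂ ^ 2 : ℝ) : ℂ) * (((x ^ (2 * α) : ℝ) : ℂ) *
      Complex.exp (x * (Complex.I * s + conj (Complex.I * t))))) + 2 * (E s * E t) *
      (((σ₁ ^ 2 - σ₂ ^ 2 : ℝ) : ℂ) * (((x ^ (2 * α) : ℝ) : ℂ) *
      Complex.exp (x * (Complex.I * s + Complex.I * t)))) =
      ((2 * x ^ (2 * α) : ℝ) : ℂ) * (((σ₁ ^ 2 + σ₂ ^ 2 : ℝ) : ℂ) * (F s * conj (F t)) +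
        ((σ₁ ^ 2 - σ₂ ^ 2 : ℝ) : ℂ) * (F s * F t)) := by
    rw [← f1, ← f2]
    push_cast
    ring
  rw [e2, Complex.reCLM_apply, Complex.re_ofReal_mul, Complex.add_re, Complex.re_ofReal_mul,
    Complex.re_ofReal_mul, Complex.mul_re, Complex.mul_re, Complex.conj_re, Complex.conj_im]
  simp only [hFre, hFim]
  ring

/-- Linear combinations of the values of the transformed Gaussian analytic function. -/
theorem hasLaw_sum_tildeTransform (h : IsLimitGAF σ₁ σ₂ α G P) (hα : -(1 / 2) < α) {ι : Type*}
    (s : Finset ι) (c t : ι → ℝ) :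
    HasLaw (fun ω => ∑ j ∈ s, c j * tildeTransform (G ω) (t j))
      (gaussianReal 0 (tildeVariance σ₁ σ₂ α s c t).toNNReal) P := by
  have := h.gaussian.isProbabilityMeasure
  have hp := ((h.isGaussianProcess_tildeTransform.comp_right t).smul c).hasGaussianLaw_fun_sum
    (I := s)
  have hL : ∀ j, MemLp (fun ω => tildeTransform (G ω) (t j)) 2 P := fun j =>
    (h.isGaussianProcess_tildeTransform.hasGaussianLaw_eval (t j)).memLp_two
  refine HasGaussianLaw.hasLaw_of_moments hp ?_ ?_
  · change ∫ ω, ∑ j ∈ s, c j * tildeTransform (G ω) (t j) ∂P = 0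
    rw [integral_finsetSum _ fun j _ => ((hL j).integrable (by norm_num)).const_mul _]
    refine Finset.sum_eq_zero fun j _ => ?_
    rw [integral_const_mul, h.integral_tildeTransform, mul_zero]
  · change ∫ ω, (∑ j ∈ s, c j * tildeTransform (G ω) (t j)) ^ 2 ∂P = _
    have e : ∀ ω, (∑ j ∈ s, c j * tildeTransform (G ω) (t j)) ^ 2 = ∑ i ∈ s, ∑ j ∈ s,
        c i * c j * (tildeTransform (G ω) (t i) * tildeTransform (G ω) (t j)) := fun ω => by
      rw [sq, Finset.sum_mul_sum]
      exact Finset.sum_congr rfl fun i _ => Finset.sum_congr rfl fun j _ => by ring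
    have hint : ∀ i j, Integrable (fun ω => c i * c j *
        (tildeTransform (G ω) (t i) * tildeTransform (G ω) (t j))) P := fun i j =>
      ((hL i).integrable_mul (hL j)).const_mul _
    simp only [e]
    rw [integral_finsetSum _ fun i _ => integrable_finsetSum _ fun j _ => hint i j]
    simp only [integral_finsetSum _ fun j _ => hint _ j, integral_const_mul,
      h.integral_tildeTransform_mul hα]
    rw [tildeVariance]
    have hii : ∀ f : ℝ → ℝ, Continuous f →
        IntervalIntegrable (fun x : ℝ => x ^ (2 * α) * f x) volume 0 1 :=
      fun f hf => intervalIntegrable_rpow_mul hα hf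
    have e2 : ∀ x : ℝ, x ^ (2 * α) * (σ₁ ^ 2 * (∑ j ∈ s, c j * Real.cos (t j * (x - 1))) ^ 2 +
        σ₂ ^ 2 * (∑ j ∈ s, c j * Real.sin (t j * (x - 1))) ^ 2) =
        ∑ i ∈ s, ∑ j ∈ s, c i * c j * (x ^ (2 * α) * (σ₁ ^ 2 * (Real.cos (t i * (x - 1)) *
        Real.cos (t j * (x - 1))) + σ₂ ^ 2 * (Real.sin (t i * (x - 1)) *
          Real.sin (t j * (x - 1))))) := fun x => by
      rw [sq (∑ j ∈ s, c j * Real.cos (t j * (x - 1))), Finset.sum_mul_sum,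
        sq (∑ j ∈ s, c j * Real.sin (t j * (x - 1))), Finset.sum_mul_sum]
      simp only [Finset.mul_sum, ← Finset.sum_add_distrib]
      exact Finset.sum_congr rfl fun i _ => Finset.sum_congr rfl fun j _ => by ring
    simp only [e2]
    rw [intervalIntegral.integral_finsetSum, Finset.mul_sum]
    · refine Finset.sum_congr rfl fun i _ => ?_
      rw [intervalIntegral.integral_finsetSum, Finset.mul_sum]
      · refine Finset.sum_congr rfl fun j _ => ?_
        rw [intervalIntegral.integral_const_mul]
        ring
      · exact fun j _ => (hii _ (by fun_prop)).const_mul _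
    · intro i _
      have := IntervalIntegrable.sum s (f := fun j (x : ℝ) => c i * c j * (x ^ (2 * α) *
        (σ₁ ^ 2 * (Real.cos (t i * (x - 1)) * Real.cos (t j * (x - 1))) +
          σ₂ ^ 2 * (Real.sin (t i * (x - 1)) * Real.sin (t j * (x - 1))))))
        (a := 0) (b := 1) (μ := volume) fun j _ => (hii _ (by fun_prop)).const_mul _
      refine this.congr (fun x _ => ?_)
      simp

theorem analyticOnNhd_tildeTransform {g : ℂ → ℂ} (hg : Differentiable ℂ g) :
    AnalyticOnNhd ℝ (tildeTransform g) Set.univ := by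
  have h1 : Differentiable ℂ fun z : ℂ =>
      2 * (Complex.exp (-(Complex.I * z)) * g (Complex.I * z)) := by fun_prop
  refine (Differentiable.analyticOnNhd_re h1).congr isOpen_univ fun t _ => ?_
  simp [tildeTransform]

theorem ae_analyticOnNhd (h : IsLimitGAF σ₁ σ₂ α G P) :
    ∀ᵐ ω ∂P, AnalyticOnNhd ℝ (tildeTransform (G ω)) Set.univ :=
  h.entire.mono fun _ hω => analyticOnNhd_tildeTransform hω

theorem ae_simple_zeros (h : IsLimitGAF σ₁ σ₂ α G P) (hα : -(1 / 2) < α)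
    (hσ : 0 < σ₁ ^ 2 + σ₂ ^ 2) :
    ∀ᵐ ω ∂P, ∀ t : ℝ, tildeTransform (G ω) t = 0 → deriv (tildeTransform (G ω)) t ≠ 0 := by
  refine ae_forall_deriv_ne_zero (v := fun t => tildeVariance σ₁ σ₂ α {()} (fun _ => 1) fun _ => t)
    h.ae_analyticOnNhd (fun t => ?_) (sq_nonneg σ₁) (sq_nonneg σ₂) hσ
    fun T hT => exists_mul_le_tildeVariance hα hT
  simpa using h.hasLaw_sum_tildeTransform hα {()} (fun _ => 1) fun _ => t

theorem integral_exp_sum_tildeTransform (h : IsLimitGAF σ₁ σ₂ α G P) (hα : -(1 / 2) < α)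
    {ι : Type*} (s : Finset ι) (c t : ι → ℝ) :
    ∫ ω, Complex.exp (((∑ j ∈ s, c j * tildeTransform (G ω) (t j) : ℝ) : ℂ) * Complex.I) ∂P =
      Complex.exp (-(tildeVariance σ₁ σ₂ α s c t : ℂ) / 2) := by
  have := integral_exp_of_hasLaw (tildeVariance_nonneg _ _ _ _ _ _)
    (h.hasLaw_sum_tildeTransform hα s c t) 1
  simpa only [one_mul, one_pow, mul_one] using this

/-- The finite-dimensional distributions of the transform do not depend on the version. -/
theorem identDistrib_restrict_tildeTransform (h : IsLimitGAF σ₁ σ₂ α G P) (hα : -(1 / 2) < α)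
    {Ω' : Type*} [MeasurableSpace Ω'] {P' : Measure Ω'} {G' : Ω' → ℂ → ℂ}
    (h' : IsLimitGAF σ₁ σ₂ α G' P') (T : Finset ℝ) :
    IdentDistrib (fun ω => T.restrict (tildeTransform (G ω)))
      (fun ω => T.restrict (tildeTransform (G' ω))) P P' := by
  have hP := h.gaussian.isProbabilityMeasure
  have hP' := h'.gaussian.isProbabilityMeasure
  have hm : AEMeasurable (fun ω => T.restrict (tildeTransform (G ω))) P :=
    (h.isGaussianProcess_tildeTransform.hasGaussianLaw T).aemeasurable
  have hm' : AEMeasurable (fun ω => T.restrict (tildeTransform (G' ω))) P' :=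
    (h'.isGaussianProcess_tildeTransform.hasGaussianLaw T).aemeasurable
  have hp := Measure.isProbabilityMeasure_map hm
  have hp' := Measure.isProbabilityMeasure_map hm'
  refine ⟨hm, hm', Measure.ext_of_charFunDual (funext fun L => ?_)⟩
  have hL : ∀ z : T → ℝ, L z = ∑ i, L (Pi.single i 1) * z i := fun z => by
    conv_lhs => rw [← Finset.univ_sum_single z, map_sum]
    refine Finset.sum_congr rfl fun i _ => ?_
    rw [show (Pi.single i (z i) : T → ℝ) = z i • Pi.single i 1 by
      rw [← Pi.single_smul, smul_eq_mul, mul_one], map_smul, smul_eq_mul, mul_comm]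
  have hc : Continuous fun z : T → ℝ => Complex.exp (L z * Complex.I) := by fun_prop
  rw [charFunDual_apply, charFunDual_apply, integral_map hm hc.aestronglyMeasurable,
    integral_map hm' hc.aestronglyMeasurable]
  refine (integral_congr_ae (Eventually.of_forall fun ω => ?_)).trans
    ((h.integral_exp_sum_tildeTransform hα Finset.univ (fun i : T => L (Pi.single i 1))
      fun i => i).trans ((h'.integral_exp_sum_tildeTransform hα Finset.univ
        (fun i : T => L (Pi.single i 1)) fun i => i).symm.trans
          (integral_congr_ae (Eventually.of_forall fun ω => ?_))))
  · rw [hL]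
    rfl
  · beta_reduce
    rw [hL (T.restrict (tildeTransform (G' ω)))]
    rfl

end IsLimitGAF

end Transform

/-! ### Existence of the Gaussian analytic function -/

theorem hasLaw_gaussianReal_sum {Ω : Type*} [MeasurableSpace Ω] {P : Measure Ω} {ι : Type*}
    [Fintype ι] {X : ι → Ω → ℝ} {v : ι → ℝ} (hv : ∀ i, 0 ≤ v i)
    (hX : ∀ i, HasLaw (X i) (gaussianReal 0 (v i).toNNReal) P) (h : iIndepFun X P) :
    HasLaw (fun ω => ∑ i, X i ω) (gaussianReal 0 (∑ i, v i).toNNReal) P := by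
  have := h.isProbabilityMeasure
  have hm := fun i => moments_of_hasLaw (hv i) (hX i)
  have hsum : (fun ω => ∑ i, X i ω) = ∑ i, X i := by ext; simp
  have h0 : ∫ ω, ∑ i, X i ω ∂P = 0 := by
    rw [integral_finsetSum _ fun i _ => (hm i).1.integrable (by norm_num)]
    exact Finset.sum_eq_zero fun i _ => (hm i).2.1
  refine HasGaussianLaw.hasLaw_of_moments
    (iIndepFun.hasGaussianLaw_fun_sum (fun i => (hX i).hasGaussianLaw) h) h0 ?_
  have hL : MemLp (fun ω => ∑ i, X i ω) 2 P := memLp_finsetSum _ fun i _ => (hm i).1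
  rw [← variance_of_integral_eq_zero hL.aemeasurable h0, hsum,
    IndepFun.variance_sum (fun i _ => (hm i).1) fun i _ j _ hij => h.indepFun hij]
  refine Finset.sum_congr rfl fun i _ => ?_
  rw [variance_of_integral_eq_zero (hX i).aemeasurable (hm i).2.1, (hm i).2.2]

section GramSchmidt

open InnerProductSpace

variable {H : Type*} [NormedAddCommGroup H] [InnerProductSpace ℝ H]

theorem sum_gramSchmidt_eq (v : ℕ → H) {n N : ℕ} (hn : n < N) :
    v n = ∑ j ∈ Finset.range N, (inner ℝ (gramSchmidt ℝ v j) (v n) /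
      ‖gramSchmidt ℝ v j‖ ^ 2) • gramSchmidt ℝ v j := by
  have h1 : ∑ j ∈ Finset.range N, (inner ℝ (gramSchmidt ℝ v j) (v n) /
      ‖gramSchmidt ℝ v j‖ ^ 2) • gramSchmidt ℝ v j = ∑ j ∈ Finset.range (n + 1),
      (inner ℝ (gramSchmidt ℝ v j) (v n) / ‖gramSchmidt ℝ v j‖ ^ 2) • gramSchmidt ℝ v j := by
    refine (Finset.sum_subset (Finset.range_subset_range.2 hn) fun j _ hj => ?_).symm
    rw [gramSchmidt_inv_triangular ℝ v (by simpa using hj), zero_div, zero_smul]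
  have hself : inner ℝ (gramSchmidt ℝ v n) (v n) = ‖gramSchmidt ℝ v n‖ ^ 2 := by
    conv_lhs => rw [gramSchmidt_def'' ℝ v n]
    rw [inner_add_right, inner_sum, real_inner_self_eq_norm_sq, Finset.sum_eq_zero, add_zero]
    intro i hi
    rw [inner_smul_right, gramSchmidt_orthogonal ℝ v (Finset.mem_Iio.1 hi).ne', mul_zero]
  have hlast : (inner ℝ (gramSchmidt ℝ v n) (v n) / ‖gramSchmidt ℝ v n‖ ^ 2) •
      gramSchmidt ℝ v n = gramSchmidt ℝ v n := by
    rw [hself]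
    rcases eq_or_ne (gramSchmidt ℝ v n) 0 with h0 | h0
    · rw [h0, smul_zero]
    · rw [div_self (pow_ne_zero 2 (norm_ne_zero_iff.2 h0)), one_smul]
  rw [h1, Finset.sum_range_succ, hlast, add_comm]
  have h2 := gramSchmidt_def'' ℝ v n
  rw [show Finset.Iio n = Finset.range n from by ext; simp] at h2
  exact h2

/-- For every sequence of vectors of a Hilbert space there is a centred Gaussian sequence with the
same Gram matrix. -/
theorem exists_gaussian_sequence (v : ℕ → H) :
    ∃ (Ω : Type) (_ : MeasurableSpace Ω) (P : Measure Ω) (_ : IsProbabilityMeasure P)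
      (W : ℕ → Ω → ℝ), ∀ (N : ℕ) (c : ℕ → ℝ),
        HasLaw (fun ω => ∑ n ∈ Finset.range N, c n * W n ω)
          (gaussianReal 0 (‖∑ n ∈ Finset.range N, c n • v n‖ ^ 2).toNNReal) P := by
  -- expand in the Gram–Schmidt basis and replace the basis vectors by independent standard Gaussians
  obtain ⟨Ω, mΩ, P, ζ, -, hζ, hind, hP⟩ := exists_iid ℕ (gaussianReal 0 1)
  set g := gramSchmidt ℝ v with hg
  refine ⟨Ω, mΩ, P, hP, fun n ω => ∑ j ∈ Finset.range (n + 1),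
    inner ℝ (g j) (v n) / ‖g j‖ * ζ j ω, fun N c => ?_⟩
  set f : H := ∑ n ∈ Finset.range N, c n • v n with hf
  have hW : ∀ ω, ∑ n ∈ Finset.range N, c n * ∑ j ∈ Finset.range (n + 1),
      inner ℝ (g j) (v n) / ‖g j‖ * ζ j ω =
      ∑ j : Fin N, inner ℝ (g j) f / ‖g j‖ * ζ j ω := fun ω => by
    rw [Fin.sum_univ_eq_sum_range (fun j => inner ℝ (g j) f / ‖g j‖ * ζ j ω) N]
    have h1 : ∀ n ∈ Finset.range N, c n * ∑ j ∈ Finset.range (n + 1),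
        inner ℝ (g j) (v n) / ‖g j‖ * ζ j ω = ∑ j ∈ Finset.range N,
          c n * (inner ℝ (g j) (v n) / ‖g j‖ * ζ j ω) := fun n hn => by
      rw [← Finset.mul_sum]
      congr 1
      refine Finset.sum_subset (Finset.range_subset_range.2 (Finset.mem_range.1 hn))
        fun j _ hj => ?_
      rw [hg, gramSchmidt_inv_triangular ℝ v (by simpa using hj), zero_div, zero_mul]
    rw [Finset.sum_congr rfl h1, Finset.sum_comm]
    refine Finset.sum_congr rfl fun j _ => ?_
    rw [hf, inner_sum, Finset.sum_div, Finset.sum_mul]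
    refine Finset.sum_congr rfl fun n _ => ?_
    rw [inner_smul_right]
    ring
  have hexp : f = ∑ j ∈ Finset.range N, (inner ℝ (g j) f / ‖g j‖ ^ 2) • g j := by
    have h1 : ∀ j, (inner ℝ (g j) f / ‖g j‖ ^ 2) • g j =
        ∑ n ∈ Finset.range N, c n • (inner ℝ (g j) (v n) / ‖g j‖ ^ 2) • g j := fun j => by
      rw [hf, inner_sum, Finset.sum_div, Finset.sum_smul]
      refine Finset.sum_congr rfl fun n _ => ?_
      rw [inner_smul_right, smul_smul, mul_div_assoc]
    simp only [h1]
    rw [Finset.sum_comm, hf]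
    refine Finset.sum_congr rfl fun n hn => ?_
    rw [← Finset.smul_sum, ← sum_gramSchmidt_eq v (Finset.mem_range.1 hn)]
  -- Parseval; a vanishing `g j` contributes `0`, by the convention for division by `0`
  have hnorm : ‖f‖ ^ 2 = ∑ j : Fin N, (inner ℝ (g j) f / ‖g j‖) ^ 2 := by
    rw [Fin.sum_univ_eq_sum_range (fun j => (inner ℝ (g j) f / ‖g j‖) ^ 2) N,
      ← real_inner_self_eq_norm_sq]
    conv_lhs => rw [hexp, sum_inner]
    rw [← hexp]
    refine Finset.sum_congr rfl fun j _ => ?_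
    rw [inner_smul_left, div_pow]
    simp
    ring
  simp only [hW, hnorm]
  refine hasLaw_gaussianReal_sum (X := fun (j : Fin N) ω => inner ℝ (g j) f / ‖g j‖ * ζ j ω)
    (fun j => sq_nonneg _) (fun j => ?_) ?_
  · have := gaussianReal_const_mul (hζ j) (inner ℝ (g j) f / ‖g j‖)
    rw [mul_zero, mul_one] at this
    convert this using 2
    ext
    simp [sq_nonneg]
  · exact (hind.precomp (g := fun j : Fin N => (j : ℕ)) Fin.val_injective).comp
      (fun (j : Fin N) x => inner ℝ (g j) f / ‖g j‖ * x) fun j => by fun_prop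

end GramSchmidt

theorem memLp_rpow_smul {α : ℝ} (hα : -(1 / 2) < α) {p : ℝ → ℂ} (hp : Continuous p) :
    MemLp (fun x : ℝ => x ^ α • p x) 2 (volume.restrict (Set.Ioc 0 1)) := by
  have hm : AEStronglyMeasurable (fun x : ℝ => x ^ α • p x) (volume.restrict (Set.Ioc 0 1)) := by
    have h1 : Measurable fun x : ℝ => x ^ α := by fun_prop
    exact h1.aestronglyMeasurable.smul hp.aestronglyMeasurable
  rw [memLp_two_iff_integrable_sq_norm hm]
  have := intervalIntegrable_rpow_mul hα (f := fun x => ‖p x‖ ^ 2) (by fun_prop)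
  rw [intervalIntegrable_iff_integrableOn_Ioc_of_le zero_le_one] at this
  refine this.congr ?_
  filter_upwards [ae_restrict_mem measurableSet_Ioc] with x hx
  rw [norm_smul, mul_pow, Real.norm_of_nonneg (Real.rpow_nonneg hx.1.le _), smul_eq_mul,
    ← Real.rpow_natCast (x ^ α), ← Real.rpow_mul hx.1.le]
  congr 2
  push_cast
  ring

/-- A Gaussian sequence indexed like the vectors `x^α p_n(x)` of `L²([0, 1]; ℂ)`, viewed as a real
Hilbert space. -/
theorem exists_gaussian_sequence_rpow {α : ℝ} (hα : -(1 / 2) < α) (p : ℕ → ℝ → ℂ)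
    (hp : ∀ n, Continuous (p n)) :
    ∃ (Ω : Type) (_ : MeasurableSpace Ω) (P : Measure Ω) (_ : IsProbabilityMeasure P)
      (W : ℕ → Ω → ℝ), ∀ (N : ℕ) (c : ℕ → ℝ),
        HasLaw (fun ω => ∑ n ∈ Finset.range N, c n * W n ω) (gaussianReal 0
          (∫ x in (0 : ℝ)..1, x ^ (2 * α) *
            ‖∑ n ∈ Finset.range N, (c n : ℂ) * p n x‖ ^ 2).toNNReal) P := by
  obtain ⟨Ω, mΩ, P, hP, W, hW⟩ :=
    exists_gaussian_sequence fun n => (memLp_rpow_smul hα (hp n)).toLp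
  refine ⟨Ω, mΩ, P, hP, W, fun N c => ?_⟩
  convert hW N c using 3
  have hcont : ∀ N, Continuous fun x => ∑ n ∈ Finset.range N, (c n : ℂ) * p n x := fun N => by
    fun_prop
  have hsum : ∀ N, ∑ n ∈ Finset.range N, c n • (memLp_rpow_smul hα (hp n)).toLp =
      (memLp_rpow_smul hα (hcont N)).toLp := fun N => by
    induction N with
    | zero =>
      rw [Finset.sum_range_zero]
      refine ((Lp.eq_zero_iff_ae_eq_zero).2 ?_).symm
      filter_upwards [(memLp_rpow_smul hα (hcont 0)).coeFn_toLp] with x hx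
      rw [hx]
      simp
    | succ N ih =>
      rw [Finset.sum_range_succ, ih, ← MemLp.toLp_const_smul, ← MemLp.toLp_add]
      congr 1
      funext x
      simp only [Pi.add_apply, Pi.smul_apply, Finset.sum_range_succ, Complex.real_smul]
      ring
  rw [hsum, ← real_inner_self_eq_norm_sq, L2.inner_def,
    intervalIntegral.integral_of_le zero_le_one]
  refine integral_congr_ae ?_
  filter_upwards [ae_restrict_mem measurableSet_Ioc,
    (memLp_rpow_smul hα (hcont N)).coeFn_toLp] with x hx hx2
  rw [hx2, real_inner_self_eq_norm_sq, norm_smul, mul_pow,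
    Real.norm_of_nonneg (Real.rpow_nonneg hx.1.le _), ← Real.rpow_natCast (x ^ α),
    ← Real.rpow_mul hx.1.le]
  congr 2
  push_cast
  ring

theorem sum_range_two_mul {M : Type*} [AddCommMonoid M] (f : ℕ → M) (N : ℕ) :
    ∑ n ∈ Finset.range (2 * N), f n = ∑ n ∈ Finset.range N, (f (2 * n) + f (2 * n + 1)) := by
  induction N with
  | zero => simp
  | succ N ih => rw [Finset.sum_range_succ, ← ih, Nat.mul_succ, Finset.sum_range_succ,
      Finset.sum_range_succ, add_assoc]

theorem norm_sum_exp_partial_le (z : ℂ) (N : ℕ) :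
    ‖∑ n ∈ Finset.range N, z ^ n / (n.factorial : ℂ)‖ ≤ Real.exp ‖z‖ := by
  refine (norm_sum_le _ _).trans ?_
  simp only [norm_div, norm_pow, Complex.norm_natCast]
  exact Real.sum_le_exp_of_nonneg (norm_nonneg z) N

/-- The variances of the Taylor polynomials converge. -/
theorem tendsto_wienerVariance_partial {ι : Type*} {α : ℝ} (hα : -(1 / 2) < α) (s : Finset ι)
    (u a b : ι → ℂ) :
    Tendsto (fun N => ∫ x in (0 : ℝ)..1, x ^ (2 * α) *
      ((∑ j ∈ s, (a j * ∑ n ∈ Finset.range N, (u j * x) ^ n / (n.factorial : ℂ)).re) ^ 2 +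
        (∑ j ∈ s, (b j * ∑ n ∈ Finset.range N, (u j * x) ^ n / (n.factorial : ℂ)).re) ^ 2))
      atTop (𝓝 (wienerVariance α s u a b)) := by
  have hexp : ∀ z : ℂ, Tendsto (fun N => ∑ n ∈ Finset.range N, z ^ n / (n.factorial : ℂ)) atTop
      (𝓝 (Complex.exp z)) := fun z => by
    have := NormedSpace.expSeries_div_hasSum_exp z
    rw [← Complex.exp_eq_exp_ℂ] at this
    exact this.tendsto_sum_nat
  have hb : ∀ (c : ι → ℂ) (N : ℕ) (x : ℝ), x ∈ Set.uIoc (0 : ℝ) 1 →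
      (∑ j ∈ s, (c j * ∑ n ∈ Finset.range N, (u j * x) ^ n / (n.factorial : ℂ)).re) ^ 2 ≤
        (∑ j ∈ s, ‖c j‖ * Real.exp ‖u j‖) ^ 2 := fun c N x hx => by
    rw [Set.uIoc_of_le zero_le_one] at hx
    rw [← sq_abs]
    refine pow_le_pow_left₀ (abs_nonneg _) ?_ 2
    refine (Finset.abs_sum_le_sum_abs _ _).trans (Finset.sum_le_sum fun j _ => ?_)
    refine (Complex.abs_re_le_norm _).trans ?_
    rw [norm_mul]
    refine mul_le_mul_of_nonneg_left ((norm_sum_exp_partial_le _ N).trans ?_) (norm_nonneg _)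
    rw [Real.exp_le_exp, norm_mul, Complex.norm_real, Real.norm_of_nonneg hx.1.le]
    exact mul_le_of_le_one_right (norm_nonneg _) hx.2
  refine intervalIntegral.tendsto_integral_filter_of_dominated_convergence
    (fun x => x ^ (2 * α) * ((∑ j ∈ s, ‖a j‖ * Real.exp ‖u j‖) ^ 2 +
      (∑ j ∈ s, ‖b j‖ * Real.exp ‖u j‖) ^ 2)) ?_ ?_ ?_ ?_
  · refine Eventually.of_forall fun N => ?_
    have h := intervalIntegrable_rpow_mul hα (f := fun x : ℝ =>
      ((∑ j ∈ s, (a j * ∑ n ∈ Finset.range N, (u j * x) ^ n / (n.factorial : ℂ)).re) ^ 2 +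
        (∑ j ∈ s, (b j * ∑ n ∈ Finset.range N, (u j * x) ^ n / (n.factorial : ℂ)).re) ^ 2))
        (by fun_prop)
    exact (intervalIntegrable_iff.1 h).aestronglyMeasurable
  · refine Eventually.of_forall fun N => Eventually.of_forall fun x hx => ?_
    have hx' := hx
    rw [Set.uIoc_of_le zero_le_one] at hx'
    have h0 : 0 ≤ x ^ (2 * α) := Real.rpow_nonneg hx'.1.le _
    rw [Real.norm_of_nonneg (by positivity)]
    exact mul_le_mul_of_nonneg_left (add_le_add (hb a N x hx) (hb b N x hx)) h0
  · exact (intervalIntegral.intervalIntegrable_rpow' (by linarith)).mul_const _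
  · refine Eventually.of_forall fun x _ => Tendsto.const_mul _ ?_
    refine Tendsto.add (Tendsto.pow (tendsto_finsetSum _ fun j _ => ?_) 2)
      (Tendsto.pow (tendsto_finsetSum _ fun j _ => ?_) 2)
    · exact (Complex.continuous_re.tendsto _).comp ((hexp _).const_mul _)
    · exact (Complex.continuous_re.tendsto _).comp ((hexp _).const_mul _)

theorem ae_exists_mem_coeffBox {Ω : Type*} [MeasurableSpace Ω] {P : Measure Ω}
    {D : Ω → ℕ → ℝ} {C : ℝ} (hC : 0 ≤ C) (hDm : ∀ n, AEMeasurable (fun ω => D ω n) P)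
    (hD : ∀ n, ∫⁻ ω, ENNReal.ofReal (D ω n ^ 2) ∂P ≤ ENNReal.ofReal (C * 4 ^ n)) :
    ∀ᵐ ω ∂P, ∃ R : ℝ, D ω ∈ coeffBox R := by
  rw [ae_iff]
  have hlim : Tendsto (fun n : ℕ => ENNReal.ofReal (9 / 5 * C / (n : ℝ) ^ 2)) atTop (𝓝 0) := by
    rw [← ENNReal.ofReal_zero]
    refine ENNReal.tendsto_ofReal (Tendsto.div_atTop tendsto_const_nhds ?_)
    exact (tendsto_pow_atTop two_ne_zero).comp tendsto_natCast_atTop_atTop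
  refine le_antisymm (ge_of_tendsto hlim ?_) zero_le
  filter_upwards [eventually_gt_atTop 0] with n hn
  refine (measure_mono fun ω hω => ?_).trans
    (measure_notMem_coeffBox_le hC hDm hD (show (0 : ℝ) < n by exact_mod_cast hn))
  exact fun h => hω ⟨n, h⟩

theorem sum_sum_re_mul {ι : Type*} (s : Finset ι) (c : ι → ℂ) (z : ι → ℕ → ℂ) (w : ℕ → ℝ) {N : ℕ} :
    ∑ n ∈ Finset.range N, (∑ j ∈ s, (c j * z j n).re) * w n =
      ∑ j ∈ s, (c j * ∑ n ∈ Finset.range N, (w n : ℂ) * z j n).re := by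
  simp only [Finset.sum_mul, Finset.mul_sum, Complex.re_sum]
  rw [Finset.sum_comm]
  refine Finset.sum_congr rfl fun j _ => Finset.sum_congr rfl fun n _ => ?_
  rw [← Complex.re_mul_ofReal]
  congr 1
  ring

/-- Construction of the Gaussian analytic function as a power series `∑ Wₙ uⁿ / n!`, where `Wₙ` plays
the role of the integral of `x^(α + n)` against Brownian motion. -/
theorem exists_isLimitGAF {α : ℝ} (hα : -(1 / 2) < α) (σ₁ σ₂ : ℝ) :
    ∃ (Ω₀ : Type) (_ : MeasurableSpace Ω₀) (P₀ : Measure Ω₀) (_ : IsProbabilityMeasure P₀)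
      (G : Ω₀ → ℂ → ℂ), IsLimitGAF σ₁ σ₂ α G P₀ := by
  -- even indices: `x^(α + n)`; odd indices: `i x^(α + n)`
  set p : ℕ → ℝ → ℂ := fun k x => (if k % 2 = 0 then 1 else Complex.I) * (x : ℂ) ^ (k / 2) with hp
  have hpc : ∀ k, Continuous (p k) := fun k => by fun_prop
  have hp0 : ∀ n x, p (2 * n) x = (x : ℂ) ^ n := fun n x => by simp [hp]
  have hp1 : ∀ n x, p (2 * n + 1) x = Complex.I * (x : ℂ) ^ n := fun n x => by
    have h1 : (2 * n + 1) % 2 = 1 := by omega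
    have h2 : (2 * n + 1) / 2 = n := by omega
    simp [hp, h1, h2]
  obtain ⟨Ω, mΩ, P, hP, W, hW⟩ := exists_gaussian_sequence_rpow hα p hpc
  -- the law of a linear combination of both sequences
  have hW2 : ∀ (N : ℕ) (c d : ℕ → ℝ), HasLaw
      (fun ω => ∑ n ∈ Finset.range N, (c n * W (2 * n) ω + d n * W (2 * n + 1) ω))
      (gaussianReal 0 (∫ x in (0 : ℝ)..1, x ^ (2 * α) *
        ((∑ n ∈ Finset.range N, c n * x ^ n) ^ 2 +
          (∑ n ∈ Finset.range N, d n * x ^ n) ^ 2)).toNNReal) P := fun N c d => by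
    set e : ℕ → ℝ := fun k => if k % 2 = 0 then c (k / 2) else d (k / 2) with he
    have he0 : ∀ n, e (2 * n) = c n := fun n => by simp [he]
    have he1 : ∀ n, e (2 * n + 1) = d n := fun n => by
      have h1 : (2 * n + 1) % 2 = 1 := by omega
      have h2 : (2 * n + 1) / 2 = n := by omega
      simp [he, h1, h2]
    have h := hW (2 * N) e
    simp only [sum_range_two_mul, he0, he1, hp0, hp1] at h
    refine (Eq.mpr ?_ h)
    congr 3
    refine intervalIntegral.integral_congr fun x _ => ?_
    have e2 : ∑ n ∈ Finset.range N, ((c n : ℂ) * (x : ℂ) ^ n + (d n : ℂ) *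
        (Complex.I * (x : ℂ) ^ n)) = ((∑ n ∈ Finset.range N, c n * x ^ n : ℝ) : ℂ) +
          ((∑ n ∈ Finset.range N, d n * x ^ n : ℝ) : ℂ) * Complex.I := by
      push_cast
      rw [Finset.sum_add_distrib, Finset.sum_mul]
      congr 1
      exact Finset.sum_congr rfl fun n _ => by ring
    rw [e2, ← Complex.normSq_eq_norm_sq, Complex.normSq_add_mul_I]
  set V : ℝ := ∫ x in (0 : ℝ)..1, x ^ (2 * α) with hV
  have hV0 : 0 ≤ V :=
    intervalIntegral.integral_nonneg zero_le_one fun x hx => Real.rpow_nonneg hx.1 _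
  -- second moments of the coefficients
  have hmom : ∀ n, ∀ X : Ω → ℝ, HasLaw X (gaussianReal 0 (∫ x in (0 : ℝ)..1,
      x ^ (2 * α) * (x ^ n) ^ 2).toNNReal) P →
        ∫⁻ ω, ENNReal.ofReal (X ω ^ 2) ∂P ≤ ENNReal.ofReal (V * 4 ^ n) := fun n X hX => by
    obtain ⟨h1, -, h2⟩ := moments_of_hasLaw (intervalIntegral.integral_nonneg zero_le_one
      fun x hx => mul_nonneg (Real.rpow_nonneg hx.1 _) (sq_nonneg _)) hX
    rw [← ofReal_integral_eq_lintegral_ofReal h1.integrable_sq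
      (Eventually.of_forall fun _ => sq_nonneg _), h2]
    refine ENNReal.ofReal_le_ofReal ?_
    have h4 : (1 : ℝ) ≤ 4 ^ n := one_le_pow₀ (by norm_num)
    refine le_trans ?_ (le_mul_of_one_le_right hV0 h4)
    refine intervalIntegral.integral_mono_on zero_le_one
      (intervalIntegrable_rpow_mul hα (f := fun x => (x ^ n) ^ 2) (by fun_prop))
      (intervalIntegral.intervalIntegrable_rpow' (by linarith)) fun x hx => ?_
    refine mul_le_of_le_one_right (Real.rpow_nonneg hx.1 _) ?_
    exact pow_le_one₀ (pow_nonneg hx.1 n) (pow_le_one₀ hx.1 hx.2)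
  have hsingle : ∀ (n : ℕ) (f : ℕ → ℝ), ∑ k ∈ Finset.range (n + 1), (if k = n then 1 else 0) * f k
      = f n := fun n f => by simp
  have hlaw0 : ∀ n, HasLaw (W (2 * n)) (gaussianReal 0 (∫ x in (0 : ℝ)..1,
      x ^ (2 * α) * (x ^ n) ^ 2).toNNReal) P := fun n => by
    have h := hW2 (n + 1) (fun k => if k = n then 1 else 0) fun _ => 0
    simp only [zero_mul, add_zero, Finset.sum_const_zero, hsingle n (fun k => W (2 * k) _),
      hsingle, ne_eq, OfNat.ofNat_ne_zero, not_false_eq_true, zero_pow] at h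
    exact h
  have hlaw1 : ∀ n, HasLaw (W (2 * n + 1)) (gaussianReal 0 (∫ x in (0 : ℝ)..1,
      x ^ (2 * α) * (x ^ n) ^ 2).toNNReal) P := fun n => by
    have h := hW2 (n + 1) (fun _ => 0) fun k => if k = n then 1 else 0
    simp only [zero_mul, zero_add, Finset.sum_const_zero, hsingle n (fun k => W (2 * k + 1) _),
      hsingle, ne_eq, OfNat.ofNat_ne_zero, not_false_eq_true, zero_pow] at h
    exact h
  have hbox0 := ae_exists_mem_coeffBox (D := fun ω n => W (2 * n) ω) hV0
    (fun n => (hlaw0 n).aemeasurable) fun n => hmom n _ (hlaw0 n)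
  have hbox1 := ae_exists_mem_coeffBox (D := fun ω n => W (2 * n + 1) ω) hV0
    (fun n => (hlaw1 n).aemeasurable) fun n => hmom n _ (hlaw1 n)
  have hnorm : ∀ {d : ℕ → ℝ} {R : ℝ}, d ∈ coeffBox R → ∀ n, ‖(d n : ℂ)‖ ≤ R * 3 ^ n :=
    fun hd n => by rw [Complex.norm_real]; exact hd n
  -- partial sums have the right law, and they converge almost surely
  have hpair : IsWienerPair α (fun u ω => expSeries (fun n => (W (2 * n) ω : ℂ)) u)
      (fun u ω => expSeries (fun n => (W (2 * n + 1) ω : ℂ)) u) P := by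
    intro ι s u a b
    have hvar := tendsto_wienerVariance_partial hα s u a b
    have hX := fun N => hW2 N (fun n => ∑ j ∈ s, (a j * (u j ^ n / (n.factorial : ℂ))).re)
      fun n => ∑ j ∈ s, (b j * (u j ^ n / (n.factorial : ℂ))).re
    have e3 : ∀ (c : ι → ℂ) (N : ℕ) (x : ℝ),
        ∑ n ∈ Finset.range N, (∑ j ∈ s, (c j * (u j ^ n / (n.factorial : ℂ))).re) * x ^ n =
        ∑ j ∈ s, (c j * ∑ n ∈ Finset.range N, (u j * x) ^ n / (n.factorial : ℂ)).re :=
      fun c N x => by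
        rw [sum_sum_re_mul s c (fun j n => u j ^ n / (n.factorial : ℂ)) fun n => x ^ n]
        refine Finset.sum_congr rfl fun j _ => ?_
        congr 2
        refine Finset.sum_congr rfl fun n _ => ?_
        push_cast
        ring
    simp only [e3] at hX
    refine hasLaw_gaussianReal_of_tendsto (fun N => intervalIntegral.integral_nonneg zero_le_one
      fun x hx => mul_nonneg (Real.rpow_nonneg hx.1 _) (by positivity)) hX ?_ hvar
    filter_upwards [hbox0, hbox1] with ω ⟨R₀, h0⟩ ⟨R₁, h1⟩
    have hs0 := fun j => (summable_expSeries (hnorm h0) (u j)).hasSum.tendsto_sum_nat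
    have hs1 := fun j => (summable_expSeries (hnorm h1) (u j)).hasSum.tendsto_sum_nat
    have hlim := tendsto_finsetSum s fun j _ =>
      (((Complex.continuous_re.tendsto _).comp ((hs0 j).const_mul (a j))).add
        ((Complex.continuous_re.tendsto _).comp ((hs1 j).const_mul (b j))))
    refine hlim.congr fun N => ?_
    simp only [Function.comp_apply]
    rw [Finset.sum_add_distrib, Finset.sum_add_distrib,
      sum_sum_re_mul s a (fun j n => u j ^ n / (n.factorial : ℂ)) fun n => W (2 * n) ω,
      sum_sum_re_mul s b (fun j n => u j ^ n / (n.factorial : ℂ)) fun n => W (2 * n + 1) ω]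
    simp only [mul_div_assoc]
  refine ⟨Ω, mΩ, P, hP, _, hpair.isLimitGAF hα σ₁ σ₂ ?_⟩
  filter_upwards [hbox0, hbox1] with ω ⟨R₀, h0⟩ ⟨R₁, h1⟩
  exact ((differentiable_expSeries (hnorm h0)).const_mul _).add
    ((differentiable_expSeries (hnorm h1)).const_mul _)

/-! ### Growth of Brownian paths at the origin -/

/-- Dyadic chaining: a continuous function with `|w((j+1)/2ⁿ) - w(j/2ⁿ)| ≤ K 2^(-γn)` and `w(0) = 0`
is `O(x^γ)`. -/
theorem exists_abs_le_rpow_of_dyadic {w : ℝ → ℝ} (hw : Continuous w) (hw0 : w 0 = 0) {γ K : ℝ}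
    (hγ : 0 < γ) (hK : 0 ≤ K)
    (h : ∀ n j : ℕ, j < 2 ^ n → |w ((j + 1) / 2 ^ n) - w (j / 2 ^ n)| ≤
      K * ((1 / 2 : ℝ) ^ γ) ^ n) :
    ∃ M : ℝ, 0 ≤ M ∧ ∀ x ∈ Set.Icc (0 : ℝ) 1, |w x| ≤ M * x ^ γ := by
  set r : ℝ := (1 / 2 : ℝ) ^ γ with hr
  have hr0 : 0 < r := by positivity
  have hr1 : r < 1 := Real.rpow_lt_one (by norm_num) (by norm_num) hγ
  have hr1' : 0 < 1 - r := by linarith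
  refine ⟨K / (1 - r) * 2 ^ γ, by positivity, fun x hx => ?_⟩
  rcases hx.1.eq_or_lt with hx0 | hx0
  · rw [← hx0, hw0, abs_zero]; positivity
  obtain ⟨N, hN1, hN2⟩ := exists_nat_pow_near_of_lt_one hx0 hx.2
    (by norm_num : (0 : ℝ) < 1 / 2) (by norm_num)
  -- bound at the dyadic approximation of `x` of level `N + k`, where `x ∼ 2^(-N)`: level `N` is
  -- reached from `0` by at most one increment, each further level costs one increment
  have hclaim : ∀ k : ℕ, |w (⌊2 ^ (N + k) * x⌋₊ / 2 ^ (N + k))| ≤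
      K * (r ^ N * ((1 - r ^ (k + 1)) / (1 - r))) := by
    intro k
    induction k with
    | zero =>
      have h1 : (2 : ℝ) ^ N * x ≤ 1 := by
        calc (2 : ℝ) ^ N * x ≤ 2 ^ N * (1 / 2) ^ N := by gcongr
          _ = 1 := by rw [← mul_pow]; norm_num
      have h2 : ⌊(2 : ℝ) ^ N * x⌋₊ ≤ 1 := by
        have := Nat.floor_le_floor h1
        simpa using this
      simp only [add_zero, zero_add, pow_one, div_self hr1'.ne', mul_one]
      rcases Nat.le_one_iff_eq_zero_or_eq_one.1 h2 with h3 | h3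
      · rw [h3]; simp [hw0]; positivity
      · rw [h3]
        have := h N 0 (by positivity)
        simpa [hw0] using this
    | succ k ih =>
      set n := N + k with hn
      have hnn : N + (k + 1) = n + 1 := by omega
      rw [hnn]
      set y : ℝ := 2 ^ n * x with hy
      have hy0 : 0 ≤ y := by positivity
      have hy2 : (2 : ℝ) ^ (n + 1) * x = 2 * y := by rw [hy, pow_succ]; ring
      have hyn : y ≤ 2 ^ n := by rw [hy]; exact mul_le_of_le_one_right (by positivity) hx.2
      rw [hy2]
      have hstep : |w (⌊2 * y⌋₊ / 2 ^ (n + 1)) - w (⌊y⌋₊ / 2 ^ n)| ≤ K * r ^ (n + 1) := by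
        have f1 := Nat.floor_le hy0
        have f2 := Nat.lt_floor_add_one y
        have e1 : ((⌊y⌋₊ : ℕ) : ℝ) / 2 ^ n = ((2 * ⌊y⌋₊ : ℕ) : ℝ) / 2 ^ (n + 1) := by
          push_cast
          rw [pow_succ]
          field_simp
        have g1 : 2 * ⌊y⌋₊ ≤ ⌊2 * y⌋₊ := Nat.le_floor (by push_cast; linarith)
        have g2 : ⌊2 * y⌋₊ < 2 * ⌊y⌋₊ + 2 := by
          rw [Nat.floor_lt (by positivity)]
          push_cast
          linarith
        rw [e1]
        rcases (show ⌊2 * y⌋₊ = 2 * ⌊y⌋₊ ∨ ⌊2 * y⌋₊ = 2 * ⌊y⌋₊ + 1 by omega) with g | g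
        · rw [g, sub_self, abs_zero]; positivity
        · rw [g]
          have hlt : 2 * ⌊y⌋₊ < 2 ^ (n + 1) := by
            have : ((2 * ⌊y⌋₊ + 1 : ℕ) : ℝ) ≤ 2 ^ (n + 1) := by
              rw [← g, pow_succ]
              have := Nat.floor_le (show 0 ≤ 2 * y by positivity)
              linarith
            have h' : 2 * ⌊y⌋₊ + 1 ≤ 2 ^ (n + 1) := by exact_mod_cast this
            omega
          have := h (n + 1) (2 * ⌊y⌋₊) hlt
          push_cast at this ⊢
          exact this
      have e3 : K * (r ^ N * ((1 - r ^ (k + 1 + 1)) / (1 - r))) =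
          K * r ^ (n + 1) + K * (r ^ N * ((1 - r ^ (k + 1)) / (1 - r))) := by
        rw [hn]
        field_simp
        ring
      rw [e3]
      calc _ = |(w (⌊2 * y⌋₊ / 2 ^ (n + 1)) - w (⌊y⌋₊ / 2 ^ n)) + w (⌊y⌋₊ / 2 ^ n)| := by
            rw [sub_add_cancel]
        _ ≤ _ := (abs_add_le _ _).trans (add_le_add hstep ih)
  have hlim : Tendsto (fun k : ℕ => |w (⌊2 ^ (N + k) * x⌋₊ / 2 ^ (N + k))|) atTop (𝓝 |w x|) := by
    have h1 : Tendsto (fun k : ℕ => (2 : ℝ) ^ (N + k)) atTop atTop :=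
      (tendsto_pow_atTop_atTop_of_one_lt one_lt_two).comp (tendsto_add_atTop_nat N |>.congr
        fun k => add_comm k N)
    have h2 := (tendsto_nat_floor_mul_div_atTop hx0.le).comp h1
    have h3 : Tendsto (fun k : ℕ => ((⌊2 ^ (N + k) * x⌋₊ : ℕ) : ℝ) / 2 ^ (N + k)) atTop (𝓝 x) := by
      simpa only [Function.comp_def, mul_comm x] using h2
    exact ((hw.tendsto x).comp h3).abs
  have hle : |w x| ≤ K * (r ^ N * (1 / (1 - r))) := by
    refine le_of_tendsto' hlim fun k => (hclaim k).trans ?_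
    gcongr
    linarith [pow_pos hr0 (k + 1)]
  refine hle.trans ?_
  have hrN : r ^ N ≤ 2 ^ γ * x ^ γ := by
    rw [hr, ← Real.rpow_natCast, ← Real.rpow_mul (by norm_num), mul_comm γ, Real.rpow_mul
      (by norm_num), Real.rpow_natCast, ← Real.mul_rpow two_pos.le hx0.le]
    refine Real.rpow_le_rpow (by positivity) ?_ hγ.le
    rw [pow_succ] at hN1
    linarith
  calc K * (r ^ N * (1 / (1 - r))) ≤ K * (2 ^ γ * x ^ γ * (1 / (1 - r))) := by gcongr
    _ = _ := by ring

/-- The `2k`-th moment of a centred Gaussian scales like the `k`-th power of the variance. -/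
theorem exists_lintegral_pow_gaussianReal (k : ℕ) : ∃ C : ℝ≥0∞, C ≠ ⊤ ∧
    ∀ {Ω : Type*} [MeasurableSpace Ω] {P : Measure Ω} {X : Ω → ℝ} {v : ℝ≥0},
      HasLaw X (gaussianReal 0 v) P →
        ∫⁻ ω, ENNReal.ofReal (X ω ^ (2 * k)) ∂P = ENNReal.ofReal ((v : ℝ) ^ k) * C := by
  refine ⟨∫⁻ x, ENNReal.ofReal (x ^ (2 * k)) ∂gaussianReal 0 1, ?_, fun {Ω _ P X v} hX => ?_⟩
  · have h := (memLp_id_gaussianReal (μ := 0) (v := 1) ((2 * k : ℕ) : ℝ≥0)).integrable_norm_pow'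
    have h2 : Integrable (fun x : ℝ => x ^ (2 * k)) (gaussianReal 0 1) := by
      refine (h.congr (Eventually.of_forall fun x => ?_))
      simp only [id, Real.norm_eq_abs]
      simp [pow_mul]
    exact h2.lintegral_lt_top.ne
  · have hm : Measurable fun x : ℝ => ENNReal.ofReal (x ^ (2 * k)) := by fun_prop
    have h1 := hX.lintegral_comp hm.aemeasurable
    have h2 := gaussianReal_map_const_mul (μ := 0) (v := 1) (√(v : ℝ))
    rw [mul_zero, mul_one] at h2
    have h3 : NNReal.mk (√(v : ℝ) ^ 2) (sq_nonneg _) = v := by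
      ext
      simp
    rw [h3] at h2
    rw [h1, ← h2, lintegral_map hm (by fun_prop),
      ← lintegral_const_mul _ hm]
    refine lintegral_congr fun x => ?_
    rw [← ENNReal.ofReal_mul (by positivity), mul_pow, pow_mul (√(v : ℝ)),
      Real.sq_sqrt (NNReal.coe_nonneg v)]

theorem abs_le_one_add_of_pow_le {y S : ℝ} {k : ℕ} (hk : 1 ≤ k) (hS : 0 ≤ S)
    (h : y ^ (2 * k) ≤ S) : |y| ≤ 1 + S := by
  rcases le_total |y| 1 with h1 | h1
  · linarith
  · have h2 : |y| ≤ |y| ^ (2 * k) := le_self_pow₀ h1 (by omega)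
    have h3 : |y| ^ (2 * k) = y ^ (2 * k) := by rw [pow_mul, sq_abs, ← pow_mul]
    linarith

/-- Brownian paths are `O(x^γ)` at the origin for `γ < 1/2`: high moments bound all dyadic increments
at once. -/
theorem ProbabilityTheory.IsBrownianReal.ae_exists_abs_le_rpow {Ω : Type*} [MeasurableSpace Ω]
    {P : Measure Ω} {B : ℝ≥0 → Ω → ℝ} (hB : IsBrownianReal B P) {γ : ℝ} (hγ : 0 < γ) (hγ2 : γ < 1 / 2) :
    ∀ᵐ ω ∂P, ∃ M : ℝ, 0 ≤ M ∧ ∀ x ∈ Set.Icc (0 : ℝ) 1, |B x.toNNReal ω| ≤ M * x ^ γ := by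
  -- with this `k` the `2ⁿ` increments of level `n`, divided by `2^(-γn)`, have `2k`-th moments that
  -- sum to a geometrically small quantity
  obtain ⟨k, hk⟩ := exists_nat_gt (1 / (1 - 2 * γ))
  have h2γ : 0 < 1 - 2 * γ := by linarith
  rw [div_lt_iff₀ h2γ] at hk
  have hk1 : 1 ≤ k := by
    rcases Nat.eq_zero_or_pos k with h | h
    · rw [h] at hk; norm_num at hk
    · exact h
  obtain ⟨C, hC, hmom⟩ := exists_lintegral_pow_gaussianReal k
  set r : ℝ := (1 / 2 : ℝ) ^ γ with hr
  have hr0 : 0 < r := by positivity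
  set Δ : ℕ → ℕ → Ω → ℝ := fun n j ω => B (((j : ℝ) + 1) / 2 ^ n).toNNReal ω -
    B ((j : ℝ) / 2 ^ n).toNNReal ω with hΔ
  have hlaw : ∀ n j, HasLaw (Δ n j) (gaussianReal 0 ((1 / 2) ^ n)) P := fun n j => by
    have h := hB.hasLaw_sub (((j : ℝ) + 1) / 2 ^ n).toNNReal ((j : ℝ) / 2 ^ n).toNNReal
    have h2 : nndist ((((j : ℝ) + 1) / 2 ^ n).toNNReal : ℝ) (((j : ℝ) / 2 ^ n).toNNReal : ℝ) =
        (1 / 2) ^ n := by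
      ext
      rw [coe_nndist, Real.coe_toNNReal _ (by positivity), Real.coe_toNNReal _ (by positivity),
        Real.dist_eq, ← sub_div, add_sub_cancel_left, abs_of_nonneg (by positivity)]
      simp
    rw [show nndist ((((j : ℝ) + 1) / 2 ^ n).toNNReal).1 (((j : ℝ) / 2 ^ n).toNNReal).1 =
      (1 / 2) ^ n from h2] at h
    exact h
  set T : ℕ → Ω → ℝ≥0∞ := fun n ω =>
    ∑ j ∈ Finset.range (2 ^ n), ENNReal.ofReal ((Δ n j ω / r ^ n) ^ (2 * k)) with hT
  have hm : ∀ n j, AEMeasurable (fun ω => ENNReal.ofReal ((Δ n j ω / r ^ n) ^ (2 * k))) P :=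
    fun n j => (((hlaw n j).aemeasurable.div_const _).pow_const _).ennreal_ofReal
  set ρ : ℝ := 2 * ((r ^ (2 * k))⁻¹ * (1 / 2) ^ k) with hρ
  have hρ0 : 0 ≤ ρ := by positivity
  have hρ1 : ρ < 1 := by
    have e : ρ = (1 / 2 : ℝ) ^ ((k : ℝ) * (1 - 2 * γ) - 1) := by
      rw [Real.rpow_sub (by norm_num), Real.rpow_one, mul_sub, Real.rpow_sub (by norm_num), mul_one,
        Real.rpow_natCast, hρ, hr, ← Real.rpow_natCast ((1 / 2 : ℝ) ^ γ),
        ← Real.rpow_mul (by norm_num)]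
      have : γ * ((2 * k : ℕ) : ℝ) = k * (2 * γ) := by push_cast; ring
      rw [this]
      field_simp
    rw [e]
    exact Real.rpow_lt_one (by norm_num) (by norm_num) (by linarith)
  have hTint : ∀ n, ∫⁻ ω, T n ω ∂P = ENNReal.ofReal (ρ ^ n) * C := fun n => by
    simp only [hT]
    rw [lintegral_finsetSum' _ fun j _ => hm n j]
    have h1 : ∀ j, ∫⁻ ω, ENNReal.ofReal ((Δ n j ω / r ^ n) ^ (2 * k)) ∂P =
        ENNReal.ofReal (((r ^ n) ^ (2 * k))⁻¹ * ((1 / 2) ^ n) ^ k) * C := fun j => by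
      have h2 := hmom (hlaw n j)
      have h3 : ∀ ω, ENNReal.ofReal ((Δ n j ω / r ^ n) ^ (2 * k)) =
          ENNReal.ofReal (((r ^ n) ^ (2 * k))⁻¹) * ENNReal.ofReal (Δ n j ω ^ (2 * k)) := fun ω => by
        rw [← ENNReal.ofReal_mul (by positivity), div_pow, div_eq_inv_mul]
      simp only [h3]
      rw [lintegral_const_mul' _ _ ENNReal.ofReal_ne_top, h2, ← mul_assoc,
        ← ENNReal.ofReal_mul (by positivity)]
      congr 3
    simp only [h1]
    rw [Finset.sum_const, Finset.card_range, nsmul_eq_mul, ← mul_assoc]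
    congr 1
    rw [show ((2 ^ n : ℕ) : ℝ≥0∞) = ENNReal.ofReal (2 ^ n) by
      rw [ENNReal.ofReal_pow two_pos.le]; simp, ← ENNReal.ofReal_mul (by positivity)]
    congr 1
    rw [hρ, mul_pow, mul_pow, inv_pow, ← pow_mul, ← pow_mul, ← pow_mul, ← pow_mul, mul_comm n,
      mul_comm n]
  have hsum : ∫⁻ ω, ∑' n, T n ω ∂P ≠ ⊤ := by
    rw [lintegral_tsum fun n => Finset.aemeasurable_fun_sum _ fun j _ => hm n j]
    change ∑' n, ∫⁻ ω, T n ω ∂P ≠ ⊤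
    simp only [hTint]
    rw [ENNReal.tsum_mul_right, ← ENNReal.ofReal_tsum_of_nonneg (fun n => by positivity)
      (summable_geometric_of_lt_one hρ0 hρ1)]
    exact ENNReal.mul_ne_top ENNReal.ofReal_ne_top hC
  have hfin := ae_lt_top' (AEMeasurable.tsum fun n =>
    Finset.aemeasurable_fun_sum _ fun j _ => hm n j) hsum
  filter_upwards [hfin, hB.cont, hB.eval_zero_ae_eq_zero] with ω h1 h2 h3
  refine exists_abs_le_rpow_of_dyadic (w := fun x => B x.toNNReal ω)
    (h2.comp continuous_real_toNNReal) (by simpa using h3) hγ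
    (K := 1 + (∑' n, T n ω).toReal) (by positivity) fun n j hj => ?_
  have h4 : ENNReal.ofReal ((Δ n j ω / r ^ n) ^ (2 * k)) ≤ ∑' n, T n ω :=
    (Finset.single_le_sum (f := fun j => ENNReal.ofReal ((Δ n j ω / r ^ n) ^ (2 * k)))
      (fun _ _ => zero_le) (Finset.mem_range.2 hj)).trans (ENNReal.le_tsum n)
  rw [ENNReal.ofReal_le_iff_le_toReal h1.ne] at h4
  have h5 := abs_le_one_add_of_pow_le hk1 ENNReal.toReal_nonneg h4
  rw [abs_div, abs_of_pos (pow_pos hr0 n), div_le_iff₀ (pow_pos hr0 n)] at h5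
  exact h5

/-! ### Pathwise integrals of singular kernels -/

section PathIntegral

variable {E F : Type*} [NormedAddCommGroup E] [NormedSpace ℝ E] [NormedAddCommGroup F]
  [NormedSpace ℝ F] {W : ℝ≥0 → ℝ} {α γ M : ℝ}

theorem hasDerivAt_rpow_smul {g : ℝ → E} (hg : Differentiable ℝ g) (α : ℝ) {x : ℝ} (hx : 0 < x) :
    HasDerivAt (fun x : ℝ => x ^ α • g x) (x ^ α • deriv g x + (α * x ^ (α - 1)) • g x) x :=
  (Real.hasDerivAt_rpow_const (Or.inl hx.ne')).smul (hg x).hasDerivAt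

theorem rpow_le_rpow_sub_one {x : ℝ} (hx : x ∈ Set.Ioc (0 : ℝ) 1) (α : ℝ) :
    x ^ α ≤ x ^ (α - 1) :=
  Real.rpow_le_rpow_of_exponent_ge hx.1 hx.2 (by linarith)

theorem exists_norm_le_of_contDiff {g : ℝ → E} (hg : ContDiff ℝ 1 g) :
    ∃ K : ℝ, 0 ≤ K ∧ ∀ x ∈ Set.Icc (0 : ℝ) 1, ‖g x‖ ≤ K ∧ ‖deriv g x‖ ≤ K := by
  obtain ⟨K₁, h₁⟩ := isCompact_Icc.exists_bound_of_continuousOn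
    (s := Set.Icc (0 : ℝ) 1) hg.continuous.continuousOn
  obtain ⟨K₂, h₂⟩ := isCompact_Icc.exists_bound_of_continuousOn
    (s := Set.Icc (0 : ℝ) 1) (hg.continuous_deriv le_rfl).continuousOn
  exact ⟨max (max K₁ K₂) 0, le_max_right _ _, fun x hx =>
    ⟨(h₁ x hx).trans ((le_max_left _ _).trans (le_max_left _ _)),
      (h₂ x hx).trans ((le_max_right _ _).trans (le_max_left _ _))⟩⟩

theorem exists_norm_deriv_rpow_smul_le {g : ℝ → E} (hg : ContDiff ℝ 1 g) (α : ℝ) :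
    ∃ K : ℝ, 0 ≤ K ∧ ∀ x ∈ Set.Ioc (0 : ℝ) 1,
      ‖deriv (fun x : ℝ => x ^ α • g x) x‖ ≤ K * x ^ (α - 1) := by
  obtain ⟨K, hK, h⟩ := exists_norm_le_of_contDiff hg
  refine ⟨K + |α| * K, by positivity, fun x hx => ?_⟩
  rw [(hasDerivAt_rpow_smul (hg.differentiable one_ne_zero) α hx.1).deriv]
  have h1 := h x ⟨hx.1.le, hx.2⟩
  have h2 : 0 ≤ x ^ (α - 1) := Real.rpow_nonneg hx.1.le _
  have h3 : 0 ≤ x ^ α := Real.rpow_nonneg hx.1.le _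
  calc ‖x ^ α • deriv g x + (α * x ^ (α - 1)) • g x‖
      ≤ x ^ α * ‖deriv g x‖ + |α| * x ^ (α - 1) * ‖g x‖ := by
        refine (norm_add_le _ _).trans_eq ?_
        rw [norm_smul, norm_smul, Real.norm_eq_abs, Real.norm_eq_abs, abs_mul, abs_of_nonneg h2,
          abs_of_nonneg h3]
    _ ≤ x ^ (α - 1) * K + |α| * x ^ (α - 1) * K := by
        exact add_le_add (mul_le_mul (rpow_le_rpow_sub_one hx α) h1.2 (norm_nonneg _) h2)
          (mul_le_mul_of_nonneg_left h1.1 (by positivity))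
    _ = (K + |α| * K) * x ^ (α - 1) := by ring

theorem continuousOn_deriv_rpow_smul {g : ℝ → E} (hg : ContDiff ℝ 1 g) (α : ℝ) :
    ContinuousOn (deriv fun x : ℝ => x ^ α • g x) (Set.Ioi 0) := by
  have h : ∀ β : ℝ, ContinuousOn (fun x : ℝ => x ^ β) (Set.Ioi 0) := fun β x hx =>
    (Real.continuousAt_rpow_const x β (Or.inl (ne_of_gt hx))).continuousWithinAt
  have h1 : ContinuousOn (fun x : ℝ => x ^ α • deriv g x + (α * x ^ (α - 1)) • g x)
      (Set.Ioi 0) :=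
    ((h α).smul (hg.continuous_deriv le_rfl).continuousOn).add
      ((continuousOn_const.mul (h _)).smul hg.continuous.continuousOn)
  exact h1.congr fun x hx =>
    (hasDerivAt_rpow_smul (hg.differentiable one_ne_zero) α hx).deriv

theorem intervalIntegrable_rpow_add_sub_one (h : 0 < γ + α) (C : ℝ) :
    IntervalIntegrable (fun x : ℝ => C * x ^ (γ + α - 1)) volume 0 1 :=
  (intervalIntegral.intervalIntegrable_rpow' (by linarith)).const_mul C

/-- The integral `∫₀¹ x^α g(x) dW(x)` can be formed by parts as soon as `W(x) = O(x^γ)` with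
`γ + α > 0`. -/
theorem pathIntegrable_rpow_smul (hW : Continuous W) (hγ : 0 < γ + α)
    (hM : ∀ x ∈ Set.Icc (0 : ℝ) 1, |W x.toNNReal| ≤ M * x ^ γ) {g : ℝ → E}
    (hg : ContDiff ℝ 1 g) : PathIntegrable W fun x => x ^ α • g x := by
  have hWc : Continuous fun x : ℝ => W x.toNNReal := hW.comp continuous_real_toNNReal
  have hM0 : 0 ≤ M := by
    have := hM 1 (by simp)
    rw [Real.one_rpow, mul_one] at this
    exact (abs_nonneg _).trans this
  refine ⟨fun x hx => (hasDerivAt_rpow_smul (hg.differentiable one_ne_zero) α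
    hx.1).differentiableAt, ?_, ?_⟩
  · obtain ⟨K, hK, h⟩ := exists_norm_deriv_rpow_smul_le hg α
    have hint := intervalIntegrable_rpow_add_sub_one hγ (M * K)
    rw [intervalIntegrable_iff_integrableOn_Ioc_of_le zero_le_one] at hint ⊢
    refine hint.mono' ?_ ?_
    · refine ContinuousOn.aestronglyMeasurable ?_ measurableSet_Ioc
      exact hWc.continuousOn.smul ((continuousOn_deriv_rpow_smul hg α).mono
        Set.Ioc_subset_Ioi_self)
    · filter_upwards [ae_restrict_mem measurableSet_Ioc] with x hx
      have h1 := hM x ⟨hx.1.le, hx.2⟩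
      rw [norm_smul, Real.norm_eq_abs]
      calc |W x.toNNReal| * ‖deriv (fun x : ℝ => x ^ α • g x) x‖
          ≤ (M * x ^ γ) * (K * x ^ (α - 1)) := by
            gcongr
            · exact (abs_nonneg _).trans h1
            · exact h x hx
        _ = M * K * x ^ (γ + α - 1) := by
            rw [add_sub_assoc, Real.rpow_add hx.1]; ring
  · obtain ⟨K, hK, h⟩ := exists_norm_le_of_contDiff hg
    have h1 : Tendsto (fun x : ℝ => M * K * x ^ (γ + α)) (𝓝[>] 0) (𝓝 0) := by
      have h2 : ContinuousAt (fun x : ℝ => M * K * x ^ (γ + α)) 0 :=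
        (Real.continuousAt_rpow_const 0 _ (Or.inr hγ.le)).const_mul _
      have h3 := h2.tendsto
      rw [Real.zero_rpow hγ.ne', mul_zero] at h3
      exact h3.mono_left nhdsWithin_le_nhds
    refine squeeze_zero_norm' ?_ h1
    filter_upwards [Ioc_mem_nhdsGT (zero_lt_one (α := ℝ))] with x hx
    have h4 := hM x ⟨hx.1.le, hx.2⟩
    rw [norm_smul, norm_smul, Real.norm_eq_abs, Real.norm_eq_abs,
      abs_of_nonneg (Real.rpow_nonneg hx.1.le α)]
    calc |W x.toNNReal| * (x ^ α * ‖g x‖) ≤ (M * x ^ γ) * (x ^ α * K) := by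
          gcongr
          · exact mul_nonneg (Real.rpow_nonneg hx.1.le _) (norm_nonneg _)
          · exact (abs_nonneg _).trans h4
          · exact Real.rpow_nonneg hx.1.le _
          · exact (h x ⟨hx.1.le, hx.2⟩).1
      _ = M * K * x ^ (γ + α) := by rw [Real.rpow_add hx.1]; ring

theorem pathIntegral_congr {φ ψ : ℝ → E} (h : ∀ x, φ x = ψ x) :
    pathIntegral W φ = pathIntegral W ψ := by
  rw [funext h]

theorem ContinuousLinearMap.hasDerivAt_comp_of_pathIntegrable (L : E →L[ℝ] F) {φ : ℝ → E}
    (h : PathIntegrable W φ) {x : ℝ} (hx : x ∈ Set.Ioc (0 : ℝ) 1) :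
    HasDerivAt (fun x => L (φ x)) (L (deriv φ x)) x :=
  L.hasFDerivAt.comp_hasDerivAt x (h.differentiable x hx).hasDerivAt

theorem ContinuousLinearMap.pathIntegrable_comp (L : E →L[ℝ] F) {φ : ℝ → E}
    (h : PathIntegrable W φ) : PathIntegrable W fun x => L (φ x) := by
  refine ⟨fun x hx => (L.hasDerivAt_comp_of_pathIntegrable h hx).differentiableAt, ?_, ?_⟩
  · have h1 : IntervalIntegrable (fun x => L (W x.toNNReal • deriv φ x)) volume 0 1 :=
      ⟨L.integrable_comp h.integrable.1, L.integrable_comp h.integrable.2⟩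
    refine h1.congr_ae ?_
    filter_upwards [ae_restrict_mem measurableSet_uIoc] with x hx
    rw [Set.uIoc_of_le zero_le_one] at hx
    rw [(L.hasDerivAt_comp_of_pathIntegrable h hx).deriv, map_smul]
  · have := (L.continuous.tendsto 0).comp h.boundary
    rw [map_zero] at this
    exact this.congr fun x => map_smul _ _ _

/-- Pathwise integration commutes with continuous linear maps. -/
theorem ContinuousLinearMap.pathIntegral_comp [CompleteSpace E] [CompleteSpace F] (L : E →L[ℝ] F)
    {φ : ℝ → E} (h : PathIntegrable W φ) :
    pathIntegral W (fun x => L (φ x)) = L (pathIntegral W φ) := by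
  rw [pathIntegral, pathIntegral, map_sub, map_smul, ← L.intervalIntegral_comp_comm h.integrable]
  congr 1
  refine intervalIntegral.integral_congr_ae (Eventually.of_forall fun x hx => ?_)
  rw [Set.uIoc_of_le zero_le_one] at hx
  rw [(L.hasDerivAt_comp_of_pathIntegrable h hx).deriv, map_smul]

theorem pathIntegral_sum {ι : Type*} (s : Finset ι) {φ : ι → ℝ → E}
    (h : ∀ j ∈ s, PathIntegrable W (φ j)) :
    pathIntegral W (fun x => ∑ j ∈ s, φ j x) = ∑ j ∈ s, pathIntegral W (φ j) := by
  simp only [pathIntegral]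
  rw [Finset.sum_sub_distrib, ← Finset.smul_sum,
    ← intervalIntegral.integral_finsetSum fun j hj => (h j hj).integrable]
  congr 1
  refine intervalIntegral.integral_congr_ae (Eventually.of_forall fun x hx => ?_)
  rw [Set.uIoc_of_le zero_le_one] at hx
  have := (HasDerivAt.fun_sum fun j hj => ((h j hj).differentiable x hx).hasDerivAt).deriv
  rw [this, Finset.smul_sum]

theorem contDiff_exp_mul (u : ℂ) : ContDiff ℝ 1 fun x : ℝ => Complex.exp (u * x) :=
  (contDiff_const.mul Complex.ofRealCLM.contDiff).cexp

theorem expKernel_eq_smul (α : ℝ) (u : ℂ) :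
    expKernel α u = fun x : ℝ => x ^ α • Complex.exp (u * x) := by
  funext x
  rw [expKernel, Complex.real_smul]

theorem pathIntegrable_expKernel (hW : Continuous W) (hγ : 0 < γ + α)
    (hM : ∀ x ∈ Set.Icc (0 : ℝ) 1, |W x.toNNReal| ≤ M * x ^ γ) (u : ℂ) :
    PathIntegrable W (expKernel α u) := by
  rw [expKernel_eq_smul]
  exact pathIntegrable_rpow_smul hW hγ hM (contDiff_exp_mul u)

theorem pathIntegrable_cosKernel (hW : Continuous W) (hγ : 0 < γ + α)
    (hM : ∀ x ∈ Set.Icc (0 : ℝ) 1, |W x.toNNReal| ≤ M * x ^ γ) (t : ℝ) :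
    PathIntegrable W (cosKernel α t) :=
  pathIntegrable_rpow_smul (g := fun x => Real.cos (t * (x - 1))) hW hγ hM
    (Real.contDiff_cos.comp (by fun_prop))

theorem pathIntegrable_sinKernel (hW : Continuous W) (hγ : 0 < γ + α)
    (hM : ∀ x ∈ Set.Icc (0 : ℝ) 1, |W x.toNNReal| ≤ M * x ^ γ) (t : ℝ) :
    PathIntegrable W (sinKernel α t) :=
  pathIntegrable_rpow_smul (g := fun x => Real.sin (t * (x - 1))) hW hγ hM
    (Real.contDiff_sin.comp (by fun_prop))

/-- The pathwise integral of `x^α exp(u x)` is an entire function of `u`: differentiate under the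
integral sign. -/
theorem differentiable_pathIntegral_expKernel (hW : Continuous W) (hγ : 0 < γ + α)
    (hM : ∀ x ∈ Set.Icc (0 : ℝ) 1, |W x.toNNReal| ≤ M * x ^ γ) :
    Differentiable ℂ fun u => pathIntegral W (expKernel α u) := by
  have hM0 : 0 ≤ M := by
    have := hM 1 (by simp)
    rw [Real.one_rpow, mul_one] at this
    exact (abs_nonneg _).trans this
  -- the integrand of the integration by parts formula is `A u x * exp (u x)`
  set A : ℂ → ℝ → ℂ := fun u x => (W x.toNNReal : ℂ) *
    (((x ^ α : ℝ) : ℂ) * u + ((α * x ^ (α - 1) : ℝ) : ℂ)) with hA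
  have hF : ∀ u, pathIntegral W (expKernel α u) = (W 1 : ℂ) * Complex.exp u -
      ∫ x in (0 : ℝ)..1, A u x * Complex.exp (u * x) := by
    intro u
    rw [pathIntegral]
    congr 1
    · simp [expKernel]
    · refine intervalIntegral.integral_congr_ae (Eventually.of_forall fun x hx => ?_)
      rw [Set.uIoc_of_le zero_le_one] at hx
      have h1 : HasDerivAt (fun x : ℝ => Complex.exp (u * x)) (Complex.exp (u * x) * u) x := by
        have := ((hasDerivAt_id x).ofReal_comp.const_mul u).cexp
        simpa using this
      rw [expKernel_eq_smul, (hasDerivAt_rpow_smul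
        ((contDiff_exp_mul u).differentiable one_ne_zero) α hx.1).deriv, h1.deriv]
      simp only [Complex.real_smul, hA]
      ring
  rw [funext hF]
  refine Differentiable.sub (by fun_prop) fun u₀ => ?_
  set R : ℝ := ‖u₀‖ + 1 with hR
  have hR0 : 0 ≤ R := by positivity
  set A' : ℂ → ℝ → ℂ := fun u x => (W x.toNNReal : ℂ) * ((x ^ α : ℝ) : ℂ) *
    Complex.exp (u * x) + A u x * (Complex.exp (u * x) * x) with hA'
  have hbA : ∀ u ∈ Metric.ball u₀ 1, ∀ x ∈ Set.Ioc (0 : ℝ) 1, ‖A u x‖ ≤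
      M * (R + |α|) * x ^ (γ + α - 1) ∧ ‖(W x.toNNReal : ℂ) * ((x ^ α : ℝ) : ℂ)‖ ≤
      M * x ^ (γ + α - 1) ∧ ‖Complex.exp (u * x)‖ ≤ Real.exp R := by
    intro u hu x hx
    have hu' : ‖u‖ ≤ R := by
      have h1 : ‖u‖ ≤ ‖u₀‖ + ‖u - u₀‖ := norm_le_norm_add_norm_sub' u u₀
      rw [Metric.mem_ball, dist_eq_norm] at hu
      linarith
    have h1 := hM x ⟨hx.1.le, hx.2⟩
    have h2 : 0 ≤ x ^ (α - 1) := Real.rpow_nonneg hx.1.le _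
    have h3 : 0 ≤ x ^ α := Real.rpow_nonneg hx.1.le _
    have h4 : 0 ≤ x ^ γ := Real.rpow_nonneg hx.1.le _
    have h5 := rpow_le_rpow_sub_one hx α
    have h6 : x ^ (γ + α - 1) = x ^ γ * x ^ (α - 1) := by
      rw [add_sub_assoc, Real.rpow_add hx.1]
    have h7 : ‖((x ^ α : ℝ) : ℂ)‖ ≤ x ^ (α - 1) := by
      rw [Complex.norm_real, Real.norm_eq_abs, abs_of_nonneg h3]; exact h5
    have h8 : ‖(W x.toNNReal : ℂ)‖ ≤ M * x ^ γ := by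
      rw [Complex.norm_real, Real.norm_eq_abs]; exact h1
    refine ⟨?_, ?_, ?_⟩
    · have h9 : ‖((x ^ α : ℝ) : ℂ) * u + ((α * x ^ (α - 1) : ℝ) : ℂ)‖ ≤
          x ^ (α - 1) * R + |α| * x ^ (α - 1) := by
        refine (norm_add_le _ _).trans (add_le_add ?_ ?_)
        · rw [norm_mul]; gcongr
        · rw [Complex.norm_real, Real.norm_eq_abs, abs_mul, abs_of_nonneg h2]
      rw [hA]
      beta_reduce
      rw [norm_mul]
      calc _ ≤ (M * x ^ γ) * (x ^ (α - 1) * R + |α| * x ^ (α - 1)) := by gcongr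
        _ = _ := by rw [h6]; ring
    · rw [norm_mul]
      calc _ ≤ (M * x ^ γ) * x ^ (α - 1) := by gcongr
        _ = _ := by rw [h6]; ring
    · rw [Complex.norm_exp]
      refine Real.exp_le_exp.2 ((Complex.re_le_norm _).trans ?_)
      rw [norm_mul, Complex.norm_real, Real.norm_eq_abs, abs_of_pos hx.1]
      calc ‖u‖ * x ≤ R * 1 := mul_le_mul hu' hx.2 hx.1.le hR0
        _ = R := mul_one R
  have hWc : Continuous fun x : ℝ => (W x.toNNReal : ℂ) :=
    Complex.continuous_ofReal.comp (hW.comp continuous_real_toNNReal)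
  have hrp : ∀ β : ℝ, ContinuousOn (fun x : ℝ => ((x ^ β : ℝ) : ℂ)) (Set.Ioc 0 1) := fun β x hx =>
    (Complex.continuous_ofReal.continuousAt.comp
      (Real.continuousAt_rpow_const x β (Or.inl hx.1.ne'))).continuousWithinAt
  have hAc : ∀ u, ContinuousOn (A u) (Set.Ioc 0 1) := fun u => by
    have h := hrp (α - 1)
    have h' := hrp α
    rw [hA]
    simp only [Complex.ofReal_mul]
    fun_prop
  have hec : ∀ u : ℂ, Continuous fun x : ℝ => Complex.exp (u * x) := fun u => by fun_prop
  have hmeas : ∀ u, AEStronglyMeasurable (fun x : ℝ => A u x * Complex.exp (u * x))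
      (volume.restrict (Set.uIoc 0 1)) := fun u => by
    rw [Set.uIoc_of_le zero_le_one]
    exact ((hAc u).mul (hec u).continuousOn).aestronglyMeasurable measurableSet_Ioc
  have key := intervalIntegral.hasDerivAt_integral_of_dominated_loc_of_deriv_le
    (μ := volume) (a := 0) (b := 1) (x₀ := u₀) (s := Metric.ball u₀ 1)
    (F := fun u x => A u x * Complex.exp (u * x)) (F' := A')
    (bound := fun x => (M * Real.exp R + M * (R + |α|) * Real.exp R) * x ^ (γ + α - 1))
    (Metric.ball_mem_nhds u₀ one_pos) (Eventually.of_forall hmeas) ?_ ?_ ?_ ?_ ?_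
  · exact key.2.differentiableAt
  · refine (intervalIntegrable_rpow_add_sub_one hγ (M * (R + |α|) * Real.exp R)).mono_fun
      (hmeas u₀) ?_
    filter_upwards [ae_restrict_mem measurableSet_uIoc] with x hx
    rw [Set.uIoc_of_le zero_le_one] at hx
    obtain ⟨h1, h2, h3⟩ := hbA u₀ (Metric.mem_ball_self one_pos) x hx
    refine le_trans ?_ (le_abs_self _)
    rw [norm_mul]
    calc _ ≤ (M * (R + |α|) * x ^ (γ + α - 1)) * Real.exp R := by
          gcongr
          exact (norm_nonneg _).trans h1
      _ = _ := by ring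
  · rw [Set.uIoc_of_le zero_le_one]
    refine ContinuousOn.aestronglyMeasurable ?_ measurableSet_Ioc
    have h := hAc u₀
    have h' := hrp α
    rw [hA']
    fun_prop
  · refine Eventually.of_forall fun x hx u hu => ?_
    rw [Set.uIoc_of_le zero_le_one] at hx
    obtain ⟨h1, h2, h3⟩ := hbA u hu x hx
    have h4 : ‖(x : ℂ)‖ ≤ 1 := by
      rw [Complex.norm_real, Real.norm_eq_abs, abs_of_pos hx.1]; exact hx.2
    refine (norm_add_le _ _).trans ?_
    rw [norm_mul _ (Complex.exp _), norm_mul (A u x), norm_mul (Complex.exp _)]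
    calc _ ≤ (M * x ^ (γ + α - 1)) * Real.exp R +
          (M * (R + |α|) * x ^ (γ + α - 1)) * (Real.exp R * 1) := by
          gcongr
          · exact (norm_nonneg _).trans h2
          · exact (norm_nonneg _).trans h1
      _ = _ := by ring
  · exact intervalIntegrable_rpow_add_sub_one hγ _
  · refine Eventually.of_forall fun x _ u _ => ?_
    have h1 : HasDerivAt (fun u => A u x) ((W x.toNNReal : ℂ) * ((x ^ α : ℝ) : ℂ)) u := by
      have := (((hasDerivAt_id u).const_mul ((x ^ α : ℝ) : ℂ)).add_const
        ((α * x ^ (α - 1) : ℝ) : ℂ)).const_mul (W x.toNNReal : ℂ)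
      rw [mul_one] at this
      exact this
    have h2 : HasDerivAt (fun u : ℂ => Complex.exp (u * x)) (Complex.exp (u * x) * x) u := by
      have := ((hasDerivAt_id u).mul_const (x : ℂ)).cexp
      simpa using this
    exact h1.mul h2

theorem integralGAF_differentiable (σ₁ σ₂ : ℝ) {W₁ W₂ : ℝ≥0 → ℝ}
    (h₁ : Differentiable ℂ fun u => pathIntegral W₁ (expKernel α u))
    (h₂ : Differentiable ℂ fun u => pathIntegral W₂ (expKernel α u)) :
    Differentiable ℂ (integralGAF σ₁ σ₂ α W₁ W₂) := by
  unfold integralGAF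
  fun_prop

/-- `e^(-it) ∫₀¹ x^α e^(itx) dW = ∫₀¹ x^α cos(t(x-1)) dW + i ∫₀¹ x^α sin(t(x-1)) dW`. -/
theorem exp_mul_pathIntegral_expKernel {t : ℝ}
    (h : PathIntegrable W (expKernel α (Complex.I * t))) :
    Complex.exp (-(Complex.I * t)) * pathIntegral W (expKernel α (Complex.I * t)) =
      pathIntegral W (cosKernel α t) + pathIntegral W (sinKernel α t) * Complex.I := by
  have hk : ∀ x : ℝ, Complex.exp (-(Complex.I * t)) * expKernel α (Complex.I * t) x =
      ((x ^ α : ℝ) : ℂ) * Complex.exp ((t * (x - 1) : ℝ) * Complex.I) := fun x => by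
    rw [expKernel, mul_left_comm, ← Complex.exp_add]
    congr 2
    push_cast
    ring
  set c := Complex.exp (-(Complex.I * t))
  have h1 := (Complex.reCLM ∘L ContinuousLinearMap.mul ℝ ℂ c).pathIntegral_comp h
  have h2 := (Complex.imCLM ∘L ContinuousLinearMap.mul ℝ ℂ c).pathIntegral_comp h
  simp only [ContinuousLinearMap.comp_apply, ContinuousLinearMap.mul_apply', hk,
    Complex.reCLM_apply, Complex.imCLM_apply, Complex.re_ofReal_mul, Complex.im_ofReal_mul,
    Complex.exp_ofReal_mul_I_re, Complex.exp_ofReal_mul_I_im] at h1 h2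
  apply Complex.ext
  · rw [show cosKernel α t = fun x => x ^ α * Real.cos (t * (x - 1)) from rfl, h1]
    simp
  · rw [show sinKernel α t = fun x => x ^ α * Real.sin (t * (x - 1)) from rfl, h2]
    simp

theorem tildeTransform_integralGAF (σ₁ σ₂ : ℝ) {W₁ W₂ : ℝ≥0 → ℝ} {t : ℝ}
    (h₁ : PathIntegrable W₁ (expKernel α (Complex.I * t)))
    (h₂ : PathIntegrable W₂ (expKernel α (Complex.I * t))) :
    tildeTransform (integralGAF σ₁ σ₂ α W₁ W₂) t = integralTilde σ₁ σ₂ α W₁ W₂ t := by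
  have h : Complex.exp (-(Complex.I * t)) * integralGAF σ₁ σ₂ α W₁ W₂ (Complex.I * t) =
      σ₁ * (pathIntegral W₁ (cosKernel α t) + pathIntegral W₁ (sinKernel α t) * Complex.I) +
      Complex.I * σ₂ *
        (pathIntegral W₂ (cosKernel α t) + pathIntegral W₂ (sinKernel α t) * Complex.I) := by
    rw [← exp_mul_pathIntegral_expKernel h₁, ← exp_mul_pathIntegral_expKernel h₂, integralGAF]
    ring
  rw [tildeTransform, h, integralTilde]
  simp [Complex.mul_re]
  ring

end PathIntegral

/-! ### Riemann–Stieltjes sums -/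

section StieltjesSum

/-- The Riemann–Stieltjes sum `∑ f((i+1)/n) (W((i+1)/n) - W(i/n))` over `i < n`. -/
noncomputable def stieltjesSum (f : ℝ → ℝ) (n : ℕ) (W : ℝ≥0 → ℝ) : ℝ :=
  ∑ i ∈ Finset.range n, f ((i + 1 : ℕ) / n) * (W ((i + 1 : ℕ) / n) - W ((i : ℕ) / n))

variable {W : ℝ≥0 → ℝ} {α γ M : ℝ} {g : ℝ → ℝ}

/-- On `[k/n, (k+1)/n]` the discretised path is constant; for `k = 0` it is `W(0) = 0`, which removes
the singularity of the kernel at the origin. -/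
theorem integral_comp_floor_mul_deriv (hg : ContDiff ℝ 1 g) (α : ℝ) {n : ℕ} (hn : 0 < n)
    (hW0 : W 0 = 0) (k : ℕ) :
    IntervalIntegrable (fun x : ℝ => W (⌊n * x⌋₊ / n) * deriv (fun x : ℝ => x ^ α • g x) x) volume
      ((k : ℝ) / n) ((k + 1 : ℕ) / n) ∧
    ∫ x in ((k : ℝ) / n)..((k + 1 : ℕ) / n),
      W (⌊n * x⌋₊ / n) * deriv (fun x : ℝ => x ^ α • g x) x =
      W ((k : ℕ) / n) * ((fun x : ℝ => x ^ α • g x) ((k + 1 : ℕ) / n) -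
        (fun x : ℝ => x ^ α • g x) ((k : ℝ) / n)) := by
  set f : ℝ → ℝ := fun x => x ^ α • g x with hf
  have hn' : (0 : ℝ) < n := by exact_mod_cast hn
  have hle : (k : ℝ) / n ≤ (k + 1 : ℕ) / n := by gcongr; simp
  have hae : ∀ᵐ x : ℝ, x ∈ Set.uIoc ((k : ℝ) / n) ((k + 1 : ℕ) / n) →
      W (⌊n * x⌋₊ / n) * deriv f x = W ((k : ℕ) / n) * deriv f x := by
    filter_upwards [(Set.countable_singleton (((k + 1 : ℕ) : ℝ) / n)).ae_notMem volume] with x hx hx2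
    rw [Set.uIoc_of_le hle] at hx2
    have hlt : x < ((k + 1 : ℕ) : ℝ) / n := lt_of_le_of_ne hx2.2 hx
    have h1 : (k : ℝ) < n * x := by
      have := (div_lt_iff₀ hn').1 hx2.1
      linarith
    have h2 : n * x < (k : ℝ) + 1 := by
      have := (lt_div_iff₀ hn').1 hlt
      push_cast at this
      linarith
    rw [(Nat.floor_eq_iff ((Nat.cast_nonneg k).trans h1.le)).2 ⟨h1.le, h2⟩]
  have hae' : (fun x => W ((k : ℕ) / n) * deriv f x) =ᵐ[volume.restrict
      (Set.uIoc ((k : ℝ) / n) ((k + 1 : ℕ) / n))] fun x => W (⌊n * x⌋₊ / n) * deriv f x := by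
    rw [EventuallyEq, ae_restrict_iff' measurableSet_uIoc]
    filter_upwards [hae] with x hx hx2 using (hx hx2).symm
  rw [intervalIntegral.integral_congr_ae hae]
  rcases Nat.eq_zero_or_pos k with rfl | hk
  · have h0 : W (((0 : ℕ) : ℝ≥0) / n) = 0 := by simpa using hW0
    rw [h0] at hae' ⊢
    simp only [zero_mul] at hae' ⊢
    refine ⟨?_, by simp⟩
    exact (intervalIntegrable_const (c := (0 : ℝ))).congr_ae hae'
  · have hk' : (0 : ℝ) < k / n := by positivity
    have hsub : Set.uIcc ((k : ℝ) / n) ((k + 1 : ℕ) / n) ⊆ Set.Ioi 0 := by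
      rw [Set.uIcc_of_le hle]
      exact fun x hx => hk'.trans_le hx.1
    have hint : IntervalIntegrable (deriv f) volume ((k : ℝ) / n) ((k + 1 : ℕ) / n) :=
      ((continuousOn_deriv_rpow_smul hg α).mono hsub).intervalIntegrable
    refine ⟨(hint.const_mul _).congr_ae hae', ?_⟩
    rw [intervalIntegral.integral_const_mul, intervalIntegral.integral_eq_sub_of_hasDerivAt
      (fun x hx => (hasDerivAt_rpow_smul (hg.differentiable one_ne_zero) α
        (hsub hx)).differentiableAt.hasDerivAt) hint]

/-- Summation by parts turns the Riemann–Stieltjes sum into the pathwise integral against the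
discretised path. -/
theorem stieltjesSum_eq (hg : ContDiff ℝ 1 g) (α : ℝ) {n : ℕ} (hn : 0 < n) (hW0 : W 0 = 0) :
    stieltjesSum (fun x : ℝ => x ^ α • g x) n W = W 1 • (fun x : ℝ => x ^ α • g x) 1 -
      ∫ x in (0 : ℝ)..1, W (⌊n * x⌋₊ / n) * deriv (fun x : ℝ => x ^ α • g x) x := by
  have hn' : (n : ℝ) ≠ 0 := by exact_mod_cast hn.ne'
  have hn'' : (n : ℝ≥0) ≠ 0 := by exact_mod_cast hn.ne'
  have h1 := intervalIntegral.sum_integral_adjacent_intervals (μ := volume) (n := n)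
    (a := fun k : ℕ => (k : ℝ) / n)
    (fun k _ => (integral_comp_floor_mul_deriv hg α hn hW0 k).1)
  simp only [fun k => (integral_comp_floor_mul_deriv hg α hn hW0 k).2] at h1
  simp only [Nat.cast_zero, zero_div, div_self hn'] at h1
  set f : ℝ → ℝ := fun x => x ^ α • g x with hf
  rw [← h1, eq_sub_iff_add_eq, stieltjesSum, ← Finset.sum_add_distrib]
  have h2 := Finset.sum_range_sub (fun i : ℕ => W ((i : ℕ) / n) * f ((i : ℝ) / n)) n
  simp only [div_self hn', div_self hn'', Nat.cast_zero, zero_div, hW0, zero_mul, sub_zero] at h2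
  rw [smul_eq_mul, ← h2]
  refine Finset.sum_congr rfl fun i _ => ?_
  ring

/-- Dominated convergence, since the discretised path obeys the same bound `O(x^γ)`. -/
theorem tendsto_stieltjesSum (hW : Continuous W) (hW0 : W 0 = 0) (hγ0 : 0 < γ) (hγ : 0 < γ + α)
    (hM : ∀ x ∈ Set.Icc (0 : ℝ) 1, |W x.toNNReal| ≤ M * x ^ γ) (hg : ContDiff ℝ 1 g) :
    Tendsto (fun n => stieltjesSum (fun x : ℝ => x ^ α • g x) n W) atTop
      (𝓝 (pathIntegral W fun x => x ^ α • g x)) := by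
  have hM0 : 0 ≤ M := by
    have := hM 1 (by simp)
    rw [Real.one_rpow, mul_one] at this
    exact (abs_nonneg _).trans this
  set f : ℝ → ℝ := fun x => x ^ α • g x with hf
  have hcoe : ∀ (n : ℕ) (x : ℝ), W ((⌊n * x⌋₊ : ℝ≥0) / n) = W ((⌊n * x⌋₊ : ℝ) / n).toNNReal := by
    intro n x
    rw [Real.toNNReal_div (Nat.cast_nonneg _), Real.toNNReal_natCast, Real.toNNReal_natCast]
  have hev : (fun n : ℕ => W 1 • f 1 - ∫ x in (0 : ℝ)..1, W (⌊n * x⌋₊ / n) * deriv f x) =ᶠ[atTop]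
      fun n : ℕ => stieltjesSum f n W := by
    filter_upwards [eventually_gt_atTop 0] with n hn using (stieltjesSum_eq hg α hn hW0).symm
  refine Tendsto.congr' hev (Tendsto.const_sub _ ?_)
  obtain ⟨K, hK, hKb⟩ := exists_norm_deriv_rpow_smul_le hg α
  have hWc : Continuous fun x : ℝ => W x.toNNReal := hW.comp continuous_real_toNNReal
  refine intervalIntegral.tendsto_integral_filter_of_dominated_convergence
    (fun x => M * K * x ^ (γ + α - 1)) (Eventually.of_forall fun n => ?_)
    (Eventually.of_forall fun n => Eventually.of_forall fun x hx => ?_)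
    (intervalIntegrable_rpow_add_sub_one hγ _) (Eventually.of_forall fun x hx => ?_)
  · rw [Set.uIoc_of_le zero_le_one]
    refine AEStronglyMeasurable.mul ?_ (((continuousOn_deriv_rpow_smul hg α).mono
      Set.Ioc_subset_Ioi_self).aestronglyMeasurable measurableSet_Ioc)
    simp only [hcoe]
    refine (hWc.measurable.comp ?_).aestronglyMeasurable
    exact ((measurable_from_nat (f := fun k : ℕ => (k : ℝ))).comp
      (Nat.measurable_floor.comp (by fun_prop))).div_const _
  · rw [Set.uIoc_of_le zero_le_one] at hx
    have h1 : (⌊n * x⌋₊ : ℝ) / n ≤ x := by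
      rcases Nat.eq_zero_or_pos n with rfl | hn
      · simpa using hx.1.le
      · have hn' : (0 : ℝ) < n := by exact_mod_cast hn
        rw [div_le_iff₀ hn', mul_comm x]
        exact Nat.floor_le (by have := hx.1; positivity)
    have h0 : 0 ≤ (⌊n * x⌋₊ : ℝ) / n := by positivity
    have h2 : |W ((⌊n * x⌋₊ : ℝ) / n).toNNReal| ≤ M * x ^ γ :=
      (hM _ ⟨h0, h1.trans hx.2⟩).trans (by gcongr)
    rw [norm_mul, Real.norm_eq_abs, hcoe]
    calc |W ((⌊n * x⌋₊ : ℝ) / n).toNNReal| * ‖deriv f x‖ ≤ (M * x ^ γ) * (K * x ^ (α - 1)) :=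
          mul_le_mul h2 (hKb x hx) (norm_nonneg _) ((abs_nonneg _).trans h2)
      _ = M * K * x ^ (γ + α - 1) := by rw [add_sub_assoc, Real.rpow_add hx.1]; ring
  · rw [Set.uIoc_of_le zero_le_one] at hx
    simp only [smul_eq_mul, hcoe]
    refine Tendsto.mul_const _ ((hWc.tendsto x).comp ?_)
    have := (tendsto_nat_floor_mul_div_atTop hx.1.le).comp
      (tendsto_natCast_atTop_atTop (R := ℝ))
    refine this.congr fun n => ?_
    simp [mul_comm]

/-- Riemann sums for `∫₀¹ x^(2α) g(x)² dx`; the singularity at `0` is harmless because the nodes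
are right end points. -/
theorem tendsto_sum_sq_div (hα : -(1 / 2) < α) (hg : Continuous g) :
    Tendsto (fun n : ℕ => ∑ i ∈ Finset.range n,
      (fun x : ℝ => x ^ α • g x) ((i + 1 : ℕ) / n) ^ 2 * (n : ℝ)⁻¹) atTop
      (𝓝 (∫ x in (0 : ℝ)..1, x ^ (2 * α) * g x ^ 2)) := by
  set f : ℝ → ℝ := fun x => x ^ α • g x with hf
  obtain ⟨K, hK⟩ := isCompact_Icc.exists_bound_of_continuousOn
    (s := Set.Icc (0 : ℝ) 1) hg.continuousOn
  have hK0 : 0 ≤ K := (norm_nonneg _).trans (hK 0 (by simp))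
  have hev : (fun n : ℕ => ∫ x in (0 : ℝ)..1, f ((⌈n * x⌉₊ : ℕ) / n) ^ 2) =ᶠ[atTop]
      fun n : ℕ => ∑ i ∈ Finset.range n, f ((i + 1 : ℕ) / n) ^ 2 * (n : ℝ)⁻¹ := by
    filter_upwards [eventually_gt_atTop 0] with n hn
    rw [integral_comp_ceil hn (fun k => f (k / n) ^ 2), mul_comm, Finset.sum_mul,
      Finset.range_eq_Ico, Finset.sum_Ico_add' (fun k : ℕ => f (k / n) ^ 2 * (n : ℝ)⁻¹) 0 n 1]
    exact Finset.sum_congr (by ext; simp) fun _ _ => rfl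
  refine Tendsto.congr' hev ?_
  have hsq : ∀ y : ℝ, 0 < y → f y ^ 2 = y ^ (2 * α) * g y ^ 2 := fun y hy => by
    simp only [hf]
    rw [smul_eq_mul, mul_pow, ← Real.rpow_natCast (y ^ α), ← Real.rpow_mul hy.le]
    congr 2
    push_cast
    ring
  refine intervalIntegral.tendsto_integral_filter_of_dominated_convergence
    (fun x => (x ^ (2 * α) + 1) * K ^ 2) (Eventually.of_forall fun n => ?_)
    ?_ ?_ (Eventually.of_forall fun x hx => ?_)
  · rw [Set.uIoc_of_le zero_le_one]
    exact (intervalIntegrable_comp_ceil (m := n) (fun k => f (k / n) ^ 2) 0 1).1.aestronglyMeasurable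
  · filter_upwards [eventually_gt_atTop 0] with n hn
    refine Eventually.of_forall fun x hx => ?_
    rw [Set.uIoc_of_le zero_le_one] at hx
    have hn' : (0 : ℝ) < n := by exact_mod_cast hn
    set y : ℝ := (⌈n * x⌉₊ : ℕ) / n with hy
    have h1 : x ≤ y := by
      rw [hy, le_div_iff₀ hn', mul_comm]
      exact Nat.le_ceil _
    have h2 : y ≤ 1 := by
      rw [hy, div_le_one hn']
      have : n * x ≤ n := by nlinarith [hx.2]
      exact_mod_cast Nat.ceil_le.2 this
    have h0 : 0 < y := hx.1.trans_le h1
    have h3 : y ^ (2 * α) ≤ x ^ (2 * α) + 1 := by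
      rcases le_total 0 (2 * α) with h | h
      · have := Real.rpow_le_one h0.le h2 h
        have := Real.rpow_nonneg hx.1.le (2 * α)
        linarith
      · have := Real.rpow_le_rpow_of_nonpos hx.1 h1 h
        linarith
    rw [Real.norm_eq_abs, abs_of_nonneg (sq_nonneg _), hsq y h0]
    have h4 : g y ^ 2 ≤ K ^ 2 := by
      rw [← sq_abs]
      have := hK y ⟨h0.le, h2⟩
      exact pow_le_pow_left₀ (abs_nonneg _) this 2
    exact mul_le_mul h3 h4 (sq_nonneg _) (by have := Real.rpow_nonneg hx.1.le (2 * α); linarith)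
  · exact ((intervalIntegral.intervalIntegrable_rpow' (by linarith)).add
      intervalIntegrable_const).mul_const _
  · rw [Set.uIoc_of_le zero_le_one] at hx
    rw [← hsq x hx.1]
    have hc : ContinuousAt (fun y => f y ^ 2) x :=
      (((Real.continuousAt_rpow_const x α (Or.inl hx.1.ne')).smul hg.continuousAt)).pow 2
    refine hc.tendsto.comp ?_
    have := (tendsto_nat_ceil_mul_div_atTop hx.1.le).comp
      (tendsto_natCast_atTop_atTop (R := ℝ))
    refine this.congr fun n => ?_
    simp [mul_comm]

end StieltjesSum

/-! ### Wiener integrals -/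

section Wiener

variable {Ω : Type*} [MeasurableSpace Ω] {P : Measure Ω} {B B₁ B₂ : ℝ≥0 → Ω → ℝ} {α : ℝ}
  {g g₁ g₂ : ℝ → ℝ}

theorem measurable_stieltjesSum (f : ℝ → ℝ) (n : ℕ) : Measurable (stieltjesSum f n) := by
  unfold stieltjesSum
  fun_prop

theorem ProbabilityTheory.IsBrownianReal.hasLaw_stieltjesSum (hB : IsBrownianReal B P) (f : ℝ → ℝ)
    (n : ℕ) : HasLaw (fun ω => stieltjesSum f n fun s => B s ω) (gaussianReal 0
      (∑ i ∈ Finset.range n, f ((i + 1 : ℕ) / n) ^ 2 * (n : ℝ)⁻¹).toNNReal) P := by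
  have hmono : Monotone fun i : Fin (n + 1) => ((i : ℕ) : ℝ≥0) / n := fun i j hij => by
    have : ((i : ℕ) : ℝ≥0) ≤ (j : ℕ) := by exact_mod_cast hij
    beta_reduce
    gcongr
  have hind := hB.hasIndepIncrements n _ hmono
  have hind2 := hind.comp (fun (i : Fin n) y => f ((i + 1 : ℕ) / n) * y) fun i => by fun_prop
  have := hasLaw_gaussianReal_sum (P := P)
    (X := fun (i : Fin n) ω => f ((i + 1 : ℕ) / n) *
      (B ((i + 1 : ℕ) / n) ω - B ((i : ℕ) / n) ω))
    (v := fun i : Fin n => f ((i + 1 : ℕ) / n) ^ 2 * (n : ℝ)⁻¹)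
    (fun i => by positivity) (fun i => ?_) hind2
  · rw [Finset.sum_range]
    refine this.congr (Eventually.of_forall fun ω => ?_)
    simp only [stieltjesSum, Finset.sum_range]
  · have h1 := gaussianReal_const_mul (hB.hasLaw_sub (((i : ℕ) + 1 : ℕ) / n) ((i : ℕ) / n))
      (f ((i + 1 : ℕ) / n))
    rw [mul_zero] at h1
    refine (congrArg (fun v => HasLaw _ (gaussianReal 0 v) P) ?_).mp h1
    apply NNReal.eq
    rw [Real.coe_toNNReal _ (by positivity)]
    rw [NNReal.coe_mul, coe_nndist, Real.dist_eq]
    change _ * |(((((i : ℕ) + 1 : ℕ) : ℝ≥0) / (n : ℝ≥0) : ℝ≥0) : ℝ) -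
      ((((i : ℕ) : ℝ≥0) / (n : ℝ≥0) : ℝ≥0) : ℝ)| = _
    refine congrArg₂ _ rfl ?_
    push_cast
    rw [← sub_div, add_sub_cancel_left, one_div, abs_of_nonneg (by positivity)]

/-- An exponent `γ < 1/2` for which Brownian paths are `O(x^γ)` at `0` and `x^(γ+α)` tends
to `0`. -/
theorem exists_growth_exponent (hα : -(1 / 2) < α) : ∃ γ : ℝ, 0 < γ ∧ γ < 1 / 2 ∧ 0 < γ + α := by
  refine ⟨(max 0 (-α) + 1 / 2) / 2, ?_, ?_, ?_⟩
  · have := le_max_left 0 (-α)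
    linarith
  · have : max 0 (-α) < 1 / 2 := max_lt (by norm_num) (by linarith)
    linarith
  · have := le_max_right 0 (-α)
    linarith

/-- The almost sure properties of a Brownian path on which the pathwise integrals rest. -/
theorem ProbabilityTheory.IsBrownianReal.ae_growth (hB : IsBrownianReal B P) {γ : ℝ} (hγ : 0 < γ)
    (hγ2 : γ < 1 / 2) : ∀ᵐ ω ∂P, Continuous (fun s => B s ω) ∧ B 0 ω = 0 ∧
      ∃ M : ℝ, ∀ x ∈ Set.Icc (0 : ℝ) 1, |B x.toNNReal ω| ≤ M * x ^ γ := by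
  filter_upwards [hB.cont, hB.eval_zero_ae_eq_zero, hB.ae_exists_abs_le_rpow hγ hγ2] with
    ω h1 h2 ⟨M, _, h3⟩
  exact ⟨h1, h2, M, h3⟩

/-- The Wiener isometry for a pair of independent Brownian motions. -/
theorem hasLaw_pathIntegral_add [IsProbabilityMeasure P] (hB₁ : IsBrownianReal B₁ P)
    (hB₂ : IsBrownianReal B₂ P) (hind : IndepFun (fun ω s => B₁ s ω) (fun ω s => B₂ s ω) P)
    (hα : -(1 / 2) < α) (hg₁ : ContDiff ℝ 1 g₁) (hg₂ : ContDiff ℝ 1 g₂) :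
    HasLaw (fun ω => pathIntegral (fun s => B₁ s ω) (fun x : ℝ => x ^ α • g₁ x) +
      pathIntegral (fun s => B₂ s ω) (fun x : ℝ => x ^ α • g₂ x))
      (gaussianReal 0 (∫ x in (0 : ℝ)..1, x ^ (2 * α) * (g₁ x ^ 2 + g₂ x ^ 2)).toNNReal) P := by
  obtain ⟨γ, hγ0, hγ2, hγ⟩ := exists_growth_exponent hα
  have hint : ∀ {g : ℝ → ℝ}, ContDiff ℝ 1 g →
      IntervalIntegrable (fun x : ℝ => x ^ (2 * α) * g x ^ 2) volume 0 1 := fun hg =>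
    intervalIntegrable_rpow_mul hα (hg.continuous.pow 2)
  have hlim := (tendsto_sum_sq_div hα hg₁.continuous).add (tendsto_sum_sq_div hα hg₂.continuous)
  rw [← intervalIntegral.integral_add (hint hg₁) (hint hg₂)] at hlim
  simp only [← mul_add] at hlim
  have hnn : ∀ (f : ℝ → ℝ) (n : ℕ),
      0 ≤ ∑ i ∈ Finset.range n, f ((i + 1 : ℕ) / n) ^ 2 * (n : ℝ)⁻¹ := fun f n =>
    Finset.sum_nonneg fun i _ => by positivity
  have hlaw : ∀ n, HasLaw
      (fun ω => stieltjesSum (fun x : ℝ => x ^ α • g₁ x) n (fun s => B₁ s ω) +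
        stieltjesSum (fun x : ℝ => x ^ α • g₂ x) n (fun s => B₂ s ω)) (gaussianReal 0
      (∑ i ∈ Finset.range n, (fun x : ℝ => x ^ α • g₁ x) ((i + 1 : ℕ) / n) ^ 2 * (n : ℝ)⁻¹ +
      ∑ i ∈ Finset.range n,
        (fun x : ℝ => x ^ α • g₂ x) ((i + 1 : ℕ) / n) ^ 2 * (n : ℝ)⁻¹).toNNReal) P := fun n =>
    hasLaw_gaussianReal_add (hnn (fun x : ℝ => x ^ α • g₁ x) n)
      (hnn (fun x : ℝ => x ^ α • g₂ x) n) (hB₁.hasLaw_stieltjesSum _ n)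
      (hB₂.hasLaw_stieltjesSum _ n) (hind.comp (measurable_stieltjesSum _ n)
        (measurable_stieltjesSum _ n))
  refine hasLaw_gaussianReal_of_tendsto (fun n => add_nonneg
    (hnn (fun x : ℝ => x ^ α • g₁ x) n) (hnn (fun x : ℝ => x ^ α • g₂ x) n)) hlaw ?_ hlim
  filter_upwards [hB₁.ae_growth hγ0 hγ2, hB₂.ae_growth hγ0 hγ2] with ω ⟨h1, h2, M, h3⟩ ⟨k1, k2, N, k3⟩
  exact (tendsto_stieltjesSum h1 h2 hγ0 hγ h3 hg₁).add (tendsto_stieltjesSum k1 k2 hγ0 hγ k3 hg₂)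

theorem sum_re_mul_pathIntegral_expKernel {W : ℝ≥0 → ℝ} {ι : Type*} (s : Finset ι) (u a : ι → ℂ)
    (h : ∀ u, PathIntegrable W (expKernel α u)) :
    ∑ j ∈ s, (a j * pathIntegral W (expKernel α (u j))).re =
      pathIntegral W fun x : ℝ => x ^ α • ∑ j ∈ s, (a j * Complex.exp (u j * x)).re := by
  have h1 : ∀ j, pathIntegral W (fun x => (a j * expKernel α (u j) x).re) =
      (a j * pathIntegral W (expKernel α (u j))).re := fun j =>
    (Complex.reCLM ∘L ContinuousLinearMap.mul ℝ ℂ (a j)).pathIntegral_comp (h (u j))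
  have h2 : ∀ j, PathIntegrable W fun x => (a j * expKernel α (u j) x).re := fun j =>
    (Complex.reCLM ∘L ContinuousLinearMap.mul ℝ ℂ (a j)).pathIntegrable_comp (h (u j))
  simp only [← h1]
  rw [← pathIntegral_sum s fun j _ => h2 j]
  refine pathIntegral_congr fun x => ?_
  rw [smul_eq_mul, Finset.mul_sum]
  refine Finset.sum_congr rfl fun j _ => ?_
  rw [expKernel, mul_left_comm, Complex.re_ofReal_mul]

/-- Integration of `x^α exp(u x)` against two independent Brownian motions. -/
theorem isWienerPair_pathIntegral [IsProbabilityMeasure P] (hB₁ : IsBrownianReal B₁ P)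
    (hB₂ : IsBrownianReal B₂ P) (hind : IndepFun (fun ω s => B₁ s ω) (fun ω s => B₂ s ω) P)
    (hα : -(1 / 2) < α) :
    IsWienerPair α (fun u ω => pathIntegral (fun s => B₁ s ω) (expKernel α u))
      (fun u ω => pathIntegral (fun s => B₂ s ω) (expKernel α u)) P := by
  intro ι s u a b
  have hg : ∀ a : ι → ℂ, ContDiff ℝ 1 fun x : ℝ => ∑ j ∈ s, (a j * Complex.exp (u j * x)).re :=
    fun a => ContDiff.sum fun j _ =>
      Complex.reCLM.contDiff.comp (contDiff_const.mul (contDiff_exp_mul (u j)))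
  obtain ⟨γ, hγ0, hγ2, hγ⟩ := exists_growth_exponent hα
  refine (hasLaw_pathIntegral_add hB₁ hB₂ hind hα (hg a) (hg b)).congr ?_
  filter_upwards [hB₁.ae_growth hγ0 hγ2, hB₂.ae_growth hγ0 hγ2] with ω ⟨h1, _, M, h3⟩ ⟨k1, _, N, k3⟩
  rw [Finset.sum_add_distrib,
    sum_re_mul_pathIntegral_expKernel s u a fun u => pathIntegrable_expKernel h1 hγ h3 u,
    sum_re_mul_pathIntegral_expKernel s u b fun u => pathIntegrable_expKernel k1 hγ k3 u]

end Wiener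

/-! ### The limit theorem for the zeros -/

/-- The integral of `x^α exp(u x)` against a complex Brownian motion is a version of the Gaussian
analytic function. -/
theorem isLimitGAF_integralGAF {Ω : Type*} [MeasurableSpace Ω] {P : Measure Ω}
    [IsProbabilityMeasure P] {B₁ B₂ : ℝ≥0 → Ω → ℝ} {α : ℝ} (hB₁ : IsBrownianReal B₁ P)
    (hB₂ : IsBrownianReal B₂ P) (hind : IndepFun (fun ω s => B₁ s ω) (fun ω s => B₂ s ω) P)
    (hα : -(1 / 2) < α) (σ₁ σ₂ : ℝ) :
    IsLimitGAF σ₁ σ₂ α (fun ω => integralGAF σ₁ σ₂ α (fun s => B₁ s ω) (fun s => B₂ s ω)) P := by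
  obtain ⟨γ, hγ0, hγ2, hγ⟩ := exists_growth_exponent hα
  refine (isWienerPair_pathIntegral hB₁ hB₂ hind hα).isLimitGAF hα σ₁ σ₂ ?_
  filter_upwards [hB₁.ae_growth hγ0 hγ2, hB₂.ae_growth hγ0 hγ2] with ω ⟨h1, _, M, h3⟩ ⟨k1, _, N, k3⟩
  exact integralGAF_differentiable σ₁ σ₂ (differentiable_pathIntegral_expKernel h1 hγ h3)
    (differentiable_pathIntegral_expKernel k1 hγ k3)

theorem ae_tildeTransform_integralGAF {Ω : Type*} [MeasurableSpace Ω] {P : Measure Ω}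
    {B₁ B₂ : ℝ≥0 → Ω → ℝ} {α : ℝ} (hB₁ : IsBrownianReal B₁ P) (hB₂ : IsBrownianReal B₂ P)
    (hα : -(1 / 2) < α) (σ₁ σ₂ : ℝ) :
    ∀ᵐ ω ∂P, ∀ t : ℝ, tildeTransform (integralGAF σ₁ σ₂ α (fun s => B₁ s ω) (fun s => B₂ s ω)) t =
      integralTilde σ₁ σ₂ α (fun s => B₁ s ω) (fun s => B₂ s ω) t := by
  obtain ⟨γ, hγ0, hγ2, hγ⟩ := exists_growth_exponent hα
  filter_upwards [hB₁.ae_growth hγ0 hγ2, hB₂.ae_growth hγ0 hγ2] with ω ⟨h1, _, M, h3⟩ ⟨k1, _, N, k3⟩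
  exact fun t => tildeTransform_integralGAF σ₁ σ₂ (pathIntegrable_expKernel h1 hγ h3 _)
    (pathIntegrable_expKernel k1 hγ k3 _)

theorem proposition4p2 {Ω : Type*} [MeasurableSpace Ω] (P : Measure Ω) [IsProbabilityMeasure P]
    -- independent copies of a complex random variable
    (ξ : ℕ → Ω → ℂ) (hindep : iIndepFun ξ P) (hident : ∀ k, IdentDistrib (ξ k) (ξ 0) P P)
    -- centred, with finite second moment, not almost surely zero, and with uncorrelated real and
    -- imaginary parts
    (hL2 : MemLp (ξ 0) 2 P) (hmean : ∫ ω, ξ 0 ω ∂P = 0)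
    (σ₁ σ₂ : ℝ) (hσ₁_nonneg : 0 ≤ σ₁) (hσ₂_nonneg : 0 ≤ σ₂)
    (hσ₁ : σ₁ ^ 2 = ∫ ω, (ξ 0 ω).re ^ 2 ∂P) (hσ₂ : σ₂ ^ 2 = ∫ ω, (ξ 0 ω).im ^ 2 ∂P)
    (hσ : 0 < σ₁ ^ 2 + σ₂ ^ 2)
    (hcov : cov[fun ω => (ξ 0 ω).re, fun ω => (ξ 0 ω).im; P] = 0)
    (b : ℝ → ℝ) (α : ℝ) (hb : IsRegularlyVarying b α) (hα : -(1 / 2) < α) :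
    -- the Gaussian analytic function exists
    (∃ (Ω₀ : Type) (_ : MeasurableSpace Ω₀) (P₀ : Measure Ω₀) (_ : IsProbabilityMeasure P₀)
      (G : Ω₀ → ℂ → ℂ), IsLimitGAF σ₁ σ₂ α G P₀) ∧
    -- for every version of it: no multiple real zeros, and convergence of the zeros on `M_p(ℝ)`
    (∀ {Ω' : Type*} [MeasurableSpace Ω'] (P' : Measure Ω') [IsProbabilityMeasure P']
      (G : Ω' → ℂ → ℂ), IsLimitGAF σ₁ σ₂ α G P' →
        (∀ᵐ ω ∂P', ∀ t : ℝ, tildeTransform (G ω) t = 0 → deriv (tildeTransform (G ω)) t ≠ 0) ∧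
        TendstoInDistribution
          (fun (m : ℕ) (ω : Ω) => realZeros fun t : ℝ =>
            selfInversive b (fun k => ξ k ω) m (Complex.exp (Complex.I * t / m)))
          atTop (fun ω : Ω' => realZeros (tildeTransform (G ω))) (fun _ => P) P') ∧
    -- the stochastic-integral representation
    (∀ {Ω'' : Type*} [MeasurableSpace Ω''] (P'' : Measure Ω'') [IsProbabilityMeasure P'']
      (B₁ B₂ : ℝ≥0 → Ω'' → ℝ), IsBrownianReal B₁ P'' → IsBrownianReal B₂ P'' →
      IndepFun (fun ω s => B₁ s ω) (fun ω s => B₂ s ω) P'' →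
        -- all the pathwise integrals exist
        (∀ᵐ ω ∂P'', ∀ u : ℂ, PathIntegrable (fun s => B₁ s ω) (expKernel α u) ∧
          PathIntegrable (fun s => B₂ s ω) (expKernel α u)) ∧
        (∀ᵐ ω ∂P'', ∀ t : ℝ, PathIntegrable (fun s => B₁ s ω) (cosKernel α t) ∧
          PathIntegrable (fun s => B₂ s ω) (sinKernel α t)) ∧
        -- the integral against the complex Brownian motion is a version of the Gaussian analytic
        -- function, and its transform is the difference of real stochastic integrals
        IsLimitGAF σ₁ σ₂ α
          (fun ω => integralGAF σ₁ σ₂ α (fun s => B₁ s ω) (fun s => B₂ s ω)) P'' ∧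
        (∀ᵐ ω ∂P'', ∀ t : ℝ,
          tildeTransform (integralGAF σ₁ σ₂ α (fun s => B₁ s ω) (fun s => B₂ s ω)) t =
            integralTilde σ₁ σ₂ α (fun s => B₁ s ω) (fun s => B₂ s ω) t) ∧
        -- every version has the finite-dimensional distributions of that integral
        (∀ {Ω' : Type*} [MeasurableSpace Ω'] (P' : Measure Ω') [IsProbabilityMeasure P']
          (G : Ω' → ℂ → ℂ), IsLimitGAF σ₁ σ₂ α G P' → ∀ T : Finset ℝ,
            IdentDistrib (fun ω => T.restrict (tildeTransform (G ω)))
              (fun ω => T.restrict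
                (integralTilde σ₁ σ₂ α (fun s => B₁ s ω) (fun s => B₂ s ω))) P' P'')) := by
  refine ⟨exists_isLimitGAF hα σ₁ σ₂, ?_, ?_⟩
  · intro Ω' _ P' _ G hG
    have hsimple := hG.ae_simple_zeros hα hσ
    refine ⟨hsimple, ?_⟩
    exact tendstoInDistribution_realZeros_selfInversive hindep hident hL2 hmean hσ₁ hσ₂ hcov hb hα
      (Y := fun ω => tildeTransform (G ω))
      (fun t => hG.isGaussianProcess_tildeTransform.aemeasurable t)
      hG.ae_analyticOnNhd hsimple
      fun N c q => hG.integral_exp_sum_tildeTransform hα (Finset.range N) c q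
  · intro Ω'' _ P'' _ B₁ B₂ hB₁ hB₂ hind
    obtain ⟨γ, hγ0, hγ2, hγ⟩ := exists_growth_exponent hα
    have hB := (hB₁.ae_growth hγ0 hγ2).and (hB₂.ae_growth hγ0 hγ2)
    have hGAF := isLimitGAF_integralGAF hB₁ hB₂ hind hα σ₁ σ₂
    have htilde := ae_tildeTransform_integralGAF hB₁ hB₂ hα σ₁ σ₂
    refine ⟨?_, ?_, hGAF, htilde, fun P' _ G hG T => ?_⟩
    · filter_upwards [hB] with ω ⟨⟨h1, _, M, h3⟩, k1, _, N, k3⟩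
      exact fun u => ⟨pathIntegrable_expKernel h1 hγ h3 u, pathIntegrable_expKernel k1 hγ k3 u⟩
    · filter_upwards [hB] with ω ⟨⟨h1, _, M, h3⟩, k1, _, N, k3⟩
      exact fun t => ⟨pathIntegrable_cosKernel h1 hγ h3 t, pathIntegrable_sinKernel k1 hγ k3 t⟩
    · have h1 := hG.identDistrib_restrict_tildeTransform hα hGAF T
      have h2 : (fun ω => T.restrict (tildeTransform
          (integralGAF σ₁ σ₂ α (fun s => B₁ s ω) (fun s => B₂ s ω)))) =ᵐ[P'']
          fun ω => T.restrict (integralTilde σ₁ σ₂ α (fun s => B₁ s ω) (fun s => B₂ s ω)) := by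
        filter_upwards [htilde] with ω hω
        exact funext fun t => hω t
      exact h1.trans (IdentDistrib.of_ae_eq h1.aemeasurable_snd h2)
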